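/- **Lemma 6.1 (virial-type identity).** Let $Q$ be the ground state, i.e. the positive radial solution in $H^1(\mathbb R^2)$ of $-\Delta Q+Q-Q^3=0$, let $\Lambda Q=Q+\vec y\cdot\nabla Q$ and $F(y_1,y_2)=\int_{-\infty}^{y_1}\Lambda Q(z,y_2)\,dz$. Fix $\varphi\in C^\infty(\mathbb R)$ with $\varphi(r)=1$ for $r\le 1$ and $\varphi(r)=0$ for $r\ge 2$, and for $A\ge 1$ put $\varphi_A(y_1)=\varphi(y_1/A)$. Let $$\kappa=\frac12\int_{\mathbb R} y_2^2\Big(\int_{\mathbb R} Q_{y_2}(y_1,y_2)\,dy_1\Big)^2dy_2 .$$ There is a constant $C_3>0$, depending only on $Q$ and $\varphi$, such that the following holds. Let $u\in C([0,\infty);H^1(\mathbb R^2))$ be a (distributional) solution of $u_t+\partial_{x_1}(\Delta u+u^3)=0$, and let $\lambda>0$ and $x$ be real-valued $C^1$ functions of $s\in[0,\infty)$, where the rescaled time $s$ is given by $s=0$ at $t=0$ and $\frac{ds}{dt}=\lambda^{-3}$. Put $$\varepsilon(s,y_1,y_2)=\lambda(s)\,u\big(t(s),\lambda(s)y_1+x(s),\lambda(s)y_2\big)-Q(y_1,y_2),\qquad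 t(s)=\int_0^s\lambda(\sigma)^3\,d\sigma,$$ and suppose that $\varepsilon(s)\in H^1(\mathbb R^2)$ for all $s\ge 0$. Then for every $A\ge1$ the function $$J_A(s)=\int_{\mathbb R^2}\varepsilon(s,y_1,y_2)\,F(y_1,y_2)\,\varphi_A(y_1)\,dy_1dy_2$$ is $C^1$ on $[0,\infty)$ (one-sided derivatives at $s=0$), and for all $s\ge0$ $$\frac{d}{ds}J_A=-\frac{\lambda_s}{\lambda}(J_A-\kappa)+2\Big(1-\frac12\Big(\frac{x_s}{\lambda}-1\Big)\Big)\int_{\mathbb R^2}\varepsilon Q+R(\varepsilon,A),$$ where $$\begin{aligned}|R(\varepsilon,A)|\le C_3\Big(&\|\varepsilon\|_2^2+\|\varepsilon\|_2^2\|\varepsilon\|_{H^1}+A^{-1/2}\|\varepsilon\|_2+\Big|\frac{x_s}{\lambda}-1\Big|\big(A^{-1}+\|\varepsilon\|_2\big)\\&+\Big|\frac{\lambda_s}{\lambda}\Big|\Big(A^{-1}+\|\varepsilon\|_2+A^{1/2}\|\varepsilon\|_{L^2(y_1\ge A)}+\Big|\int_{\mathbb R^2}y_2F_{y_2}\,\varepsilon\,\varphi_A\Big|\Big)\Big).\end{aligned}$$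 -/

import Mathlib

open MeasureTheory Set Filter Topology
open scoped ContDiff

noncomputable section

namespace ZK

/-! Points of the plane are pairs `(y₁, y₂) : ℝ × ℝ`, with the product Lebesgue measure. -/

/-- Classical partial derivative in the first variable. -/
def d1 (f : ℝ × ℝ → ℝ) (y : ℝ × ℝ) : ℝ := fderiv ℝ f y (1, 0)

/-- Classical partial derivative in the second variable. -/
def d2 (f : ℝ × ℝ → ℝ) (y : ℝ × ℝ) : ℝ := fderiv ℝ f y (0, 1)

/-- The Laplacian `∂₁² + ∂₂²`. -/
def lap (f : ℝ × ℝ → ℝ) (y : ℝ × ℝ) : ℝ := d1 (d1 f) y + d2 (d2 f) y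

/-- Test functions: smooth and compactly supported. -/
def IsTest (ψ : ℝ × ℝ → ℝ) : Prop := ContDiff ℝ ∞ ψ ∧ HasCompactSupport ψ

/-- `g` is the weak derivative of `f` in the direction `v`. -/
def HasWeakDeriv (v : ℝ × ℝ) (f g : ℝ × ℝ → ℝ) : Prop :=
  LocallyIntegrable f ∧ LocallyIntegrable g ∧
    ∀ ψ : ℝ × ℝ → ℝ, IsTest ψ → ∫ y, f y * fderiv ℝ ψ y v = - ∫ y, g y * ψ y

/-- The Sobolev space `H¹(ℝ²)`: `f` and its weak first derivatives are in `L²`. -/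
def MemH1 (f : ℝ × ℝ → ℝ) : Prop :=
  MemLp f 2 volume ∧
    (∃ g, MemLp g 2 volume ∧ HasWeakDeriv (1, 0) f g) ∧
    (∃ g, MemLp g 2 volume ∧ HasWeakDeriv (0, 1) f g)

open Classical in
/-- The weak derivative of `f` in the direction `v` (unique almost everywhere; `0` if there is
none). -/
def weakDeriv (v : ℝ × ℝ) (f : ℝ × ℝ → ℝ) : ℝ × ℝ → ℝ :=
  if h : ∃ g, HasWeakDeriv v f g then h.choose else 0

/-- The norm of `L²(S)`, for a set `S` of the plane. -/
def l2NormOn (S : Set (ℝ × ℝ)) (f : ℝ × ℝ → ℝ) : ℝ :=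
  (eLpNorm f 2 (volume.restrict S)).toReal

/-- The norm of `L²(ℝ²)`. -/
def l2Norm (f : ℝ × ℝ → ℝ) : ℝ := (eLpNorm f 2 volume).toReal

/-- The norm of `H¹(ℝ²)`. -/
def h1Norm (f : ℝ × ℝ → ℝ) : ℝ :=
  √(l2Norm f ^ 2 + l2Norm (weakDeriv (1, 0) f) ^ 2 + l2Norm (weakDeriv (0, 1) f) ^ 2)

/-- `Q` is a ground state: a positive radial (classical) solution in `H¹(ℝ²)` of
`-ΔQ + Q - Q³ = 0`. -/
structure IsGroundState (Q : ℝ × ℝ → ℝ) : Prop where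
  contDiff : ContDiff ℝ 2 Q
  memH1 : MemH1 Q
  pos : ∀ y, 0 < Q y
  radial : ∀ y z : ℝ × ℝ, y.1 ^ 2 + y.2 ^ 2 = z.1 ^ 2 + z.2 ^ 2 → Q y = Q z
  eq : ∀ y, - lap Q y + Q y - Q y ^ 3 = 0

/-- `u` is a global `H¹` solution of `u_t + ∂₁(Δu + u³) = 0` on `[0, ∞)`: it is continuous in time
with values in `H¹(ℝ²)` and the equation holds in the sense of distributions at each time. -/
structure IsH1Solution (u : ℝ → ℝ × ℝ → ℝ) : Prop where
  memH1 : ∀ t, 0 ≤ t → MemH1 (u t)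
  continuous : ∀ t₀, 0 ≤ t₀ →
    Tendsto (fun t => h1Norm (fun x => u t x - u t₀ x)) (𝓝[Ici 0] t₀) (𝓝 0)
  eq : ∀ ψ : ℝ × ℝ → ℝ, IsTest ψ → ∀ t, 0 ≤ t →
    HasDerivWithinAt (fun τ => ∫ x, u τ x * ψ x)
      ((∫ x, u t x * d1 (lap ψ) x) + ∫ x, u t x ^ 3 * d1 ψ x) (Ici 0) t

/-- The scaling generator `ΛQ = Q + y · ∇Q`. -/
def scalingGen (Q : ℝ × ℝ → ℝ) (y : ℝ × ℝ) : ℝ := Q y + y.1 * d1 Q y + y.2 * d2 Q y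

/-- `F(y₁, y₂) = ∫_{-∞}^{y₁} ΛQ(z, y₂) dz`. -/
def bigF (Q : ℝ × ℝ → ℝ) (y : ℝ × ℝ) : ℝ := ∫ z in Iic y.1, scalingGen Q (z, y.2)

/-- `κ = ½ ∫ y₂² (∫ Q_{y₂}(y₁, y₂) dy₁)² dy₂`. -/
def kappa (Q : ℝ × ℝ → ℝ) : ℝ := (1 / 2) * ∫ y₂ : ℝ, y₂ ^ 2 * (∫ y₁ : ℝ, d2 Q (y₁, y₂)) ^ 2

/-- A smooth cutoff equal to `1` on `(-∞, 1]` and to `0` on `[2, ∞)`. -/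
structure IsCutoff (φ : ℝ → ℝ) : Prop where
  contDiff : ContDiff ℝ ∞ φ
  eq_one : ∀ r, r ≤ 1 → φ r = 1
  eq_zero : ∀ r, 2 ≤ r → φ r = 0

/-- `φ_A(y₁) = φ(y₁ / A)`, as a function on the plane. -/
def cutoff (φ : ℝ → ℝ) (A : ℝ) (y : ℝ × ℝ) : ℝ := φ (y.1 / A)

/-- The original time `t` as a function of the rescaled time `s`: `t(0) = 0` and
`ds/dt = 1 / lam³`, that is `dt/ds = lam³`. -/
def origTime (lam : ℝ → ℝ) (s : ℝ) : ℝ := ∫ σ in (0 : ℝ)..s, lam σ ^ 3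

/-- `ε(s, y) = lam(s) u(t(s), lam(s) y₁ + x(s), lam(s) y₂) - Q(y)`. -/
def eps (Q : ℝ × ℝ → ℝ) (u : ℝ → ℝ × ℝ → ℝ) (lam x : ℝ → ℝ) (s : ℝ) (y : ℝ × ℝ) : ℝ :=
  lam s * u (origTime lam s) (lam s * y.1 + x s, lam s * y.2) - Q y

/-- `J_A(s) = ∫ ε(s) F φ_A`. -/
def virial (Q : ℝ × ℝ → ℝ) (φ : ℝ → ℝ) (u : ℝ → ℝ × ℝ → ℝ) (lam x : ℝ → ℝ) (A s : ℝ) : ℝ :=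
  ∫ y, eps Q u lam x s y * bigF Q y * cutoff φ A y

/-- `lam_s / lam`, with the derivative on `[0, ∞)` (one-sided at `0`). -/
def scaleRate (lam : ℝ → ℝ) (s : ℝ) : ℝ := derivWithin lam (Ici 0) s / lam s

/-- `x_s / lam - 1`. -/
def shiftRate (lam x : ℝ → ℝ) (s : ℝ) : ℝ := derivWithin x (Ici 0) s / lam s - 1

end ZK

end

/-! Write v = ε + Q for the rescaled solution, ψ = F φ_A, k = ∂₁ψ, σ = λ_s/λ and τ = x_s/λ − 1. In
the variables (s, y) the equation tested against ψ reads dJ_A/ds = (∫ v Δk + ∫ v³ k − ∫ v k) − σ ∫ v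
Λψ − τ ∫ v k, and the three groups are evaluated separately.

The bracket is expanded around Q (`integral_expand`). Terms free of ε cancel by the ground state
equation. Terms linear in ε form −∫ ε Lk with L = −Δ + 1 − 3Q². Since ∂₁F = ΛQ, the function k is ΛQ
up to cutoff errors, and LΛQ = −2Q (`lap_scalingGen`) produces 2∫εQ. As F need not decay for y₁ →
+∞, the errors carrying a derivative of φ are only localized to the strip A ≤ y₁ ≤ 2A, where size
A⁻¹ and L² norm √A of the strip combine to A^{-1/2} (`exists_linear_le`). Quadratic and cubic terms
need only a bound on sup |k| uniform in A and the cubic Gagliardo–Nirenberg inequality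
(`exists_nonlinear_le`).

In the τ term, ∫ QΛQ = 0 leaves O(A⁻¹ + ‖ε‖₂) (`exists_shift_le`). In the σ term, Λ is
antisymmetric, so ∫ QΛψ = −∫ ΛQ ψ is close to −∫ ΛQ F = −κ: on each horizontal line ΛQ·F is the
derivative of F²/2, and ∫ ΛQ dy₁ = y₂ ∫ ∂₂Q dy₁ (`integral_scalingGen_mul_bigF`, `exists_scale_le`).

Two preparations make this rigorous. First, Q is only assumed C², positive, radial and in H¹;
smoothness and decay of all derivatives come from the radial equation alone, through the function P
with ∇Q = P y (`contDiff_nat`, `exists_exp_bound`, `decayN`). Hence ψ is a Schwartz function.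
Second, u solves the equation only against compactly supported test functions. Truncation extends
this to Schwartz functions (`hasDerivWithinAt_rapid`), Ladyzhenskaya's inequality makes u³
continuous in time with values in L¹, and the moving frame is put on the test function, which is
smooth, rather than on u (`hasDerivWithinAt_pairing`). -/

noncomputable section

namespace ZK

/-! ### Calculus of the classical partial derivatives. -/

section Calculus

variable {f g : ℝ × ℝ → ℝ}

lemma fderiv_eq_d1_d2 (f : ℝ × ℝ → ℝ) (y v : ℝ × ℝ) :
    fderiv ℝ f y v = v.1 * d1 f y + v.2 * d2 f y := by
  have : v = v.1 • ((1, 0) : ℝ × ℝ) + v.2 • ((0, 1) : ℝ × ℝ) := by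
    ext <;> simp
  conv_lhs => rw [this]
  rw [map_add, map_smul, map_smul]
  simp [d1, d2]

lemma norm_fderiv_le (f : ℝ × ℝ → ℝ) (y : ℝ × ℝ) : ‖fderiv ℝ f y‖ ≤ |d1 f y| + |d2 f y| := by
  refine ContinuousLinearMap.opNorm_le_bound _ (by positivity) fun v => ?_
  rw [fderiv_eq_d1_d2]
  have h1 : |v.1| ≤ ‖v‖ := norm_fst_le v
  have h2 : |v.2| ≤ ‖v‖ := norm_snd_le v
  calc ‖v.1 * d1 f y + v.2 * d2 f y‖ ≤ |v.1| * |d1 f y| + |v.2| * |d2 f y| := by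
        rw [← abs_mul, ← abs_mul]; exact abs_add_le _ _
    _ ≤ ‖v‖ * |d1 f y| + ‖v‖ * |d2 f y| := by gcongr
    _ = _ := by ring

lemma d1_contDiff (hf : ContDiff ℝ ∞ f) : ContDiff ℝ ∞ (d1 f) :=
  (hf.fderiv_right (m := ∞) (by simp)).clm_apply contDiff_const

lemma d2_contDiff (hf : ContDiff ℝ ∞ f) : ContDiff ℝ ∞ (d2 f) :=
  (hf.fderiv_right (m := ∞) (by simp)).clm_apply contDiff_const

lemma smooth_differentiable (hf : ContDiff ℝ ∞ f) : Differentiable ℝ f :=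
  hf.differentiable (by simp)

lemma lap_contDiff (hf : ContDiff ℝ ∞ f) : ContDiff ℝ ∞ (lap f) :=
  (d1_contDiff (d1_contDiff hf)).add (d2_contDiff (d2_contDiff hf))

lemma d1_add (hf : Differentiable ℝ f) (hg : Differentiable ℝ g) :
    d1 (fun y => f y + g y) = fun y => d1 f y + d1 g y := by
  funext y
  simp only [d1]
  rw [fderiv_fun_add (hf y) (hg y)]; rfl

lemma d2_add (hf : Differentiable ℝ f) (hg : Differentiable ℝ g) :
    d2 (fun y => f y + g y) = fun y => d2 f y + d2 g y := by
  funext y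
  simp only [d2]
  rw [fderiv_fun_add (hf y) (hg y)]; rfl

lemma d1_mul (hf : Differentiable ℝ f) (hg : Differentiable ℝ g) :
    d1 (fun y => f y * g y) = fun y => f y * d1 g y + d1 f y * g y := by
  funext y
  simp only [d1]
  rw [fderiv_fun_mul (hf y) (hg y)]; simp; ring

lemma d2_mul (hf : Differentiable ℝ f) (hg : Differentiable ℝ g) :
    d2 (fun y => f y * g y) = fun y => f y * d2 g y + d2 f y * g y := by
  funext y
  simp only [d2]
  rw [fderiv_fun_mul (hf y) (hg y)]; simp; ring

lemma d1_const_mul (c : ℝ) (hf : Differentiable ℝ f) :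
    d1 (fun y => c * f y) = fun y => c * d1 f y := by
  funext y
  simp only [d1]
  rw [fderiv_const_mul (hf y)]; rfl

lemma d2_const_mul (c : ℝ) (hf : Differentiable ℝ f) :
    d2 (fun y => c * f y) = fun y => c * d2 f y := by
  funext y
  simp only [d2]
  rw [fderiv_const_mul (hf y)]; rfl

lemma d1_fst : d1 (fun y => y.1) = fun _ => 1 := by
  funext y; simp [d1, fderiv_fst]

lemma d2_fst : d2 (fun y => y.1) = fun _ => 0 := by
  funext y; simp [d2, fderiv_fst]

lemma d1_snd : d1 (fun y => y.2) = fun _ => 0 := by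
  funext y; simp [d1, fderiv_snd]

lemma d2_snd : d2 (fun y => y.2) = fun _ => 1 := by
  funext y; simp [d2, fderiv_snd]

lemma differentiable_fst' : Differentiable ℝ (fun y : ℝ × ℝ => y.1) := differentiable_fst
lemma differentiable_snd' : Differentiable ℝ (fun y : ℝ × ℝ => y.2) := differentiable_snd

lemma d1_d2_comm (hf : ContDiff ℝ ∞ f) : d1 (d2 f) = d2 (d1 f) := by
  funext y
  have hs : IsSymmSndFDerivAt ℝ f y := (hf.of_le (m := 2) (by norm_cast)).contDiffAt.isSymmSndFDerivAt (by simp)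
  have hd : DifferentiableAt ℝ (fderiv ℝ f) y :=
    (hf.fderiv_right (m := ∞) (by simp)).differentiable (by simp) y
  have key : ∀ v w : ℝ × ℝ, fderiv ℝ (fun z => fderiv ℝ f z v) y w
      = fderiv ℝ (fderiv ℝ f) y w v := by
    intro v w
    rw [fderiv_clm_apply hd (differentiableAt_const v)]
    simp
  change fderiv ℝ (fun z => fderiv ℝ f z (0, 1)) y (1, 0)
    = fderiv ℝ (fun z => fderiv ℝ f z (1, 0)) y (0, 1)
  rw [key, key]
  exact hs _ _

lemma d1_lap (hf : ContDiff ℝ ∞ f) : d1 (lap f) = lap (d1 f) := by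
  have h1 := d1_contDiff (d1_contDiff hf)
  have h2 := d2_contDiff (d2_contDiff hf)
  have : d1 (lap f) = fun y => d1 (d1 (d1 f)) y + d1 (d2 (d2 f)) y :=
    d1_add (smooth_differentiable h1) (smooth_differentiable h2)
  rw [this, d1_d2_comm (d2_contDiff hf), d1_d2_comm hf]
  rfl

lemma d1_comp_smul_add (hf : Differentiable ℝ f) (c : ℝ) (p : ℝ × ℝ) :
    d1 (fun y => f (c • y + p)) = fun y => c * d1 f (c • y + p) := by
  funext y
  have h : HasFDerivAt (fun y : ℝ × ℝ => f (c • y + p))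
      ((fderiv ℝ f (c • y + p)).comp (c • ContinuousLinearMap.id ℝ (ℝ × ℝ))) y :=
    (hf _).hasFDerivAt.comp y (((hasFDerivAt_id y).const_smul c).add_const p)
  simp [d1, h.fderiv]

lemma d2_comp_smul_add (hf : Differentiable ℝ f) (c : ℝ) (p : ℝ × ℝ) :
    d2 (fun y => f (c • y + p)) = fun y => c * d2 f (c • y + p) := by
  funext y
  have h : HasFDerivAt (fun y : ℝ × ℝ => f (c • y + p))
      ((fderiv ℝ f (c • y + p)).comp (c • ContinuousLinearMap.id ℝ (ℝ × ℝ))) y :=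
    (hf _).hasFDerivAt.comp y (((hasFDerivAt_id y).const_smul c).add_const p)
  simp [d2, h.fderiv]

lemma d1_fst_comp {h h' : ℝ → ℝ} (hh : ∀ r, HasDerivAt h (h' r) r) (c : ℝ) :
    d1 (fun y : ℝ × ℝ => h (c * y.1)) = fun y => c * h' (c * y.1) := by
  funext y
  have : HasFDerivAt (fun y : ℝ × ℝ => h (c * y.1))
      (h' (c * y.1) • (c • ContinuousLinearMap.fst ℝ ℝ ℝ)) y :=
    (hh _).comp_hasFDerivAt y (hasFDerivAt_fst.const_mul c)
  simp [d1, this.fderiv, mul_comm]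

lemma d2_fst_comp {h h' : ℝ → ℝ} (hh : ∀ r, HasDerivAt h (h' r) r) (c : ℝ) :
    d2 (fun y : ℝ × ℝ => h (c * y.1)) = fun _ => 0 := by
  funext y
  have : HasFDerivAt (fun y : ℝ × ℝ => h (c * y.1))
      (h' (c * y.1) • (c • ContinuousLinearMap.fst ℝ ℝ ℝ)) y :=
    (hh _).comp_hasFDerivAt y (hasFDerivAt_fst.const_mul c)
  simp [d2, this.fderiv]

lemma hasDerivAt_d1 (hf : Differentiable ℝ f) (a b : ℝ) :
    HasDerivAt (fun z => f (z, b)) (d1 f (a, b)) a := by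
  exact (hf (a, b)).hasFDerivAt.comp_hasDerivAt a
    ((hasDerivAt_id a).prodMk (hasDerivAt_const a b))

end Calculus

/-! ### Smooth families with derivatives decaying against a weight. -/

section RapidFamilies

variable {ι κ : Type*} {w w₁ w₂ : ℝ × ℝ → ℝ} {f g : ι → ℝ × ℝ → ℝ}

/-- The family `f` decays faster than every power of the weight `w`, uniformly in the index. -/
def Dom (w : ℝ × ℝ → ℝ) (f : ι → ℝ × ℝ → ℝ) : Prop :=
  ∀ k : ℕ, ∃ C, ∀ i y, w y ^ k * |f i y| ≤ C

/-- The derivatives of order at most `n` decay faster than every power of `w`. -/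
def DecayN (w : ℝ × ℝ → ℝ) : ℕ → (ι → ℝ × ℝ → ℝ) → Prop
  | 0, f => Dom w f
  | n + 1, f => Dom w f ∧ DecayN w n (fun i => d1 (f i)) ∧ DecayN w n (fun i => d2 (f i))

/-- A family of smooth functions all of whose derivatives decay faster than every power of the
weight `w`, uniformly in the index. -/
structure RapidFam (w : ℝ × ℝ → ℝ) (f : ι → ℝ × ℝ → ℝ) : Prop where
  smooth : ∀ i, ContDiff ℝ ∞ (f i)
  decay : ∀ n, DecayN w n f

lemma DecayN.pred : ∀ {n : ℕ} {f : ι → ℝ × ℝ → ℝ}, DecayN w (n + 1) f → DecayN w n f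
  | 0, _, h => h.1
  | _ + 1, _, h => ⟨h.1, h.2.1.pred, h.2.2.pred⟩

lemma Dom.add (hw : ∀ y, 0 ≤ w y) (hf : Dom w f) (hg : Dom w g) :
    Dom w (fun i y => f i y + g i y) := by
  intro k
  obtain ⟨C, hC⟩ := hf k
  obtain ⟨D, hD⟩ := hg k
  refine ⟨C + D, fun i y => ?_⟩
  have := pow_nonneg (hw y) k
  calc w y ^ k * |f i y + g i y| ≤ w y ^ k * (|f i y| + |g i y|) := by
        gcongr; exact abs_add_le _ _
    _ ≤ C + D := by rw [mul_add]; exact add_le_add (hC i y) (hD i y)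

/-- The factors may decay in complementary regions; only the product of their weights has to
dominate `w`. This is why the weight is a parameter. -/
lemma Dom.mul (hw : ∀ y, 0 ≤ w y) (h1 : ∀ y, 0 ≤ w₁ y) (h2 : ∀ y, 0 ≤ w₂ y)
    (h : ∀ y, w y ≤ w₁ y * w₂ y) (hf : Dom w₁ f) (hg : Dom w₂ g) :
    Dom w (fun i y => f i y * g i y) := by
  intro k
  obtain ⟨C, hC⟩ := hf k
  obtain ⟨D, hD⟩ := hg k
  refine ⟨C * D, fun i y => ?_⟩
  have h1' := pow_nonneg (h1 y) k
  have h2' := pow_nonneg (h2 y) k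
  calc w y ^ k * |f i y * g i y| ≤ (w₁ y * w₂ y) ^ k * |f i y * g i y| := by
        gcongr; exacts [hw y, h y]
    _ = (w₁ y ^ k * |f i y|) * (w₂ y ^ k * |g i y|) := by rw [abs_mul, mul_pow]; ring
    _ ≤ C * D := by
        have := hC i y
        exact mul_le_mul (hC i y) (hD i y) (by positivity) (le_trans (by positivity) this)

lemma Dom.mono (hw : ∀ y, 0 ≤ w y) (h : ∀ y, w y ≤ w₁ y) (hf : Dom w₁ f) : Dom w f := by
  intro k
  obtain ⟨C, hC⟩ := hf k
  refine ⟨C, fun i y => le_trans ?_ (hC i y)⟩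
  gcongr
  exacts [hw y, h y]

lemma Dom.of_le (hw : ∀ y, 0 ≤ w y) (hf : Dom w f) (C : ℝ) (h : ∀ i y, |g i y| ≤ C * |f i y|) :
    Dom w g := by
  intro k
  obtain ⟨D, hD⟩ := hf k
  refine ⟨|C| * D, fun i y => ?_⟩
  have := pow_nonneg (hw y) k
  calc w y ^ k * |g i y| ≤ w y ^ k * (|C| * |f i y|) := by
        gcongr
        exact (h i y).trans (by gcongr; exact le_abs_self C)
    _ = |C| * (w y ^ k * |f i y|) := by ring
    _ ≤ |C| * D := by gcongr; exact hD i y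

/-- A coordinate costs one power of the weight, which decay against every power can afford. -/
lemma Dom.coord_mul (hw : ∀ y, 0 ≤ w y) {c : ℝ × ℝ → ℝ} (hc : ∀ y, |c y| ≤ w y) (hf : Dom w f) :
    Dom w (fun i y => c y * f i y) := by
  intro k
  obtain ⟨C, hC⟩ := hf (k + 1)
  refine ⟨C, fun i y => le_trans ?_ (hC i y)⟩
  have := pow_nonneg (hw y) k
  rw [abs_mul, pow_succ]
  calc w y ^ k * (|c y| * |f i y|) ≤ w y ^ k * (w y * |f i y|) := by
        gcongr; exact hc y
    _ = _ := by ring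

lemma DecayN.add (hw : ∀ y, 0 ≤ w y) {n : ℕ} : ∀ {f g : ι → ℝ × ℝ → ℝ},
    (∀ i, ContDiff ℝ ∞ (f i)) → (∀ i, ContDiff ℝ ∞ (g i)) →
    DecayN w n f → DecayN w n g → DecayN w n (fun i y => f i y + g i y) := by
  induction n with
  | zero => intro f g _ _ h1 h2; exact Dom.add hw h1 h2
  | succ n ih =>
    intro f g hf hg h1 h2
    refine ⟨Dom.add hw h1.1 h2.1, ?_, ?_⟩
    · simp_rw [fun i => d1_add (smooth_differentiable (hf i)) (smooth_differentiable (hg i))]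
      exact ih (fun i => d1_contDiff (hf i)) (fun i => d1_contDiff (hg i)) h1.2.1 h2.2.1
    · simp_rw [fun i => d2_add (smooth_differentiable (hf i)) (smooth_differentiable (hg i))]
      exact ih (fun i => d2_contDiff (hf i)) (fun i => d2_contDiff (hg i)) h1.2.2 h2.2.2

/-- Leibniz rule and induction on the order; `DecayN.pred` lowers the order of the factor that is
not differentiated. -/
lemma DecayN.mul (hw : ∀ y, 0 ≤ w y) (h1 : ∀ y, 0 ≤ w₁ y) (h2 : ∀ y, 0 ≤ w₂ y)
    (h : ∀ y, w y ≤ w₁ y * w₂ y) {n : ℕ} : ∀ {f g : ι → ℝ × ℝ → ℝ},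
    (∀ i, ContDiff ℝ ∞ (f i)) → (∀ i, ContDiff ℝ ∞ (g i)) →
    DecayN w₁ n f → DecayN w₂ n g → DecayN w n (fun i y => f i y * g i y) := by
  induction n with
  | zero => intro f g _ _ hf hg; exact Dom.mul hw h1 h2 h hf hg
  | succ n ih =>
    intro f g hf hg hf' hg'
    refine ⟨Dom.mul hw h1 h2 h hf'.1 hg'.1, ?_, ?_⟩
    · simp_rw [fun i => d1_mul (smooth_differentiable (hf i)) (smooth_differentiable (hg i))]
      exact DecayN.add hw (fun i => (hf i).mul (d1_contDiff (hg i)))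
        (fun i => (d1_contDiff (hf i)).mul (hg i))
        (ih hf (fun i => d1_contDiff (hg i)) hf'.pred hg'.2.1)
        (ih (fun i => d1_contDiff (hf i)) hg hf'.2.1 hg'.pred)
    · simp_rw [fun i => d2_mul (smooth_differentiable (hf i)) (smooth_differentiable (hg i))]
      exact DecayN.add hw (fun i => (hf i).mul (d2_contDiff (hg i)))
        (fun i => (d2_contDiff (hf i)).mul (hg i))
        (ih hf (fun i => d2_contDiff (hg i)) hf'.pred hg'.2.2)
        (ih (fun i => d2_contDiff (hf i)) hg hf'.2.2 hg'.pred)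

lemma DecayN.mono (hw : ∀ y, 0 ≤ w y) (h : ∀ y, w y ≤ w₁ y) : ∀ {n : ℕ} {f : ι → ℝ × ℝ → ℝ},
    DecayN w₁ n f → DecayN w n f
  | 0, _, hf => Dom.mono hw h hf
  | _ + 1, _, hf => ⟨Dom.mono hw h hf.1, hf.2.1.mono hw h, hf.2.2.mono hw h⟩

lemma DecayN.zero {n : ℕ} : DecayN w n (fun (_ : ι) (_ : ℝ × ℝ) => (0 : ℝ)) := by
  have h0 : Dom w (fun (_ : ι) (_ : ℝ × ℝ) => (0 : ℝ)) := fun k => ⟨0, fun i y => by simp⟩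
  induction n with
  | zero => exact h0
  | succ n ih =>
    have e1 : d1 (fun _ => (0 : ℝ)) = fun _ => 0 := by funext y; simp [d1]
    have e2 : d2 (fun _ => (0 : ℝ)) = fun _ => 0 := by funext y; simp [d2]
    refine ⟨h0, ?_, ?_⟩
    · simpa only [e1] using ih
    · simpa only [e2] using ih

lemma DecayN.const_mul (hw : ∀ y, 0 ≤ w y) {c : ι → ℝ} {M : ℝ} (hc : ∀ i, |c i| ≤ M) {n : ℕ} :
    ∀ {f : ι → ℝ × ℝ → ℝ}, (∀ i, ContDiff ℝ ∞ (f i)) →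
    DecayN w n f → DecayN w n (fun i y => c i * f i y) := by
  have h0 : ∀ {f : ι → ℝ × ℝ → ℝ}, Dom w f → Dom w (fun i y => c i * f i y) := fun hf =>
    hf.of_le hw M fun i y => by rw [abs_mul]; gcongr; exact hc i
  induction n with
  | zero => intro f _ h; exact h0 h
  | succ n ih =>
    intro f hf h
    refine ⟨h0 h.1, ?_, ?_⟩
    · simp_rw [fun i => d1_const_mul (c i) (smooth_differentiable (hf i))]
      exact ih (fun i => d1_contDiff (hf i)) h.2.1
    · simp_rw [fun i => d2_const_mul (c i) (smooth_differentiable (hf i))]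
      exact ih (fun i => d2_contDiff (hf i)) h.2.2

lemma DecayN.fst_mul (hw : ∀ y, 0 ≤ w y) (hc : ∀ y : ℝ × ℝ, |y.1| ≤ w y) {n : ℕ} :
    ∀ {f : ι → ℝ × ℝ → ℝ}, (∀ i, ContDiff ℝ ∞ (f i)) →
    DecayN w n f → DecayN w n (fun i y => y.1 * f i y) := by
  induction n with
  | zero => intro f _ h; exact Dom.coord_mul hw hc h
  | succ n ih =>
    intro f hf h
    refine ⟨Dom.coord_mul hw hc h.1, ?_, ?_⟩
    · simp_rw [fun i => d1_mul differentiable_fst' (smooth_differentiable (hf i)), d1_fst]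
      refine DecayN.add hw (fun i => contDiff_fst.mul (d1_contDiff (hf i)))
        (fun i => contDiff_const.mul (hf i)) (ih (fun i => d1_contDiff (hf i)) h.2.1) ?_
      simpa using h.pred
    · simp_rw [fun i => d2_mul differentiable_fst' (smooth_differentiable (hf i)), d2_fst]
      simpa using ih (fun i => d2_contDiff (hf i)) h.2.2

lemma DecayN.snd_mul (hw : ∀ y, 0 ≤ w y) (hc : ∀ y : ℝ × ℝ, |y.2| ≤ w y) {n : ℕ} :
    ∀ {f : ι → ℝ × ℝ → ℝ}, (∀ i, ContDiff ℝ ∞ (f i)) →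
    DecayN w n f → DecayN w n (fun i y => y.2 * f i y) := by
  induction n with
  | zero => intro f _ h; exact Dom.coord_mul hw hc h
  | succ n ih =>
    intro f hf h
    refine ⟨Dom.coord_mul hw hc h.1, ?_, ?_⟩
    · simp_rw [fun i => d1_mul differentiable_snd' (smooth_differentiable (hf i)), d1_snd]
      simpa using ih (fun i => d1_contDiff (hf i)) h.2.1
    · simp_rw [fun i => d2_mul differentiable_snd' (smooth_differentiable (hf i)), d2_snd]
      refine DecayN.add hw (fun i => contDiff_snd.mul (d2_contDiff (hf i)))
        (fun i => contDiff_const.mul (hf i)) (ih (fun i => d2_contDiff (hf i)) h.2.2) ?_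
      simpa using h.pred

namespace RapidFam

protected lemma d1 (hf : RapidFam w f) : RapidFam w (fun i => d1 (f i)) :=
  ⟨fun i => d1_contDiff (hf.smooth i), fun n => (hf.decay (n + 1)).2.1⟩

protected lemma d2 (hf : RapidFam w f) : RapidFam w (fun i => d2 (f i)) :=
  ⟨fun i => d2_contDiff (hf.smooth i), fun n => (hf.decay (n + 1)).2.2⟩

protected lemma add (hw : ∀ y, 0 ≤ w y) (hf : RapidFam w f) (hg : RapidFam w g) :
    RapidFam w (fun i y => f i y + g i y) :=
  ⟨fun i => (hf.smooth i).add (hg.smooth i),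
    fun n => (hf.decay n).add hw hf.smooth hg.smooth (hg.decay n)⟩

protected lemma mul (hw : ∀ y, 0 ≤ w y) (h1 : ∀ y, 0 ≤ w₁ y) (h2 : ∀ y, 0 ≤ w₂ y)
    (h : ∀ y, w y ≤ w₁ y * w₂ y) (hf : RapidFam w₁ f) (hg : RapidFam w₂ g) :
    RapidFam w (fun i y => f i y * g i y) :=
  ⟨fun i => (hf.smooth i).mul (hg.smooth i),
    fun n => DecayN.mul hw h1 h2 h hf.smooth hg.smooth (hf.decay n) (hg.decay n)⟩

protected lemma mono (hw : ∀ y, 0 ≤ w y) (h : ∀ y, w y ≤ w₁ y) (hf : RapidFam w₁ f) :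
    RapidFam w f :=
  ⟨hf.smooth, fun n => (hf.decay n).mono hw h⟩

protected lemma const_mul (hw : ∀ y, 0 ≤ w y) {c : ι → ℝ} {M : ℝ} (hc : ∀ i, |c i| ≤ M)
    (hf : RapidFam w f) : RapidFam w (fun i y => c i * f i y) :=
  ⟨fun i => contDiff_const.mul (hf.smooth i),
    fun n => DecayN.const_mul hw hc hf.smooth (hf.decay n)⟩

protected lemma fst_mul (hw : ∀ y, 0 ≤ w y) (hc : ∀ y : ℝ × ℝ, |y.1| ≤ w y)
    (hf : RapidFam w f) : RapidFam w (fun i y => y.1 * f i y) :=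
  ⟨fun i => contDiff_fst.mul (hf.smooth i),
    fun n => DecayN.fst_mul hw hc hf.smooth (hf.decay n)⟩

protected lemma snd_mul (hw : ∀ y, 0 ≤ w y) (hc : ∀ y : ℝ × ℝ, |y.2| ≤ w y)
    (hf : RapidFam w f) : RapidFam w (fun i y => y.2 * f i y) :=
  ⟨fun i => contDiff_snd.mul (hf.smooth i),
    fun n => DecayN.snd_mul hw hc hf.smooth (hf.decay n)⟩

protected lemma lap (hw : ∀ y, 0 ≤ w y) (hf : RapidFam w f) : RapidFam w (fun i => lap (f i)) :=
  hf.d1.d1.add hw hf.d2.d2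

lemma dom (hf : RapidFam w f) : Dom w f := hf.decay 0

lemma reindex (hf : RapidFam w f) (σ : κ → ι) : RapidFam w (fun j => f (σ j)) := by
  refine ⟨fun j => hf.smooth _, fun n => ?_⟩
  have key : ∀ n (f : ι → ℝ × ℝ → ℝ), DecayN w n f → DecayN w n (fun j => f (σ j)) := by
    intro n
    induction n with
    | zero => exact fun f h k => (h k).imp fun C hC j y => hC _ y
    | succ n ih =>
      exact fun f h => ⟨fun k => (h.1 k).imp fun C hC j y => hC _ y, ih _ h.2.1, ih _ h.2.2⟩
  exact key n f (hf.decay n)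

end RapidFam

end RapidFamilies

/-! ### Schwartz functions of the plane and integration by parts. -/

/-- The weight `1 + |y₁| + |y₂|`. -/
def wt (y : ℝ × ℝ) : ℝ := 1 + |y.1| + |y.2|

lemma one_le_wt (y : ℝ × ℝ) : 1 ≤ wt y := by
  unfold wt; linarith [abs_nonneg y.1, abs_nonneg y.2]

lemma wt_pos (y : ℝ × ℝ) : 0 < wt y := one_pos.trans_le (one_le_wt y)
lemma wt_nonneg (y : ℝ × ℝ) : 0 ≤ wt y := (wt_pos y).le
lemma abs_fst_le_wt (y : ℝ × ℝ) : |y.1| ≤ wt y := by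
  unfold wt; linarith [abs_nonneg y.2]
lemma abs_snd_le_wt (y : ℝ × ℝ) : |y.2| ≤ wt y := by
  unfold wt; linarith [abs_nonneg y.1]

/-- A Schwartz function of the plane. -/
def Rapid (f : ℝ × ℝ → ℝ) : Prop := RapidFam wt (fun _ : Unit => f)

/-- The integrable majorant `(1 + y₁²)⁻¹ (1 + y₂²)⁻¹`. -/
def maj (y : ℝ × ℝ) : ℝ := (1 + y.1 ^ 2)⁻¹ * (1 + y.2 ^ 2)⁻¹

lemma maj_pos (y : ℝ × ℝ) : 0 < maj y := by unfold maj; positivity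

lemma maj_le_one (y : ℝ × ℝ) : maj y ≤ 1 := by
  unfold maj
  rw [← mul_inv]
  exact inv_le_one_of_one_le₀ (by nlinarith [sq_nonneg y.1, sq_nonneg y.2, mul_nonneg (sq_nonneg y.1) (sq_nonneg y.2)])

lemma continuous_maj : Continuous maj := by
  unfold maj
  refine Continuous.mul ?_ ?_ <;>
    exact Continuous.inv₀ (by fun_prop) (fun y => by positivity)

lemma integrable_maj : Integrable maj :=
  (integrable_inv_one_add_sq).mul_prod (integrable_inv_one_add_sq)

lemma memLp_of_abs_le {f h : ℝ × ℝ → ℝ} (hf : AEStronglyMeasurable f volume)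
    (hh : MemLp h 2 volume) (hle : ∀ y, |f y| ≤ |h y|) : MemLp f 2 volume :=
  hh.mono hf (ae_of_all _ hle)

lemma memLp_maj : MemLp maj 2 volume := by
  rw [memLp_two_iff_integrable_sq continuous_maj.aestronglyMeasurable]
  refine integrable_maj.mono' (continuous_maj.pow 2).aestronglyMeasurable (ae_of_all _ fun y => ?_)
  have h0 := maj_pos y
  have h1 := maj_le_one y
  rw [Real.norm_eq_abs, abs_of_nonneg (by positivity), sq]
  exact mul_le_of_le_one_left h0.le h1

lemma inv_wt_pow_four_le (y : ℝ × ℝ) : (wt y ^ 4)⁻¹ ≤ maj y := by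
  unfold maj
  rw [← mul_inv]
  have h1 : 1 + y.1 ^ 2 ≤ wt y ^ 2 := by
    unfold wt; nlinarith [abs_nonneg y.1, abs_nonneg y.2, sq_abs y.1, mul_nonneg (abs_nonneg y.1) (abs_nonneg y.2)]
  have h2 : 1 + y.2 ^ 2 ≤ wt y ^ 2 := by
    unfold wt; nlinarith [abs_nonneg y.1, abs_nonneg y.2, sq_abs y.2, mul_nonneg (abs_nonneg y.1) (abs_nonneg y.2)]
  refine inv_anti₀ (by positivity) ?_
  calc (1 + y.1 ^ 2) * (1 + y.2 ^ 2) ≤ wt y ^ 2 * wt y ^ 2 := by gcongr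
    _ = _ := by ring

/-- Four spare powers of the weight, two per variable, pay for the integrable majorant. The constant
does not depend on the index. -/
lemma Dom.le_maj {ι : Type*} {f : ι → ℝ × ℝ → ℝ} (hf : Dom wt f) (k : ℕ) :
    ∃ C, 0 ≤ C ∧ ∀ i y, wt y ^ k * |f i y| ≤ C * maj y := by
  obtain ⟨C, hC⟩ := hf (k + 4)
  refine ⟨|C|, abs_nonneg C, fun i y => ?_⟩
  have hw := wt_pos y
  calc wt y ^ k * |f i y| = (wt y ^ (k + 4) * |f i y|) * (wt y ^ 4)⁻¹ := by
        rw [pow_add]; field_simp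
    _ ≤ |C| * maj y := by
      gcongr
      · exact (hC i y).trans (le_abs_self C)
      · exact inv_wt_pow_four_le y

namespace Rapid

variable {f g : ℝ × ℝ → ℝ}

lemma contDiff (hf : Rapid f) : ContDiff ℝ ∞ f := hf.smooth ()
lemma differentiable (hf : Rapid f) : Differentiable ℝ f := smooth_differentiable hf.contDiff
lemma continuous (hf : Rapid f) : Continuous f := hf.contDiff.continuous

protected lemma d1 (hf : Rapid f) : Rapid (d1 f) := RapidFam.d1 hf
protected lemma d2 (hf : Rapid f) : Rapid (d2 f) := RapidFam.d2 hf
protected lemma lap (hf : Rapid f) : Rapid (lap f) := RapidFam.lap wt_nonneg hf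

protected lemma add (hf : Rapid f) (hg : Rapid g) : Rapid (fun y => f y + g y) :=
  RapidFam.add wt_nonneg hf hg

protected lemma mul (hf : Rapid f) (hg : Rapid g) : Rapid (fun y => f y * g y) :=
  RapidFam.mul wt_nonneg wt_nonneg wt_nonneg
    (fun y => le_mul_of_one_le_left (wt_nonneg y) (one_le_wt y)) hf hg

protected lemma const_mul (c : ℝ) (hf : Rapid f) : Rapid (fun y => c * f y) :=
  RapidFam.const_mul wt_nonneg (c := fun _ => c) (fun _ => le_rfl) hf

protected lemma sub (hf : Rapid f) (hg : Rapid g) : Rapid (fun y => f y - g y) := by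
  simpa [sub_eq_add_neg] using hf.add (hg.const_mul (-1))

protected lemma fst_mul (hf : Rapid f) : Rapid (fun y => y.1 * f y) :=
  RapidFam.fst_mul wt_nonneg abs_fst_le_wt hf

protected lemma snd_mul (hf : Rapid f) : Rapid (fun y => y.2 * f y) :=
  RapidFam.snd_mul wt_nonneg abs_snd_le_wt hf

lemma le_maj (hf : Rapid f) (k : ℕ) : ∃ C, 0 ≤ C ∧ ∀ y, wt y ^ k * |f y| ≤ C * maj y := by
  obtain ⟨C, h0, hC⟩ := (RapidFam.dom hf).le_maj k
  exact ⟨C, h0, fun y => hC () y⟩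

lemma abs_le_maj (hf : Rapid f) : ∃ C, 0 ≤ C ∧ ∀ y, |f y| ≤ C * maj y := by
  simpa using hf.le_maj 0

lemma bounded (hf : Rapid f) : ∃ C, 0 ≤ C ∧ ∀ y, |f y| ≤ C := by
  obtain ⟨C, h0, hC⟩ := hf.abs_le_maj
  exact ⟨C, h0, fun y => (hC y).trans (mul_le_of_le_one_right h0 (maj_le_one y))⟩

lemma integrable (hf : Rapid f) : Integrable f := by
  obtain ⟨C, h0, hC⟩ := hf.abs_le_maj
  exact (integrable_maj.const_mul C).mono' hf.continuous.aestronglyMeasurable (ae_of_all _ hC)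

lemma memLp (hf : Rapid f) : MemLp f 2 volume := by
  obtain ⟨C, h0, hC⟩ := hf.abs_le_maj
  refine memLp_of_abs_le hf.continuous.aestronglyMeasurable (memLp_maj.const_mul C) fun y => ?_
  exact (hC y).trans (le_abs_self _)

lemma integral_mul_d1 (hf : Rapid f) (hg : Rapid g) :
    ∫ y, f y * d1 g y = - ∫ y, d1 f y * g y :=
  integral_mul_fderiv_eq_neg_fderiv_mul_of_integrable (hf.d1.mul hg).integrable
    (hf.mul hg.d1).integrable (hf.mul hg).integrable
    (fun y _ => hf.differentiable y) (fun y _ => hg.differentiable y)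

lemma integral_mul_d2 (hf : Rapid f) (hg : Rapid g) :
    ∫ y, f y * d2 g y = - ∫ y, d2 f y * g y :=
  integral_mul_fderiv_eq_neg_fderiv_mul_of_integrable (hf.d2.mul hg).integrable
    (hf.mul hg.d2).integrable (hf.mul hg).integrable
    (fun y _ => hf.differentiable y) (fun y _ => hg.differentiable y)

lemma integral_mul_lap (hf : Rapid f) (hg : Rapid g) :
    ∫ y, f y * lap g y = ∫ y, lap f y * g y := by
  have h1 : ∫ y, f y * d1 (d1 g) y = ∫ y, d1 (d1 f) y * g y := by
    rw [hf.integral_mul_d1 hg.d1, hf.d1.integral_mul_d1 hg, neg_neg]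
  have h2 : ∫ y, f y * d2 (d2 g) y = ∫ y, d2 (d2 f) y * g y := by
    rw [hf.integral_mul_d2 hg.d2, hf.d2.integral_mul_d2 hg, neg_neg]
  simp only [lap, mul_add, add_mul]
  rw [integral_add (hf.mul hg.d1.d1).integrable (hf.mul hg.d2.d2).integrable,
    integral_add (hf.d1.d1.mul hg).integrable (hf.d2.d2.mul hg).integrable, h1, h2]

end Rapid

/-! ### Weak derivatives and their uniqueness. -/

section WeakDerivatives

variable {v : ℝ × ℝ} {f g g' : ℝ × ℝ → ℝ}

lemma IsTest.fderiv_apply (hf : IsTest f) (v : ℝ × ℝ) : IsTest (fun y => fderiv ℝ f y v) :=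
  ⟨(hf.1.fderiv_right (m := ∞) (by simp)).clm_apply contDiff_const, hf.2.fderiv_apply (𝕜 := ℝ) v⟩

lemma locallyIntegrable_mul_test (hf : LocallyIntegrable f) (hg : IsTest g) :
    Integrable (fun y => f y * g y) := by
  simpa [mul_comm, smul_eq_mul] using
    hf.integrable_smul_left_of_hasCompactSupport hg.1.continuous hg.2

/-- The fundamental lemma of the calculus of variations. It makes norms of the chosen representative
`weakDeriv` computable from any other one. -/
lemma HasWeakDeriv.ae_eq (h : HasWeakDeriv v f g) (h' : HasWeakDeriv v f g') : g =ᵐ[volume] g' := by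
  refine ae_eq_of_integral_contDiff_smul_eq h.2.1 h'.2.1 fun ψ hψ hc => ?_
  have := h.2.2 ψ ⟨hψ, hc⟩
  rw [h'.2.2 ψ ⟨hψ, hc⟩] at this
  simp only [smul_eq_mul, mul_comm (ψ _)]
  linarith

lemma weakDeriv_spec (h : HasWeakDeriv v f g) : HasWeakDeriv v f (weakDeriv v f) := by
  have h' : ∃ g, HasWeakDeriv v f g := ⟨g, h⟩
  rw [weakDeriv, dif_pos h']
  exact h'.choose_spec

lemma HasWeakDeriv.weakDeriv_ae_eq (h : HasWeakDeriv v f g) : weakDeriv v f =ᵐ[volume] g :=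
  (weakDeriv_spec h).ae_eq h

lemma hasWeakDeriv_of_contDiff (hf : ContDiff ℝ 1 f) (v : ℝ × ℝ) :
    HasWeakDeriv v f (fun y => fderiv ℝ f y v) := by
  have hc : Continuous (fun y => fderiv ℝ f y v) :=
    (hf.continuous_fderiv (by simp)).clm_apply continuous_const
  refine ⟨hf.continuous.locallyIntegrable, hc.locallyIntegrable, fun ψ hψ => ?_⟩
  exact integral_mul_fderiv_eq_neg_fderiv_mul_of_integrable
    (locallyIntegrable_mul_test hc.locallyIntegrable hψ)
    (locallyIntegrable_mul_test hf.continuous.locallyIntegrable (hψ.fderiv_apply v))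
    (locallyIntegrable_mul_test hf.continuous.locallyIntegrable hψ)
    (fun y _ => hf.differentiable (by simp) y) (fun y _ => smooth_differentiable hψ.1 y)

lemma MemH1.memLp_d1 (h : MemH1 f) (hf : ContDiff ℝ 1 f) : MemLp (d1 f) 2 volume := by
  obtain ⟨g, hg, hw⟩ := h.2.1
  exact (memLp_congr_ae ((hasWeakDeriv_of_contDiff hf _).ae_eq hw)).2 hg

lemma MemH1.memLp_d2 (h : MemH1 f) (hf : ContDiff ℝ 1 f) : MemLp (d2 f) 2 volume := by
  obtain ⟨g, hg, hw⟩ := h.2.2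
  exact (memLp_congr_ae ((hasWeakDeriv_of_contDiff hf _).ae_eq hw)).2 hg

end WeakDerivatives

/-! ### Smoothness of weighted averages along the segments from the origin. -/

section SegmentAverage

lemma continuous_segment_average {E : Type} [NormedAddCommGroup E] [NormedSpace ℝ E] (j : ℕ)
    {f : ℝ × ℝ → E} (hf : Continuous f) :
    Continuous (fun y : ℝ × ℝ => ∫ θ in (0 : ℝ)..1, θ ^ j • f (θ • y)) := by
  refine intervalIntegral.continuous_parametric_intervalIntegral_of_continuous' ?_ 0 1
  unfold Function.uncurry
  fun_prop

lemma hasFDerivAt_segment_average {E : Type} [NormedAddCommGroup E] [NormedSpace ℝ E] (j : ℕ)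
    {f : ℝ × ℝ → E} (hf : ContDiff ℝ 1 f) (y : ℝ × ℝ) :
    HasFDerivAt (fun y : ℝ × ℝ => ∫ θ in (0 : ℝ)..1, θ ^ j • f (θ • y))
      (∫ θ in (0 : ℝ)..1, θ ^ (j + 1) • fderiv ℝ f (θ • y)) y := by
  have hf' : Continuous (fderiv ℝ f) := hf.continuous_fderiv (by simp)
  obtain ⟨C, hC⟩ := (isCompact_closedBall (0 : ℝ × ℝ) (‖y‖ + 1)).exists_bound_of_continuousOn
    hf'.continuousOn
  refine intervalIntegral.hasFDerivAt_integral_of_dominated_of_fderiv_le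
    (F := fun z θ => θ ^ j • f (θ • z)) (F' := fun z θ => θ ^ (j + 1) • fderiv ℝ f (θ • z))
    (bound := fun _ => C)
    (Metric.ball_mem_nhds y one_pos) ?_ ?_ ?_ ?_ ?_ ?_
  · exact Eventually.of_forall fun z => (Continuous.aestronglyMeasurable (by fun_prop))
  · exact Continuous.intervalIntegrable (by fun_prop) _ _
  · exact (Continuous.aestronglyMeasurable (by fun_prop))
  · refine ae_of_all _ fun θ hθ z hz => ?_
    rw [uIoc_of_le zero_le_one] at hθ
    have h1 : ‖θ • z‖ ≤ ‖y‖ + 1 := by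
      rw [norm_smul, Real.norm_of_nonneg hθ.1.le]
      have : ‖z‖ ≤ ‖y‖ + 1 := by
        have := norm_le_norm_add_norm_sub' z y
        rw [← dist_eq_norm] at this
        linarith [Metric.mem_ball.1 hz, dist_comm y z]
      nlinarith [norm_nonneg z, hθ.1, hθ.2]
    have h2 := hC (θ • z) (by simpa using h1)
    rw [norm_smul, norm_pow, Real.norm_of_nonneg hθ.1.le]
    exact (mul_le_of_le_one_left (norm_nonneg _) (pow_le_one₀ hθ.1.le hθ.2)).trans h2
  · exact intervalIntegrable_const
  · refine ae_of_all _ fun θ _ z _ => ?_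
    have h := ((hf.differentiable (by simp) (θ • z)).hasFDerivAt.comp z
      ((hasFDerivAt_id z).const_smul θ)).const_smul (θ ^ j)
    refine h.congr_fderiv (ContinuousLinearMap.ext fun v => ?_)
    simp [pow_succ, mul_smul]

/-- The derivative is again a segment average, of `fderiv ℝ f` with one more factor θ. It takes
values in another space, so the induction must range over all `E` and `j`. -/
lemma contDiff_segment_average (n : ℕ) : ∀ {E : Type} [NormedAddCommGroup E] [NormedSpace ℝ E]
    (j : ℕ) {f : ℝ × ℝ → E}, ContDiff ℝ n f →
    ContDiff ℝ n (fun y : ℝ × ℝ => ∫ θ in (0 : ℝ)..1, θ ^ j • f (θ • y)) := by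
  induction n with
  | zero =>
    intro E _ _ j f hf
    exact contDiff_zero.2 (continuous_segment_average j (contDiff_zero.1 hf))
  | succ n ih =>
    intro E _ _ j f hf
    push_cast at hf ⊢
    refine contDiff_succ_iff_hasFDerivAt.2 ⟨_, ih (j + 1) (hf.fderiv_right le_rfl), fun y => ?_⟩
    exact hasFDerivAt_segment_average j (hf.of_le (by simp)) y

end SegmentAverage

/-! ### Smoothness of the ground state from its radial equation. -/

section Regularity

variable {Q : ℝ × ℝ → ℝ}

/-- The radial function `P` with `∇Q = P y` for a ground state `Q`. -/
def radAvg (Q : ℝ × ℝ → ℝ) (y : ℝ × ℝ) : ℝ :=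
  ∫ θ in (0 : ℝ)..1, θ ^ 1 • (Q (θ • y) - Q (θ • y) ^ 3)

namespace IsGroundState

/-- Q is constant along the rotation orbit of y; differentiate at angle 0. -/
lemma rotation (hQ : IsGroundState Q) (y : ℝ × ℝ) : y.1 * d2 Q y - y.2 * d1 Q y = 0 := by
  have hd : HasDerivAt (fun θ : ℝ => Q (Real.cos θ * y.1 - Real.sin θ * y.2,
      Real.sin θ * y.1 + Real.cos θ * y.2)) (fderiv ℝ Q y (-y.2, y.1)) 0 := by
    have h1 : HasDerivAt (fun θ : ℝ => Real.cos θ * y.1 - Real.sin θ * y.2) (-y.2) 0 := by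
      simpa using ((Real.hasDerivAt_cos 0).mul_const y.1).fun_sub
        ((Real.hasDerivAt_sin 0).mul_const y.2)
    have h2 : HasDerivAt (fun θ : ℝ => Real.sin θ * y.1 + Real.cos θ * y.2) y.1 0 := by
      simpa using ((Real.hasDerivAt_sin 0).mul_const y.1).fun_add
        ((Real.hasDerivAt_cos 0).mul_const y.2)
    have hQd : HasFDerivAt Q (fderiv ℝ Q y) (Real.cos 0 * y.1 - Real.sin 0 * y.2,
        Real.sin 0 * y.1 + Real.cos 0 * y.2) := by
      simpa using (hQ.contDiff.differentiable (by simp) y).hasFDerivAt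
    exact hQd.comp_hasDerivAt 0 (h1.prodMk h2)
  have hc : (fun θ : ℝ => Q (Real.cos θ * y.1 - Real.sin θ * y.2,
      Real.sin θ * y.1 + Real.cos θ * y.2)) = fun _ => Q y := by
    funext θ
    apply hQ.radial
    simp only
    linear_combination (y.1 ^ 2 + y.2 ^ 2) * Real.sin_sq_add_cos_sq θ
  rw [hc] at hd
  have := hd.unique (hasDerivAt_const 0 (Q y))
  rw [fderiv_eq_d1_d2] at this
  simp only at this
  linarith

lemma contDiff_d1 (hQ : IsGroundState Q) : ContDiff ℝ 1 (d1 Q) :=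
  (hQ.contDiff.fderiv_right (m := 1) (by norm_num)).clm_apply contDiff_const

lemma contDiff_d2 (hQ : IsGroundState Q) : ContDiff ℝ 1 (d2 Q) :=
  (hQ.contDiff.fderiv_right (m := 1) (by norm_num)).clm_apply contDiff_const

/-- This is (r∂_r)²Q = r²ΔQ, valid because the angular derivative vanishes. Polar coordinates are
avoided by combining the equation with the two partial derivatives of `rotation`. -/
lemma radial_deriv (hQ : IsGroundState Q) (y : ℝ × ℝ) :
    y.1 * d1 (fun y => y.1 * d1 Q y + y.2 * d2 Q y) y
      + y.2 * d2 (fun y => y.1 * d1 Q y + y.2 * d2 Q y) y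
      = (y.1 ^ 2 + y.2 ^ 2) * (Q y - Q y ^ 3) := by
  have h1 := hQ.contDiff_d1.differentiable (by simp)
  have h2 := hQ.contDiff_d2.differentiable (by simp)
  have e0 : (fun y : ℝ × ℝ => y.1 * d2 Q y + (-1) * (y.2 * d1 Q y)) = fun _ => 0 := by
    funext y; linarith [hQ.rotation y]
  have t1 : d1 (fun y : ℝ × ℝ => y.1 * d2 Q y + (-1) * (y.2 * d1 Q y)) y = 0 := by
    rw [e0]; simp [d1]
  have t2 : d2 (fun y : ℝ × ℝ => y.1 * d2 Q y + (-1) * (y.2 * d1 Q y)) y = 0 := by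
    rw [e0]; simp [d2]
  rw [d1_add (differentiable_fst'.fun_mul h2) ((differentiable_snd'.fun_mul h1).const_mul _),
    d1_const_mul _ (differentiable_snd'.fun_mul h1), d1_mul differentiable_fst' h2,
    d1_mul differentiable_snd' h1, d1_fst, d1_snd] at t1
  rw [d2_add (differentiable_fst'.fun_mul h2) ((differentiable_snd'.fun_mul h1).const_mul _),
    d2_const_mul _ (differentiable_snd'.fun_mul h1), d2_mul differentiable_fst' h2,
    d2_mul differentiable_snd' h1, d2_fst, d2_snd] at t2
  rw [d1_add (differentiable_fst'.fun_mul h1) (differentiable_snd'.fun_mul h2),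
    d2_add (differentiable_fst'.fun_mul h1) (differentiable_snd'.fun_mul h2),
    d1_mul differentiable_fst' h1, d1_mul differentiable_snd' h2,
    d2_mul differentiable_fst' h1, d2_mul differentiable_snd' h2, d1_fst, d1_snd, d2_fst, d2_snd]
  have he := hQ.eq y
  simp only [lap] at he t1 t2 ⊢
  linear_combination y.2 * t1 - y.1 * t2 - (y.1 ^ 2 + y.2 ^ 2) * he

/-- For w = y·∇Q one has θ (d/dθ) w(θy) = (r∂_r w)(θy), so `radial_deriv` integrates along the
segment from 0 to y. -/
lemma radial_eq (hQ : IsGroundState Q) (y : ℝ × ℝ) :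
    y.1 * d1 Q y + y.2 * d2 Q y = (y.1 ^ 2 + y.2 ^ 2) * radAvg Q y := by
  set w : ℝ × ℝ → ℝ := fun y => y.1 * d1 Q y + y.2 * d2 Q y with hw
  have h1 := hQ.contDiff_d1.differentiable (by simp)
  have h2 := hQ.contDiff_d2.differentiable (by simp)
  have hwd : Differentiable ℝ w := (differentiable_fst'.fun_mul h1).add (differentiable_snd'.fun_mul h2)
  have hQc := hQ.contDiff.continuous
  have hd : ∀ θ ∈ Ioo (0 : ℝ) 1, HasDerivAt (fun θ : ℝ => w (θ • y))
      ((y.1 ^ 2 + y.2 ^ 2) * (θ ^ 1 • (Q (θ • y) - Q (θ • y) ^ 3))) θ := by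
    intro θ hθ
    have h := (hwd (θ • y)).hasFDerivAt.comp_hasDerivAt θ ((hasDerivAt_id θ).smul_const y)
    refine h.congr_deriv ?_
    have e := hQ.radial_deriv (θ • y)
    rw [← hw] at e
    rw [one_smul, fderiv_eq_d1_d2]
    have hθ0 := hθ.1.ne'
    apply mul_left_cancel₀ hθ0
    simp only [Prod.smul_fst, Prod.smul_snd, smul_eq_mul, pow_one] at e ⊢
    linear_combination e
  have := intervalIntegral.integral_eq_sub_of_hasDerivAt_of_le zero_le_one
    (hwd.continuous.comp (by fun_prop : Continuous fun θ : ℝ => θ • y)).continuousOn hd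
    (Continuous.intervalIntegrable (by fun_prop) _ _)
  rw [intervalIntegral.integral_const_mul] at this
  change y.1 * d1 Q y + y.2 * d2 Q y = _
  rw [radAvg, this]
  simp [hw]

lemma continuous_radAvg (hQ : IsGroundState Q) : Continuous (radAvg Q) :=
  continuous_segment_average 1 (f := fun y => Q y - Q y ^ 3)
    (hQ.contDiff.continuous.sub (hQ.contDiff.continuous.pow 3))

/-- Off the origin the radial and angular derivatives determine the gradient; continuity of both
sides covers the origin. -/
lemma grad_eq (hQ : IsGroundState Q) (y : ℝ × ℝ) :
    d1 Q y = y.1 * radAvg Q y ∧ d2 Q y = y.2 * radAvg Q y := by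
  have hne : ∀ y ∈ ({0}ᶜ : Set (ℝ × ℝ)), d1 Q y = y.1 * radAvg Q y ∧ d2 Q y = y.2 * radAvg Q y := by
    intro y hy
    have h0 : y.1 ^ 2 + y.2 ^ 2 ≠ 0 := by
      intro h
      apply hy
      have h1 : y.1 = 0 := by nlinarith [sq_nonneg y.1, sq_nonneg y.2]
      have h2 : y.2 = 0 := by nlinarith [sq_nonneg y.1, sq_nonneg y.2]
      exact Prod.ext h1 h2
    have e1 := hQ.radial_eq y
    have e2 := hQ.rotation y
    constructor <;> apply mul_left_cancel₀ h0
    · linear_combination y.1 * e1 - y.2 * e2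
    · linear_combination y.2 * e1 + y.1 * e2
  have hdense : Dense ({0}ᶜ : Set (ℝ × ℝ)) := dense_compl_singleton 0
  have hP := hQ.continuous_radAvg
  have c1 := hQ.contDiff_d1.continuous
  have c2 := hQ.contDiff_d2.continuous
  constructor
  · exact congrFun (Continuous.ext_on hdense c1 (continuous_fst.mul hP) fun y hy => (hne y hy).1) y
  · exact congrFun (Continuous.ext_on hdense c2 (continuous_snd.mul hP) fun y hy => (hne y hy).2) y

/-- Bootstrap without elliptic theory: if Q is C^m then so is its average P, hence so is ∇Q = P y,
and Q is C^{m+1}. -/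
lemma contDiff_nat (hQ : IsGroundState Q) (n : ℕ) : ContDiff ℝ (n + 2 : ℕ) Q := by
  induction n with
  | zero => exact hQ.contDiff
  | succ n ih =>
    have hP : ContDiff ℝ (n + 2 : ℕ) (radAvg Q) :=
      contDiff_segment_average (n + 2) 1 (f := fun y => Q y - Q y ^ 3) (ih.sub (ih.pow 3))
    have : ((n + 1 + 2 : ℕ) : WithTop ℕ∞) = ((n + 2 : ℕ) : WithTop ℕ∞) + 1 := by norm_cast
    rw [this, contDiff_succ_iff_hasFDerivAt]
    refine ⟨fun y => (y.1 * radAvg Q y) • ContinuousLinearMap.fst ℝ ℝ ℝ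
      + (y.2 * radAvg Q y) • ContinuousLinearMap.snd ℝ ℝ ℝ, ?_, fun y => ?_⟩
    · exact ((contDiff_fst.mul hP).smul contDiff_const).add
        ((contDiff_snd.mul hP).smul contDiff_const)
    · have h := (hQ.contDiff.differentiable (by simp) y).hasFDerivAt
      convert h using 1
      obtain ⟨e1, e2⟩ := hQ.grad_eq y
      refine ContinuousLinearMap.ext fun v => ?_
      rw [fderiv_eq_d1_d2, e1, e2]
      simp; ring

lemma smooth (hQ : IsGroundState Q) : ContDiff ℝ ∞ Q :=
  contDiff_infty.2 fun n => (hQ.contDiff_nat n).of_le (by norm_cast; omega)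

lemma smooth_radAvg (hQ : IsGroundState Q) : ContDiff ℝ ∞ (radAvg Q) :=
  contDiff_infty.2 fun n => contDiff_segment_average n 1 (f := fun y => Q y - Q y ^ 3)
    (((hQ.smooth).sub (hQ.smooth.pow 3)).of_le (by exact_mod_cast le_top))

lemma d1_eq (hQ : IsGroundState Q) : d1 Q = fun y => y.1 * radAvg Q y :=
  funext fun y => (hQ.grad_eq y).1

lemma d2_eq (hQ : IsGroundState Q) : d2 Q = fun y => y.2 * radAvg Q y :=
  funext fun y => (hQ.grad_eq y).2

/-- Symmetry of the mixed derivatives of Q, with ∇Q = P y inserted. -/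
lemma radAvg_rotation (hQ : IsGroundState Q) (y : ℝ × ℝ) :
    y.2 * d1 (radAvg Q) y = y.1 * d2 (radAvg Q) y := by
  have h := congrFun (d1_d2_comm hQ.smooth) y
  have hP := smooth_differentiable hQ.smooth_radAvg
  rw [hQ.d1_eq, hQ.d2_eq, d1_mul differentiable_snd' hP, d2_mul differentiable_fst' hP, d1_snd,
    d2_fst] at h
  simpa using h

/-- The ground state equation in the form div(P y) = Q − Q³. -/
lemma radAvg_radial (hQ : IsGroundState Q) (y : ℝ × ℝ) :
    y.1 * d1 (radAvg Q) y + y.2 * d2 (radAvg Q) y = Q y - Q y ^ 3 - 2 * radAvg Q y := by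
  have h := hQ.eq y
  have hP := smooth_differentiable hQ.smooth_radAvg
  rw [lap, hQ.d1_eq, hQ.d2_eq, d1_mul differentiable_fst' hP, d2_mul differentiable_snd' hP, d1_fst,
    d2_snd] at h
  simp only at h
  linarith

lemma sq_mul_d1_radAvg (hQ : IsGroundState Q) (y : ℝ × ℝ) :
    (y.1 ^ 2 + y.2 ^ 2) * d1 (radAvg Q) y = y.1 * (Q y - Q y ^ 3 - 2 * radAvg Q y) := by
  linear_combination y.1 * hQ.radAvg_radial y + y.2 * hQ.radAvg_rotation y

lemma sq_mul_d2_radAvg (hQ : IsGroundState Q) (y : ℝ × ℝ) :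
    (y.1 ^ 2 + y.2 ^ 2) * d2 (radAvg Q) y = y.2 * (Q y - Q y ^ 3 - 2 * radAvg Q y) := by
  linear_combination y.2 * hQ.radAvg_radial y - y.1 * hQ.radAvg_rotation y

lemma radAvg_congr (hQ : IsGroundState Q) {y z : ℝ × ℝ}
    (h : y.1 ^ 2 + y.2 ^ 2 = z.1 ^ 2 + z.2 ^ 2) : radAvg Q y = radAvg Q z := by
  unfold radAvg
  refine intervalIntegral.integral_congr fun θ _ => ?_
  have : Q (θ • y) = Q (θ • z) := hQ.radial _ _ (by
    simp only [Prod.smul_fst, Prod.smul_snd, smul_eq_mul]; linear_combination θ ^ 2 * h)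
  simp only [this]

end IsGroundState

end Regularity

/-! ### Exponential decay of the radial profile q(r) = Q(r, 0). -/

lemma integrableOn_radial {f : ℝ × ℝ → ℝ} (hf : Integrable f) (hc : Continuous f)
    (hrad : ∀ y z : ℝ × ℝ, y.1 ^ 2 + y.2 ^ 2 = z.1 ^ 2 + z.2 ^ 2 → f y = f z) :
    IntegrableOn (fun r : ℝ => r * f (r, 0)) (Ioi 0) := by
  refine ⟨(by fun_prop : Continuous fun r : ℝ => r * f (r, 0)).aestronglyMeasurable, ?_⟩
  have h := lintegral_comp_polarCoord_symm (fun y => ‖f y‖ₑ)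
  have hfin : ∫⁻ y, ‖f y‖ₑ < ⊤ := hf.2
  rw [← h] at hfin
  have e : ∫⁻ p in polarCoord.target, ENNReal.ofReal p.1 • ‖f (polarCoord.symm p)‖ₑ
      = ∫⁻ p in Ioi (0 : ℝ) ×ˢ Ioo (-Real.pi) Real.pi, ‖p.1 * f (p.1, 0)‖ₑ := by
    rw [polarCoord_target]
    refine setLIntegral_congr_fun (measurableSet_Ioi.prod measurableSet_Ioo) fun p hp => ?_
    have hp1 : (0 : ℝ) < p.1 := hp.1
    rw [enorm_mul, Real.enorm_eq_ofReal hp1.le, smul_eq_mul]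
    congr 2
    apply hrad
    simp only [polarCoord_symm_apply]
    linear_combination p.1 ^ 2 * Real.sin_sq_add_cos_sq p.2
  rw [e, Measure.volume_eq_prod, ← Measure.prod_restrict, lintegral_prod] at hfin
  · simp only [lintegral_const, Measure.restrict_apply MeasurableSet.univ, univ_inter,
      Real.volume_Ioo] at hfin
    rw [lintegral_mul_const' _ _ ENNReal.ofReal_ne_top] at hfin
    have hpi : ENNReal.ofReal (Real.pi - -Real.pi) ≠ 0 := by
      rw [Ne, ENNReal.ofReal_eq_zero, not_le]; linarith [Real.pi_pos]
    exact (ENNReal.mul_lt_top_iff.1 hfin).elim (fun h => h.1) fun h => h.elim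
      (fun h => by unfold HasFiniteIntegral; rw [h]; simp) (fun h => absurd h hpi)
  · exact (by fun_prop : Continuous fun p : ℝ × ℝ => p.1 * f (p.1, 0)).enorm.measurable.aemeasurable

namespace IsGroundState

variable {Q : ℝ × ℝ → ℝ}

lemma hasDerivAt_profile (hQ : IsGroundState Q) (r : ℝ) :
    HasDerivAt (fun r => Q (r, 0)) (r * radAvg Q (r, 0)) r := by
  have h := hasDerivAt_d1 (smooth_differentiable hQ.smooth) r 0
  rwa [hQ.d1_eq] at h

/-- Since q' = rP, the quantity r²P is the flux r q', and this is the radial equation (r q')' = r(q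
− q³). -/
lemma hasDerivAt_flux (hQ : IsGroundState Q) (r : ℝ) :
    HasDerivAt (fun r => r ^ 2 * radAvg Q (r, 0)) (r * (Q (r, 0) - Q (r, 0) ^ 3)) r := by
  have h := ((hasDerivAt_id r).fun_pow 2).fun_mul
    (hasDerivAt_d1 (smooth_differentiable hQ.smooth_radAvg) r 0)
  refine h.congr_deriv ?_
  have e := hQ.radAvg_radial (r, 0)
  simp at e ⊢
  linear_combination r * e

/-- In polar coordinates Q ∈ H¹ says that r q² and r q'² are integrable. For r > 1 they dominate (r
q²)' = q² + 2r q q', so r q² tends to 0. -/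
lemma profile_tendsto_zero (hQ : IsGroundState Q) :
    Tendsto (fun r : ℝ => Q (r, 0)) atTop (𝓝 0) := by
  have hQc := hQ.contDiff.continuous
  have hPc := hQ.continuous_radAvg
  have i1 : IntegrableOn (fun r : ℝ => r * Q (r, 0) ^ 2) (Ioi 0) :=
    integrableOn_radial (f := fun y => Q y ^ 2) hQ.memH1.1.integrable_sq (hQc.pow 2)
      fun y z h => by simp only [hQ.radial y z h]
  have hC1 : ContDiff ℝ 1 Q := hQ.contDiff.of_le (by norm_num)
  have i2 : IntegrableOn (fun r : ℝ => r * ((r ^ 2 + 0 ^ 2) * radAvg Q (r, 0) ^ 2)) (Ioi 0) := by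
    refine integrableOn_radial (f := fun y => (y.1 ^ 2 + y.2 ^ 2) * radAvg Q y ^ 2) ?_
      (by fun_prop) fun y z h => by simp only [hQ.radAvg_congr h, h]
    have := (hQ.memH1.memLp_d1 hC1).integrable_sq.add (hQ.memH1.memLp_d2 hC1).integrable_sq
    refine this.congr (ae_of_all _ fun y => ?_)
    simp only [Pi.add_apply, hQ.d1_eq, hQ.d2_eq]
    ring
  have hsub : Ioi (1 : ℝ) ⊆ Ioi 0 := Ioi_subset_Ioi zero_le_one
  have hder : ∀ r : ℝ, HasDerivAt (fun r : ℝ => r * Q (r, 0) ^ 2)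
      (Q (r, 0) ^ 2 + 2 * r * Q (r, 0) * (r * radAvg Q (r, 0))) r := by
    intro r
    refine ((hasDerivAt_id r).fun_mul ((hQ.hasDerivAt_profile r).fun_pow 2)).congr_deriv ?_
    simp; ring
  have hint : IntegrableOn (fun r : ℝ => Q (r, 0) ^ 2
      + 2 * r * Q (r, 0) * (r * radAvg Q (r, 0))) (Ioi 1) := by
    refine (((i1.mono_set hsub).const_mul 2).add (i2.mono_set hsub)).mono'
      (Continuous.aestronglyMeasurable (by fun_prop)) ?_
    refine (ae_restrict_mem measurableSet_Ioi).mono fun r hr => ?_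
    have hr1 : (1 : ℝ) < r := hr
    simp only [Pi.add_apply, Real.norm_eq_abs]
    rw [abs_le]
    have s1 := sq_nonneg (Q (r, 0) + r * radAvg Q (r, 0))
    have s2 := sq_nonneg (Q (r, 0) - r * radAvg Q (r, 0))
    have s3 := mul_nonneg (by linarith : (0 : ℝ) ≤ r) s1
    have s4 := mul_nonneg (by linarith : (0 : ℝ) ≤ r) s2
    have s5 := mul_nonneg (by linarith : (0 : ℝ) ≤ r - 1) (sq_nonneg (Q (r, 0)))
    have s6 := sq_nonneg (Q (r, 0))
    constructor <;> nlinarith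
  have hlim := tendsto_zero_of_hasDerivAt_of_integrableOn_Ioi (fun r _ => hder r) hint
    (i1.mono_set hsub)
  have h0 : Tendsto (fun r : ℝ => Q (r, 0) ^ 2) atTop (𝓝 0) := by
    refine squeeze_zero' (Eventually.of_forall fun r => sq_nonneg _) ?_ hlim
    filter_upwards [eventually_ge_atTop (1 : ℝ)] with r hr
    exact le_mul_of_one_le_left (sq_nonneg _) hr
  have h1 := (Real.continuous_sqrt.tendsto 0).comp h0
  rw [Real.sqrt_zero] at h1
  refine h1.congr fun r => ?_
  simp [Real.sqrt_sq (hQ.pos (r, 0)).le]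

/-- The threshold 1/2 leaves room both for q − q³ > 0 and for 3/4 − q² ≥ 0. -/
lemma exists_profile_sq_le (hQ : IsGroundState Q) :
    ∃ R : ℝ, 1 ≤ R ∧ ∀ r, R ≤ r → Q (r, 0) ^ 2 ≤ 1 / 2 := by
  have h : ∀ᶠ r in atTop, Q ((r : ℝ), (0 : ℝ)) < 1 / 2 :=
    hQ.profile_tendsto_zero.eventually (gt_mem_nhds (by norm_num))
  obtain ⟨R, hR⟩ := eventually_atTop.1 h
  refine ⟨max R 1, le_max_right _ _, fun r hr => ?_⟩
  have h1 := hR r ((le_max_left _ _).trans hr)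
  have h2 := hQ.pos (r, 0)
  nlinarith

lemma flux_strictMonoOn (hQ : IsGroundState Q) {R : ℝ} (hR1 : 1 ≤ R)
    (hR : ∀ r, R ≤ r → Q (r, 0) ^ 2 ≤ 1 / 2) :
    StrictMonoOn (fun r => r ^ 2 * radAvg Q (r, 0)) (Ici R) := by
  refine strictMonoOn_of_deriv_pos (convex_Ici R)
    (fun r _ => (hQ.hasDerivAt_flux r).continuousAt.continuousWithinAt) fun r hr => ?_
  rw [interior_Ici] at hr
  have hr' : R < r := hr
  rw [(hQ.hasDerivAt_flux r).deriv]
  have h1 := hR r hr'.le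
  have h2 := hQ.pos (r, 0)
  have : 0 < Q (r, 0) * (1 - Q (r, 0) ^ 2) := mul_pos h2 (by linarith)
  exact mul_pos (by linarith) (by linarith)

/-- Were q' ≥ 0 at some r ≥ R, the increasing flux would keep q' > 0 afterwards, and q could not
fall from a positive value to 0 at infinity. -/
lemma radAvg_neg (hQ : IsGroundState Q) {R : ℝ} (hR1 : 1 ≤ R)
    (hR : ∀ r, R ≤ r → Q (r, 0) ^ 2 ≤ 1 / 2) {r : ℝ} (hr : R ≤ r) : radAvg Q (r, 0) < 0 := by
  by_contra! hcon
  have hmono : StrictMonoOn (fun s => Q (s, (0 : ℝ))) (Ici r) := by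
    refine strictMonoOn_of_deriv_pos (convex_Ici r)
      (fun s _ => (hQ.hasDerivAt_profile s).continuousAt.continuousWithinAt) fun s hs => ?_
    rw [interior_Ici] at hs
    have hs' : r < s := hs
    have hs0 : 0 < s := by linarith
    rw [(hQ.hasDerivAt_profile s).deriv]
    have h := hQ.flux_strictMonoOn hR1 hR (mem_Ici.2 hr) (mem_Ici.2 (hr.trans hs'.le)) hs'
    simp only at h
    have h0 : 0 ≤ r ^ 2 * radAvg Q (r, 0) := mul_nonneg (sq_nonneg _) hcon
    have h1 : 0 < s ^ 2 * radAvg Q (s, 0) := by linarith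
    exact mul_pos hs0 (pos_of_mul_pos_right h1 (by positivity))
  have hev : ∀ᶠ s in atTop, Q (r, 0) ≤ Q ((s : ℝ), (0 : ℝ)) :=
    (eventually_ge_atTop r).mono fun s hs =>
      hmono.monotoneOn (mem_Ici.2 le_rfl) (mem_Ici.2 hs) hs
  have := ge_of_tendsto hQ.profile_tendsto_zero hev
  linarith [hQ.pos (r, 0)]

/-- The energy E = q'² − q²/4 has E' = 2q'(3q/4 − q³ − q'/r) ≤ 0 because q' < 0. Being at least
−q²/4, which tends to 0, the decreasing E is nonnegative, so |q'| ≥ q/2. -/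
lemma deriv_profile_le (hQ : IsGroundState Q) {R : ℝ} (hR1 : 1 ≤ R)
    (hR : ∀ r, R ≤ r → Q (r, 0) ^ 2 ≤ 1 / 2) {r : ℝ} (hr : R ≤ r) :
    r * radAvg Q (r, 0) ≤ - (1 / 2) * Q (r, 0) := by
  set E : ℝ → ℝ := fun r => (r * radAvg Q (r, 0)) ^ 2 - 1 / 4 * Q (r, 0) ^ 2 with hE
  have hder : ∀ s, HasDerivAt E (2 * (s * radAvg Q (s, 0)) *
      (Q (s, 0) - Q (s, 0) ^ 3 - radAvg Q (s, 0) - 1 / 4 * Q (s, 0))) s := by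
    intro s
    have h1 := (((hasDerivAt_id s).fun_mul
      (hasDerivAt_d1 (smooth_differentiable hQ.smooth_radAvg) s 0)).fun_pow 2).fun_sub
      (((hQ.hasDerivAt_profile s).fun_pow 2).const_mul (1 / 4))
    refine h1.congr_deriv ?_
    have e := hQ.radAvg_radial (s, 0)
    simp at e ⊢
    linear_combination 2 * s * radAvg Q (s, 0) * e
  have hanti : AntitoneOn E (Ici R) := by
    refine antitoneOn_of_deriv_nonpos (convex_Ici R)
      (fun s _ => (hder s).continuousAt.continuousWithinAt)
      (fun s _ => (hder s).differentiableAt.differentiableWithinAt) fun s hs => ?_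
    rw [interior_Ici] at hs
    have hs' : R < s := hs
    have hs0 : 0 < s := by linarith
    rw [(hder s).deriv]
    have hneg := hQ.radAvg_neg hR1 hR hs'.le
    have hsq := hR s hs'.le
    have hpos := hQ.pos (s, 0)
    have h1 : 0 ≤ Q (s, 0) * (3 / 4 - Q (s, 0) ^ 2) := mul_nonneg hpos.le (by linarith)
    have h2 : s * radAvg Q (s, 0) ≤ 0 := mul_nonpos_of_nonneg_of_nonpos hs0.le hneg.le
    refine mul_nonpos_of_nonpos_of_nonneg (by linarith) ?_
    nlinarith
  have hE0 : 0 ≤ E r := by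
    have hlim : Tendsto (fun s : ℝ => - (1 / 4) * Q (s, 0) ^ 2) atTop (𝓝 0) := by
      have h := (hQ.profile_tendsto_zero.pow 2).const_mul (-(1 / 4))
      norm_num at h ⊢
      exact h
    refine le_of_tendsto hlim ((eventually_ge_atTop r).mono fun s hs => ?_)
    have h := hanti (mem_Ici.2 hr) (mem_Ici.2 (hr.trans hs)) hs
    refine le_trans ?_ h
    simp only [hE]
    nlinarith [sq_nonneg (s * radAvg Q (s, 0))]
  have hneg : r * radAvg Q (r, 0) < 0 :=
    mul_neg_of_pos_of_neg (by linarith) (hQ.radAvg_neg hR1 hR hr)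
  have hpos := hQ.pos (r, 0)
  have h2 : (1 / 2 * Q (r, 0)) ^ 2 ≤ (-(r * radAvg Q (r, 0))) ^ 2 := by
    simp only [hE] at hE0; linarith
  have := abs_le_of_sq_le_sq' h2 (by linarith)
  linarith [this.2]

/-- The inequality q' ≤ −q/2 makes q e^{r/2} decreasing. For P, the mean value theorem on [r − 1, r]
bounds −q' at some point ξ by q(r − 1), and monotonicity of the flux carries the bound from ξ to r.
-/
lemma exists_exp_bound (hQ : IsGroundState Q) : ∃ R C : ℝ, 1 ≤ R ∧ 0 ≤ C ∧ ∀ r, R ≤ r →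
    Q (r, 0) ≤ C * Real.exp (-(r / 2)) ∧ |radAvg Q (r, 0)| ≤ C * Real.exp (-(r / 2)) := by
  obtain ⟨R, hR1, hR⟩ := hQ.exists_profile_sq_le
  have hd : ∀ r, HasDerivAt (fun r => Q (r, 0) * Real.exp (r / 2))
      ((r * radAvg Q (r, 0) + 1 / 2 * Q (r, 0)) * Real.exp (r / 2)) r := by
    intro r
    refine ((hQ.hasDerivAt_profile r).fun_mul
      ((hasDerivAt_id r).div_const 2).exp).congr_deriv ?_
    simp; ring
  have hanti : AntitoneOn (fun r => Q (r, 0) * Real.exp (r / 2)) (Ici R) := by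
    refine antitoneOn_of_deriv_nonpos (convex_Ici R)
      (fun s _ => (hd s).continuousAt.continuousWithinAt)
      (fun s _ => (hd s).differentiableAt.differentiableWithinAt) fun s hs => ?_
    rw [interior_Ici] at hs
    rw [(hd s).deriv]
    exact mul_nonpos_of_nonpos_of_nonneg (by linarith [hQ.deriv_profile_le hR1 hR (le_of_lt hs)])
      (Real.exp_pos _).le
  set K := Q (R, 0) * Real.exp (R / 2) with hK
  have hK0 : 0 < K := mul_pos (hQ.pos _) (Real.exp_pos _)
  have hq : ∀ r, R ≤ r → Q (r, 0) ≤ K * Real.exp (-(r / 2)) := by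
    intro r hr
    have h := hanti (mem_Ici.2 le_rfl) (mem_Ici.2 hr) hr
    simp only at h
    rw [Real.exp_neg]
    rw [← div_eq_mul_inv, le_div_iff₀ (Real.exp_pos _)]
    exact h
  have he1 : 1 ≤ Real.exp (1 / 2) := Real.one_le_exp (by norm_num)
  -- The shift of R leaves room for the unit step back; e^{1/2} is the cost of evaluating q at r −
  -- 1.
  refine ⟨R + 1, K * Real.exp (1 / 2), by linarith, by positivity, fun r hr => ⟨?_, ?_⟩⟩
  · refine (hq r (by linarith)).trans ?_
    gcongr
    exact le_mul_of_one_le_right hK0.le he1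
  · obtain ⟨ξ, hξ, hξe⟩ := exists_hasDerivAt_eq_slope (fun r => Q (r, (0 : ℝ)))
      (fun r => r * radAvg Q (r, 0)) (by linarith : r - 1 < r)
      (fun s _ => (hQ.hasDerivAt_profile s).continuousAt.continuousWithinAt)
      fun s _ => hQ.hasDerivAt_profile s
    have hξR : R ≤ ξ := by linarith [hξ.1]
    have hmono := (hQ.flux_strictMonoOn hR1 hR).monotoneOn (mem_Ici.2 hξR)
      (mem_Ici.2 (hξR.trans hξ.2.le)) hξ.2.le
    simp only [sub_sub_cancel, div_one] at hξe hmono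
    have hneg := hQ.radAvg_neg hR1 hR (hξR.trans hξ.2.le)
    have hq1 := hq (r - 1) (by linarith)
    have hp1 := hQ.pos (r, 0)
    have he : Real.exp (-((r - 1) / 2)) = Real.exp (1 / 2) * Real.exp (-(r / 2)) := by
      rw [← Real.exp_add]; congr 1; ring
    rw [he] at hq1
    rw [abs_of_neg hneg]
    set X := K * Real.exp (1 / 2) * Real.exp (-(r / 2)) with hX
    have hX0 : 0 < X := by positivity
    have hb : -(ξ * radAvg Q (ξ, 0)) ≤ X := by rw [hξe, hX]; linarith
    have hr0 : 1 ≤ r := by linarith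
    have h1 : r ^ 2 * -radAvg Q (r, 0) ≤ r * X := by
      calc r ^ 2 * -radAvg Q (r, 0) ≤ ξ * -(ξ * radAvg Q (ξ, 0)) := by linarith
        _ ≤ ξ * X := by gcongr; linarith
        _ ≤ r * X := by gcongr; exact hξ.2.le
    have h2 : r * -radAvg Q (r, 0) ≤ X := by
      have : r * (r * -radAvg Q (r, 0)) ≤ r * X := by linarith
      exact le_of_mul_le_mul_left this (by linarith)
    nlinarith

end IsGroundState

/-! ### Decay of all derivatives of the ground state. -/

lemma wt_pow_mul_exp_le (k : ℕ) {r : ℝ} (hr : 0 ≤ r) :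
    (1 + 2 * r) ^ k * Real.exp (-(r / 2)) ≤ 4 ^ k * k.factorial * Real.exp (1 / 4) := by
  have h := Real.pow_div_factorial_le_exp (x := (1 + 2 * r) / 4) (by positivity) k
  have hk : (0 : ℝ) < k.factorial := by exact_mod_cast k.factorial_pos
  rw [div_le_iff₀ hk, div_pow, div_le_iff₀ (by positivity)] at h
  have e : Real.exp ((1 + 2 * r) / 4) * Real.exp (-(r / 2)) = Real.exp (1 / 4) := by
    rw [← Real.exp_add]; congr 1; ring
  calc (1 + 2 * r) ^ k * Real.exp (-(r / 2))
      ≤ Real.exp ((1 + 2 * r) / 4) * k.factorial * 4 ^ k * Real.exp (-(r / 2)) := by gcongr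
    _ = 4 ^ k * k.factorial * (Real.exp ((1 + 2 * r) / 4) * Real.exp (-(r / 2))) := by ring
    _ = _ := by rw [e]

lemma continuous_wt : Continuous wt := by unfold wt; fun_prop

lemma exists_bound_on_ball {f : ℝ × ℝ → ℝ} (hf : Continuous f) (k : ℕ) (R : ℝ) :
    ∃ C, ∀ y, ‖y‖ ≤ R → wt y ^ k * |f y| ≤ C := by
  obtain ⟨C, hC⟩ := (isCompact_closedBall (0 : ℝ × ℝ) R).exists_bound_of_continuousOn
    ((continuous_wt.pow k).mul hf.abs).continuousOn
  exact ⟨C, fun y hy => (le_abs_self _).trans (hC y (by simpa using hy))⟩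

lemma norm_le_sqrt (y : ℝ × ℝ) : ‖y‖ ≤ √(y.1 ^ 2 + y.2 ^ 2) := by
  rw [Prod.norm_def]
  exact max_le (Real.abs_le_sqrt (by nlinarith [sq_nonneg y.2]))
    (Real.abs_le_sqrt (by nlinarith [sq_nonneg y.1]))

lemma dom_of_radial_exp {f : ℝ × ℝ → ℝ} (hf : Continuous f)
    (hrad : ∀ y z : ℝ × ℝ, y.1 ^ 2 + y.2 ^ 2 = z.1 ^ 2 + z.2 ^ 2 → f y = f z) {R C : ℝ}
    (hC : 0 ≤ C) (h : ∀ r, R ≤ r → |f (r, 0)| ≤ C * Real.exp (-(r / 2))) :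
    Dom wt (fun _ : Unit => f) := by
  intro k
  obtain ⟨D, hD⟩ := exists_bound_on_ball hf k R
  refine ⟨max D (C * (4 ^ k * k.factorial * Real.exp (1 / 4))), fun _ y => ?_⟩
  by_cases hy : ‖y‖ ≤ R
  · exact (hD y hy).trans (le_max_left _ _)
  · refine le_trans ?_ (le_max_right _ _)
    set r := √(y.1 ^ 2 + y.2 ^ 2) with hr
    have hr0 : 0 ≤ r := Real.sqrt_nonneg _
    have hyr := norm_le_sqrt y
    have hRr : R ≤ r := by rw [← hr] at hyr; linarith
    have hfr : f y = f (r, 0) := hrad _ _ (by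
      simp only [hr]; rw [Real.sq_sqrt (by positivity)]; ring)
    have hw : wt y ≤ 1 + 2 * r := by
      have h1 : |y.1| ≤ r := (norm_fst_le y).trans hyr
      have h2 : |y.2| ≤ r := (norm_snd_le y).trans hyr
      unfold wt; linarith
    change wt y ^ k * |f y| ≤ _
    rw [hfr]
    calc wt y ^ k * |f (r, 0)| ≤ (1 + 2 * r) ^ k * (C * Real.exp (-(r / 2))) := by
          gcongr
          · exact wt_nonneg y
          · exact h r hRr
      _ = C * ((1 + 2 * r) ^ k * Real.exp (-(r / 2))) := by ring
      _ ≤ _ := mul_le_mul_of_nonneg_left (wt_pow_mul_exp_le k hr0) hC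

lemma differentiable_sqNorm : Differentiable ℝ (fun y : ℝ × ℝ => y.1 ^ 2 + y.2 ^ 2) := by fun_prop

lemma contDiff_sqNorm : ContDiff ℝ ∞ (fun y : ℝ × ℝ => y.1 ^ 2 + y.2 ^ 2) := by fun_prop

lemma d1_sqNorm : d1 (fun y : ℝ × ℝ => y.1 ^ 2 + y.2 ^ 2) = fun y => 2 * y.1 := by
  simp only [sq]
  rw [d1_add (differentiable_fst'.fun_mul differentiable_fst')
    (differentiable_snd'.fun_mul differentiable_snd'), d1_mul differentiable_fst' differentiable_fst',
    d1_mul differentiable_snd' differentiable_snd', d1_fst, d1_snd]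
  funext y; simp; ring

lemma d2_sqNorm : d2 (fun y : ℝ × ℝ => y.1 ^ 2 + y.2 ^ 2) = fun y => 2 * y.2 := by
  simp only [sq]
  rw [d2_add (differentiable_fst'.fun_mul differentiable_fst')
    (differentiable_snd'.fun_mul differentiable_snd'), d2_mul differentiable_fst' differentiable_fst',
    d2_mul differentiable_snd' differentiable_snd', d2_fst, d2_snd]
  funext y; simp; ring

/-- Outside the unit ball of the sup norm the factor is at least 1; inside, continuity suffices. -/
lemma Dom.of_sqNorm_mul {f : ℝ × ℝ → ℝ} (hf : Continuous f)
    (h : Dom wt (fun _ : Unit => fun y : ℝ × ℝ => (y.1 ^ 2 + y.2 ^ 2) * f y)) :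
    Dom wt (fun _ : Unit => f) := by
  intro k
  obtain ⟨D, hD⟩ := exists_bound_on_ball hf k 1
  obtain ⟨C, hC⟩ := h k
  refine ⟨max D C, fun _ y => ?_⟩
  by_cases hy : ‖y‖ ≤ 1
  · exact (hD y hy).trans (le_max_left _ _)
  · refine le_trans ?_ ((hC () y).trans (le_max_right _ _))
    have h1 : 1 ≤ y.1 ^ 2 + y.2 ^ 2 := by
      have := norm_le_sqrt y
      rw [Real.le_sqrt (norm_nonneg y) (by positivity)] at this
      nlinarith
    have := wt_nonneg y
    rw [abs_mul, abs_of_nonneg (by positivity : 0 ≤ y.1 ^ 2 + y.2 ^ 2)]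
    gcongr
    exact le_mul_of_one_le_left (abs_nonneg _) h1

/-- Uses |y|²∂ᵢf = ∂ᵢ(|y|²f) − 2yᵢf, where the last term is covered by the induction hypothesis
applied to f. -/
lemma DecayN.of_sqNorm_mul {n : ℕ} : ∀ {f : ℝ × ℝ → ℝ}, ContDiff ℝ ∞ f →
    DecayN wt n (fun _ : Unit => fun y : ℝ × ℝ => (y.1 ^ 2 + y.2 ^ 2) * f y) →
    DecayN wt n (fun _ : Unit => f) := by
  induction n with
  | zero => intro f hf h; exact Dom.of_sqNorm_mul hf.continuous h
  | succ n ih =>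
    intro f hf h
    have hn : DecayN wt n (fun _ : Unit => f) := ih hf h.pred
    have hfd := smooth_differentiable hf
    have hs : ContDiff ℝ ∞ (fun y : ℝ × ℝ => (y.1 ^ 2 + y.2 ^ 2) * f y) := contDiff_sqNorm.mul hf
    refine ⟨Dom.of_sqNorm_mul hf.continuous h.1, ih (d1_contDiff hf) ?_, ih (d2_contDiff hf) ?_⟩
    · have h2 := DecayN.add wt_nonneg (fun _ => d1_contDiff hs)
        (fun _ => contDiff_const.mul (contDiff_fst.mul hf)) h.2.1
        (DecayN.const_mul wt_nonneg (c := fun _ => -2) (fun _ => le_rfl)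
          (fun _ => contDiff_fst.mul hf) (DecayN.fst_mul wt_nonneg abs_fst_le_wt (fun _ => hf) hn))
      convert h2 using 2
      funext y
      rw [d1_mul differentiable_sqNorm hfd, d1_sqNorm]
      ring
    · have h2 := DecayN.add wt_nonneg (fun _ => d2_contDiff hs)
        (fun _ => contDiff_const.mul (contDiff_snd.mul hf)) h.2.2
        (DecayN.const_mul wt_nonneg (c := fun _ => -2) (fun _ => le_rfl)
          (fun _ => contDiff_snd.mul hf) (DecayN.snd_mul wt_nonneg abs_snd_le_wt (fun _ => hf) hn))
      convert h2 using 2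
      funext y
      rw [d2_mul differentiable_sqNorm hfd, d2_sqNorm]
      ring

namespace IsGroundState

variable {Q : ℝ × ℝ → ℝ}

/-- Joint induction for Q and P: the system ∇Q = P y, |y|²∇P = (Q − Q³ − 2P) y is closed, so
derivatives of order n + 1 are controlled by those of order n. -/
lemma decayN (hQ : IsGroundState Q) (n : ℕ) :
    DecayN wt n (fun _ : Unit => Q) ∧ DecayN wt n (fun _ : Unit => radAvg Q) := by
  obtain ⟨R, C, hR1, hC, hb⟩ := hQ.exists_exp_bound
  have dQ : Dom wt (fun _ : Unit => Q) := dom_of_radial_exp hQ.contDiff.continuous hQ.radial hC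
    (R := R) fun r hr => by rw [abs_of_pos (hQ.pos _)]; exact (hb r hr).1
  have dP : Dom wt (fun _ : Unit => radAvg Q) := dom_of_radial_exp hQ.continuous_radAvg
    (fun _ _ h => hQ.radAvg_congr h) hC (R := R) fun r hr => (hb r hr).2
  have sQ := hQ.smooth
  have sP := hQ.smooth_radAvg
  induction n with
  | zero => exact ⟨dQ, dP⟩
  | succ n ih =>
    obtain ⟨iQ, iP⟩ := ih
    have hmul : ∀ {f g : ℝ × ℝ → ℝ}, ContDiff ℝ ∞ f → ContDiff ℝ ∞ g →
        DecayN wt n (fun _ : Unit => f) → DecayN wt n (fun _ : Unit => g) →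
        DecayN wt n (fun _ : Unit => fun y => f y * g y) := fun hf hg h1 h2 =>
      DecayN.mul wt_nonneg wt_nonneg wt_nonneg
        (fun y => le_mul_of_one_le_left (wt_nonneg y) (one_le_wt y)) (fun _ => hf) (fun _ => hg) h1 h2
    have i3 := hmul (sQ.mul sQ) sQ (hmul sQ sQ iQ iQ) iQ
    have s3 : ContDiff ℝ ∞ (fun y => -1 * (Q y * Q y * Q y)) :=
      contDiff_const.mul ((sQ.mul sQ).mul sQ)
    have s2 : ContDiff ℝ ∞ (fun y => -2 * radAvg Q y) := contDiff_const.mul sP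
    have iG := DecayN.add wt_nonneg (fun _ => sQ.add s3) (fun _ => s2)
      (DecayN.add wt_nonneg (fun _ => sQ) (fun _ => s3) iQ
        (DecayN.const_mul wt_nonneg (c := fun _ => -1) (fun _ => le_rfl)
          (fun _ => (sQ.mul sQ).mul sQ) i3))
      (DecayN.const_mul wt_nonneg (c := fun _ => -2) (fun _ => le_rfl) (fun _ => sP) iP)
    have sG := (sQ.add s3).add s2
    refine ⟨⟨dQ, ?_, ?_⟩, ⟨dP, ?_, ?_⟩⟩
    · simp only [hQ.d1_eq]
      exact DecayN.fst_mul wt_nonneg abs_fst_le_wt (fun _ => sP) iP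
    · simp only [hQ.d2_eq]
      exact DecayN.snd_mul wt_nonneg abs_snd_le_wt (fun _ => sP) iP
    · refine DecayN.of_sqNorm_mul (d1_contDiff sP) ?_
      have := DecayN.fst_mul wt_nonneg abs_fst_le_wt (fun _ => sG) iG
      convert this using 2
      funext y
      rw [hQ.sq_mul_d1_radAvg]; ring
    · refine DecayN.of_sqNorm_mul (d2_contDiff sP) ?_
      have := DecayN.snd_mul wt_nonneg abs_snd_le_wt (fun _ => sG) iG
      convert this using 2
      funext y
      rw [hQ.sq_mul_d2_radAvg]; ring

lemma rapid (hQ : IsGroundState Q) : Rapid Q := ⟨fun _ => hQ.smooth, fun n => (hQ.decayN n).1⟩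

lemma rapid_scalingGen (hQ : IsGroundState Q) : Rapid (scalingGen Q) :=
  (hQ.rapid.add hQ.rapid.d1.fst_mul).add hQ.rapid.d2.snd_mul

/-- The linearized operator maps `ΛQ` to `-2Q`. -/
lemma lap_scalingGen (hQ : IsGroundState Q) (y : ℝ × ℝ) :
    lap (scalingGen Q) y = scalingGen Q y - 3 * Q y ^ 2 * scalingGen Q y + 2 * Q y := by
  have hs := hQ.smooth
  have s1 := d1_contDiff hs
  have s2 := d2_contDiff hs
  have k := smooth_differentiable hs
  have k1 := smooth_differentiable s1
  have k2 := smooth_differentiable s2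
  have k11 := smooth_differentiable (d1_contDiff s1)
  have k12 := smooth_differentiable (d1_contDiff s2)
  have k22 := smooth_differentiable (d2_contDiff s2)
  have c12 := d1_d2_comm hs
  have m1 := differentiable_fst'.fun_mul k1
  have m2 := differentiable_snd'.fun_mul k2
  have e1 : d1 (scalingGen Q) = fun y => 2 * d1 Q y + (y.1 * d1 (d1 Q) y + y.2 * d1 (d2 Q) y) := by
    unfold scalingGen
    rw [d1_add (k.fun_add m1) m2, d1_add k m1, d1_mul differentiable_fst' k1,
      d1_mul differentiable_snd' k2, d1_fst, d1_snd]
    funext y; ring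
  have e2 : d2 (scalingGen Q) = fun y => 2 * d2 Q y + (y.1 * d1 (d2 Q) y + y.2 * d2 (d2 Q) y) := by
    unfold scalingGen
    rw [d2_add (k.fun_add m1) m2, d2_add k m1, d2_mul differentiable_fst' k1,
      d2_mul differentiable_snd' k2, d2_fst, d2_snd, ← c12]
    funext y; ring
  have n11 := differentiable_fst'.fun_mul k11
  have n12 := differentiable_snd'.fun_mul k12
  have n21 := differentiable_fst'.fun_mul k12
  have n22 := differentiable_snd'.fun_mul k22
  have e11 : d1 (d1 (scalingGen Q)) y
      = 3 * d1 (d1 Q) y + y.1 * d1 (d1 (d1 Q)) y + y.2 * d1 (d1 (d2 Q)) y := by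
    rw [e1, d1_add (k1.const_mul 2) (n11.fun_add n12), d1_const_mul 2 k1, d1_add n11 n12,
      d1_mul differentiable_fst' k11, d1_mul differentiable_snd' k12, d1_fst, d1_snd]
    ring
  have e22 : d2 (d2 (scalingGen Q)) y
      = 3 * d2 (d2 Q) y + y.1 * d2 (d1 (d2 Q)) y + y.2 * d2 (d2 (d2 Q)) y := by
    rw [e2, d2_add (k2.const_mul 2) (n21.fun_add n22), d2_const_mul 2 k2, d2_add n21 n22,
      d2_mul differentiable_fst' k12, d2_mul differentiable_snd' k22, d2_fst, d2_snd]
    ring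
  have hl : lap Q = fun y => Q y + -1 * (Q y * Q y * Q y) := by
    funext y; linarith [hQ.eq y]
  have kq := (k.fun_mul k).fun_mul k
  have a1 : d1 (lap Q) y = d1 Q y - 3 * Q y ^ 2 * d1 Q y := by
    rw [hl, d1_add k (kq.const_mul _), d1_const_mul _ kq, d1_mul (k.fun_mul k) k, d1_mul k k]
    ring
  have a2 : d2 (lap Q) y = d2 Q y - 3 * Q y ^ 2 * d2 Q y := by
    rw [hl, d2_add k (kq.const_mul _), d2_const_mul _ kq, d2_mul (k.fun_mul k) k, d2_mul k k]
    ring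
  have b1 : d1 (lap Q) y = d1 (d1 (d1 Q)) y + d2 (d1 (d2 Q)) y := by
    have : d1 (lap Q) = fun y => d1 (d1 (d1 Q)) y + d1 (d2 (d2 Q)) y := d1_add k11 k22
    rw [this, d1_d2_comm s2]
  have b2 : d2 (lap Q) y = d1 (d1 (d2 Q)) y + d2 (d2 (d2 Q)) y := by
    have : d2 (lap Q) = fun y => d2 (d1 (d1 Q)) y + d2 (d2 (d2 Q)) y := d2_add k11 k22
    rw [this, ← d1_d2_comm s1, ← c12]
  have he := hQ.eq y
  simp only [lap] at he
  rw [lap, e11, e22]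
  simp only [scalingGen]
  -- The commutator of Δ with y·∇ is 2Δ, so ΔΛQ = 3ΔQ + y·∇ΔQ. The pairs `a1`, `a2` and `b1`, `b2`
  -- evaluate ∇ΔQ from the equation and from third derivatives.
  linear_combination y.1 * (a1 - b1) + y.2 * (a2 - b2) - 3 * he

end IsGroundState

/-! ### Truncations and affine changes of variables. -/

section Dilations

variable {f : ℝ × ℝ → ℝ}

lemma IsTest.d1 (hf : IsTest f) : IsTest (d1 f) :=
  ⟨d1_contDiff hf.1, hf.2.fderiv_apply (𝕜 := ℝ) _⟩

lemma IsTest.d2 (hf : IsTest f) : IsTest (d2 f) :=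
  ⟨d2_contDiff hf.1, hf.2.fderiv_apply (𝕜 := ℝ) _⟩

lemma IsTest.rapid (hf : IsTest f) : Rapid f := by
  refine ⟨fun _ => hf.1, fun n => ?_⟩
  have hd : ∀ {f : ℝ × ℝ → ℝ}, IsTest f → Dom wt (fun _ : Unit => f) := fun {f} hf k => by
    obtain ⟨C, hC⟩ := ((continuous_wt.pow k).mul hf.1.continuous).bounded_above_of_compact_support
      (hf.2.mul_left)
    refine ⟨C, fun _ y => ?_⟩
    have := hC y
    rwa [Pi.mul_apply, Pi.pow_apply, norm_mul, Real.norm_of_nonneg (pow_nonneg (wt_nonneg y) k)] at this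
  induction n generalizing f with
  | zero => exact hd hf
  | succ n ih => exact ⟨hd hf, ih hf.d1, ih hf.d2⟩

/-- Each derivative brings a factor `c i` of modulus at most 1, so bounds stay uniform. Spreading
out destroys decay, hence the constant weight. -/
lemma DecayN.dilate {ι : Type*} {c : ι → ℝ} (hc : ∀ i, |c i| ≤ 1) {n : ℕ} :
    ∀ {f : ℝ × ℝ → ℝ}, ContDiff ℝ ∞ f → DecayN (fun _ => 1) n (fun _ : Unit => f) →
    DecayN (fun _ => 1) n (fun i y => f (c i • y + 0)) := by
  have h0 : ∀ {f : ℝ × ℝ → ℝ}, Dom (fun _ => 1) (fun _ : Unit => f) →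
      Dom (fun _ => 1) (fun (i : ι) y => f (c i • y + 0)) := fun h k =>
    (h k).imp fun C hC i y => hC () _
  have hs : ∀ {f : ℝ × ℝ → ℝ}, ContDiff ℝ ∞ f → ∀ i, ContDiff ℝ ∞ (fun y => f (c i • y + 0)) :=
    fun hf i => hf.comp (by fun_prop)
  induction n with
  | zero => intro f _ h; exact h0 h
  | succ n ih =>
    intro f hf h
    refine ⟨h0 h.1, ?_, ?_⟩
    · simp_rw [fun i => d1_comp_smul_add (smooth_differentiable hf) (c i) 0]
      exact DecayN.const_mul (fun _ => zero_le_one) hc (hs (d1_contDiff hf))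
        (ih (d1_contDiff hf) h.2.1)
    · simp_rw [fun i => d2_comp_smul_add (smooth_differentiable hf) (c i) 0]
      exact DecayN.const_mul (fun _ => zero_le_one) hc (hs (d2_contDiff hf))
        (ih (d2_contDiff hf) h.2.2)

lemma IsTest.dilate {ι : Type*} {c : ι → ℝ} (hc : ∀ i, |c i| ≤ 1) (hf : IsTest f) :
    RapidFam (fun _ => 1) (fun i y => f (c i • y)) := by
  have h := hf.rapid.mono (w := fun _ => 1) (fun _ => zero_le_one) one_le_wt
  exact ⟨fun i => hf.1.comp (by fun_prop), fun n => by
    simpa using DecayN.dilate hc hf.1 (h.decay n)⟩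

/-- A smooth compactly supported function equal to `1` on the unit ball. -/
lemma exists_test_eq_one : ∃ χ : ℝ × ℝ → ℝ, IsTest χ ∧ ∀ y, ‖y‖ ≤ 1 → χ y = 1 := by
  let b : ContDiffBump (0 : ℝ × ℝ) := ⟨1, 2, one_pos, one_lt_two⟩
  exact ⟨b, ⟨b.contDiff, b.hasCompactSupport⟩, fun y hy =>
    b.one_of_mem_closedBall (by simpa [b] using hy)⟩

/-- Truncations of a Schwartz function: uniformly controlled test functions that agree with it on
larger and larger balls. -/
lemma Rapid.exists_truncation (hf : Rapid f) : ∃ T : ℕ → ℝ × ℝ → ℝ, (∀ n, IsTest (T n)) ∧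
    RapidFam wt T ∧ ∀ y, ∀ᶠ n in atTop, T n =ᶠ[𝓝 y] f := by
  obtain ⟨χ, hχ, h1⟩ := exists_test_eq_one
  have hc : ∀ n : ℕ, |((n : ℝ) + 1)⁻¹| ≤ 1 := fun n => by
    rw [abs_of_nonneg (by positivity)]
    exact inv_le_one_of_one_le₀ (by linarith [(n.cast_nonneg : (0 : ℝ) ≤ n)])
  refine ⟨fun n y => f y * χ (((n : ℝ) + 1)⁻¹ • y), fun n => ⟨?_, ?_⟩, ?_, fun y => ?_⟩
  · exact hf.contDiff.mul (hχ.1.comp (by fun_prop))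
  · exact (hχ.2.comp_smul (by positivity)).mul_left
  · exact RapidFam.mul wt_nonneg wt_nonneg (fun _ => zero_le_one) (fun y => (mul_one _).ge)
      (RapidFam.reindex hf (fun _ : ℕ => ())) (hχ.dilate hc)
  · obtain ⟨N, hN⟩ := exists_nat_gt ‖y‖
    filter_upwards [eventually_ge_atTop N] with n hn
    have hn' : (N : ℝ) ≤ n := by exact_mod_cast hn
    filter_upwards [(continuous_norm.tendsto y).eventually (gt_mem_nhds hN)] with z hz
    have : χ (((n : ℝ) + 1)⁻¹ • z) = 1 := by
      apply h1
      rw [norm_smul, Real.norm_of_nonneg (by positivity), inv_mul_le_iff₀ (by positivity)]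
      linarith
    rw [this, mul_one]

/-- The constant is explicit so that it can be bounded over compact time intervals in
`exists_push_bound`. -/
lemma wt_le_affine {c : ℝ} (hc : c ≠ 0) (p y : ℝ × ℝ) :
    wt y ≤ (1 + |c|⁻¹ * (1 + |p.1| + |p.2|)) * wt (c • y + p) := by
  have hc' : 0 < |c| := abs_pos.2 hc
  have h1 : |c| * |y.1| ≤ |c * y.1 + p.1| + |p.1| := by
    rw [← abs_mul]; have := abs_sub (c * y.1 + p.1) p.1; simpa using this
  have h2 : |c| * |y.2| ≤ |c * y.2 + p.2| + |p.2| := by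
    rw [← abs_mul]; have := abs_sub (c * y.2 + p.2) p.2; simpa using this
  have hi : |y.1| + |y.2| = |c|⁻¹ * (|c| * |y.1| + |c| * |y.2|) := by field_simp
  have ha := abs_nonneg (c * y.1 + p.1)
  have hb := abs_nonneg (c * y.2 + p.2)
  have hp1 := abs_nonneg p.1
  have hp2 := abs_nonneg p.2
  unfold wt
  simp only [Prod.fst_add, Prod.snd_add, Prod.smul_fst, Prod.smul_snd, smul_eq_mul]
  set a := |c * y.1 + p.1|
  set b := |c * y.2 + p.2|
  have : |c|⁻¹ * (|c| * |y.1| + |c| * |y.2|) ≤ |c|⁻¹ * ((1 + |p.1| + |p.2|) * (1 + a + b)) := by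
    gcongr
    nlinarith [mul_nonneg hp1 ha, mul_nonneg hp1 hb, mul_nonneg hp2 ha, mul_nonneg hp2 hb]
  nlinarith

lemma Rapid.comp_affine (hf : Rapid f) {c : ℝ} (hc : c ≠ 0) (p : ℝ × ℝ) :
    Rapid (fun y => f (c • y + p)) := by
  have h0 : ∀ {f : ℝ × ℝ → ℝ}, Dom wt (fun _ : Unit => f) →
      Dom wt (fun _ : Unit => fun y => f (c • y + p)) := fun {f} h k => by
    obtain ⟨C, hC⟩ := h k
    set K := 1 + |c|⁻¹ * (1 + |p.1| + |p.2|) with hK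
    have hK0 : 0 ≤ K := by positivity
    refine ⟨K ^ k * C, fun _ y => ?_⟩
    have hw := wt_le_affine hc p y
    calc wt y ^ k * |f (c • y + p)| ≤ (K * wt (c • y + p)) ^ k * |f (c • y + p)| := by
          gcongr; exact wt_nonneg y
      _ = K ^ k * (wt (c • y + p) ^ k * |f (c • y + p)|) := by rw [mul_pow]; ring
      _ ≤ K ^ k * C := by gcongr; exact hC () _
  have hs : ∀ {f : ℝ × ℝ → ℝ}, ContDiff ℝ ∞ f → ContDiff ℝ ∞ (fun y => f (c • y + p)) :=
    fun hf => hf.comp (by fun_prop)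
  refine ⟨fun _ => hs hf.contDiff, fun n => ?_⟩
  have key : ∀ n, ∀ {f : ℝ × ℝ → ℝ}, ContDiff ℝ ∞ f → DecayN wt n (fun _ : Unit => f) →
      DecayN wt n (fun _ : Unit => fun y => f (c • y + p)) := by
    intro n
    induction n with
    | zero => intro f _ h; exact h0 h
    | succ n ih =>
      intro f hf h
      refine ⟨h0 h.1, ?_, ?_⟩
      · simp only [d1_comp_smul_add (smooth_differentiable hf)]
        exact DecayN.const_mul wt_nonneg (c := fun _ => c) (fun _ => le_rfl)
          (fun _ => hs (d1_contDiff hf)) (ih (d1_contDiff hf) h.2.1)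
      · simp only [d2_comp_smul_add (smooth_differentiable hf)]
        exact DecayN.const_mul wt_nonneg (c := fun _ => c) (fun _ => le_rfl)
          (fun _ => hs (d2_contDiff hf)) (ih (d2_contDiff hf) h.2.2)
  exact key n hf.contDiff (hf.decay n)

end Dilations

/-! ### The primitive in the first variable: smoothness and one-sided decay. -/

section Primitive

variable {G : ℝ × ℝ → ℝ}

/-- The primitive `∫_{-∞}^{y₁} G(z, y₂) dz`. -/
def prim (G : ℝ × ℝ → ℝ) (y : ℝ × ℝ) : ℝ := ∫ z in Iic y.1, G (z, y.2)

/-- A domain of integration independent of y allows differentiation under the integral sign. -/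
lemma prim_eq_shift (G : ℝ × ℝ → ℝ) (y : ℝ × ℝ) :
    prim G y = ∫ z in Iic (0 : ℝ), G (y.1 + z, y.2) := by
  unfold prim
  rw [← integral_indicator measurableSet_Iic, ← integral_indicator measurableSet_Iic,
    ← integral_add_left_eq_self _ y.1]
  congr 1
  funext z
  simp [indicator]

lemma Rapid.integrable_line (hG : Rapid G) (b : ℝ) : Integrable (fun z => G (z, b)) := by
  obtain ⟨C, hC0, hC⟩ := hG.abs_le_maj
  refine (integrable_inv_one_add_sq.const_mul C).mono'
    (hG.continuous.comp (by fun_prop : Continuous fun z : ℝ => (z, b))).aestronglyMeasurable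
    (ae_of_all _ fun z => (hC _).trans ?_)
  unfold maj
  gcongr
  exact mul_le_of_le_one_right (by positivity)
    (inv_le_one_of_one_le₀ (by nlinarith [sq_nonneg b]))

lemma Rapid.hasFDerivAt_prim (hG : Rapid G) (y : ℝ × ℝ) :
    HasFDerivAt (prim G) (prim (d1 G) y • ContinuousLinearMap.fst ℝ ℝ ℝ
      + prim (d2 G) y • ContinuousLinearMap.snd ℝ ℝ ℝ) y := by
  obtain ⟨C₁, hC₁0, hC₁⟩ := hG.d1.abs_le_maj
  obtain ⟨C₂, hC₂0, hC₂⟩ := hG.d2.abs_le_maj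
  have hcomp : ∀ {H : ℝ × ℝ → ℝ} (_ : Rapid H) (x : ℝ × ℝ),
      Integrable (fun z => H (x.1 + z, x.2)) := fun hH x => (hH.integrable_line x.2).comp_add_left x.1
  have hfd : ∀ x : ℝ × ℝ, ∀ z : ℝ, fderiv ℝ G (x.1 + z, x.2)
      = d1 G (x.1 + z, x.2) • ContinuousLinearMap.fst ℝ ℝ ℝ
        + d2 G (x.1 + z, x.2) • ContinuousLinearMap.snd ℝ ℝ ℝ := fun x z => by
    refine ContinuousLinearMap.ext fun v => ?_
    rw [fderiv_eq_d1_d2]; simp; ring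
  have key := hasFDerivAt_integral_of_dominated_of_fderiv_le (μ := volume.restrict (Iic (0 : ℝ)))
    (F := fun x z => G (x.1 + z, x.2)) (F' := fun x z => fderiv ℝ G (x.1 + z, x.2)) (x₀ := y)
    (bound := fun z => 3 * (C₁ + C₂) * (1 + (y.1 + z) ^ 2)⁻¹) (Metric.ball_mem_nhds y one_pos)
    (Eventually.of_forall fun x => (hcomp hG x).integrableOn.aestronglyMeasurable)
    (hcomp hG y).integrableOn
    (((hG.contDiff.continuous_fderiv (by simp)).comp
      (by fun_prop : Continuous fun z : ℝ => (y.1 + z, y.2))).aestronglyMeasurable)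
    (ae_of_all _ fun z x hx => ?_)
    ((integrable_inv_one_add_sq.comp_add_left y.1).const_mul _).integrableOn
    (ae_of_all _ fun z x _ => ?_)
  · have e : ∀ x, prim G x = ∫ z in Iic (0 : ℝ), G (x.1 + z, x.2) := prim_eq_shift G
    rw [show prim G = _ from funext e]
    refine key.congr_fderiv ?_
    simp_rw [hfd y]
    rw [integral_add ((hcomp hG.d1 y).integrableOn.smul_const _)
      ((hcomp hG.d2 y).integrableOn.smul_const _), integral_smul_const, integral_smul_const,
      prim_eq_shift, prim_eq_shift]
  · have hx1 : |x.1 - y.1| ≤ 1 := by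
      have := (norm_fst_le (x - y)).trans (mem_ball_iff_norm.1 hx).le
      simpa using this
    have hm : ∀ a b : ℝ, maj (x.1 + z, x.2) ≤ 3 * (1 + (y.1 + z) ^ 2)⁻¹ := fun _ _ => by
      unfold maj
      have h1 : (1 + x.2 ^ 2)⁻¹ ≤ 1 := inv_le_one_of_one_le₀ (by nlinarith [sq_nonneg x.2])
      -- Moving a by at most 1 to b gives 1 + b² ≤ 3(1 + a²), so one integrable bound serves the
      -- whole ball around y.
      have h2 : (1 + (x.1 + z) ^ 2)⁻¹ ≤ 3 * (1 + (y.1 + z) ^ 2)⁻¹ := by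
        rw [← div_eq_mul_inv, inv_eq_one_div, div_le_div_iff₀ (by positivity) (by positivity)]
        have := abs_le.1 hx1
        nlinarith [sq_nonneg (x.1 + z + (x.1 - y.1)), sq_nonneg (x.1 + z)]
      exact (mul_le_of_le_one_right (by positivity) h1).trans h2
    have := hm 0 0
    refine (norm_fderiv_le G _).trans ?_
    calc _ ≤ C₁ * maj (x.1 + z, x.2) + C₂ * maj (x.1 + z, x.2) := add_le_add (hC₁ _) (hC₂ _)
      _ = (C₁ + C₂) * maj (x.1 + z, x.2) := by ring
      _ ≤ (C₁ + C₂) * (3 * (1 + (y.1 + z) ^ 2)⁻¹) := by gcongr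
      _ = _ := by ring
  · exact (hG.differentiable _).hasFDerivAt.comp x
      ((hasFDerivAt_fst.add_const z).prodMk hasFDerivAt_snd) |>.congr_fderiv (by
        refine ContinuousLinearMap.ext fun v => ?_
        simp)

lemma Rapid.d1_prim' (hG : Rapid G) : d1 (prim G) = prim (d1 G) := by
  funext y; simp [d1, (hG.hasFDerivAt_prim y).fderiv]

lemma Rapid.d2_prim (hG : Rapid G) : d2 (prim G) = prim (d2 G) := by
  funext y; simp [d2, (hG.hasFDerivAt_prim y).fderiv]

lemma Rapid.tendsto_line (hG : Rapid G) (b : ℝ) : Tendsto (fun z => G (z, b)) atBot (𝓝 0) :=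
  tendsto_zero_of_hasDerivAt_of_integrableOn_Iic (a := 0)
    (fun z _ => hasDerivAt_d1 hG.differentiable z b)
    (hG.d1.integrable_line b).integrableOn (hG.integrable_line b).integrableOn

lemma Rapid.prim_d1 (hG : Rapid G) : prim (d1 G) = G := by
  funext y
  unfold prim
  rw [integral_Iic_of_hasDerivAt_of_tendsto' (f := fun z => G (z, y.2)) (m := 0)
    (fun z _ => hasDerivAt_d1 hG.differentiable z y.2) (hG.d1.integrable_line y.2).integrableOn
    (hG.tendsto_line y.2)]
  simp

lemma Rapid.d1_prim (hG : Rapid G) : d1 (prim G) = G := by rw [hG.d1_prim', hG.prim_d1]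

lemma Rapid.contDiff_prim (hG : Rapid G) : ContDiff ℝ ∞ (prim G) := by
  refine contDiff_infty.2 fun n => ?_
  induction n generalizing G with
  | zero =>
    exact contDiff_zero.2 (continuous_iff_continuousAt.2 fun y => (hG.hasFDerivAt_prim y).continuousAt)
  | succ n ih =>
    push_cast
    refine contDiff_succ_iff_hasFDerivAt.2 ⟨_, ?_, hG.hasFDerivAt_prim⟩
    exact ((ih hG.d1).smul contDiff_const).add ((ih hG.d2).smul contDiff_const)

/-- The weight `1 + |y₂| + max (-y₁) 0`. -/
def wtLeft (y : ℝ × ℝ) : ℝ := 1 + |y.2| + max (-y.1) 0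

/-- The weight `1 + max y₁ 0`. -/
def wtRight (y : ℝ × ℝ) : ℝ := 1 + max y.1 0

lemma one_le_wtLeft (y : ℝ × ℝ) : 1 ≤ wtLeft y := by
  unfold wtLeft; linarith [abs_nonneg y.2, le_max_right (-y.1) 0]

lemma wtLeft_nonneg (y : ℝ × ℝ) : 0 ≤ wtLeft y := zero_le_one.trans (one_le_wtLeft y)

lemma one_le_wtRight (y : ℝ × ℝ) : 1 ≤ wtRight y := by
  unfold wtRight; linarith [le_max_right y.1 0]

lemma wtRight_nonneg (y : ℝ × ℝ) : 0 ≤ wtRight y := zero_le_one.trans (one_le_wtRight y)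

lemma wt_le_wtLeft_mul_wtRight (y : ℝ × ℝ) : wt y ≤ wtLeft y * wtRight y := by
  unfold wt wtLeft wtRight
  have h1 : |y.1| ≤ max (-y.1) 0 + max y.1 0 := by
    rcases le_total 0 y.1 with h | h
    · rw [abs_of_nonneg h, max_eq_left h]; linarith [le_max_right (-y.1) 0]
    · rw [abs_of_nonpos h]; linarith [le_max_left (-y.1) 0, le_max_right y.1 0]
  have h2 := abs_nonneg y.2
  have h3 := le_max_right (-y.1) 0
  have h4 := le_max_right y.1 0
  nlinarith [mul_nonneg h2 h4, mul_nonneg h3 h4]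

/-- For z ≤ y₁ the value of `wtLeft` at y is at most that of `wt` at (z, y₂), so the weight passes
under the integral. No decay is claimed for y₁ → +∞, where the limit is the integral of G over the
full line. -/
lemma Rapid.dom_prim (hG : Rapid G) : Dom wtLeft (fun _ : Unit => prim G) := by
  intro k
  obtain ⟨C, hC0, hC⟩ := hG.le_maj k
  have hint : Integrable (fun z : ℝ => C * (1 + z ^ 2)⁻¹) := integrable_inv_one_add_sq.const_mul C
  refine ⟨∫ z : ℝ, C * (1 + z ^ 2)⁻¹, fun _ y => ?_⟩
  unfold prim
  have hw := pow_nonneg (wtLeft_nonneg y) k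
  rw [← abs_of_nonneg hw, ← abs_mul, ← integral_const_mul]
  calc |∫ z in Iic y.1, wtLeft y ^ k * G (z, y.2)|
      ≤ ∫ z in Iic y.1, C * (1 + z ^ 2)⁻¹ := by
        refine norm_integral_le_of_norm_le (f := fun z => wtLeft y ^ k * G (z, y.2))
          (μ := volume.restrict (Iic y.1)) hint.integrableOn ((ae_restrict_mem measurableSet_Iic).mono fun z hz => ?_)
        have hz' : z ≤ y.1 := hz
        have hle : wtLeft y ≤ wt (z, y.2) := by
          unfold wtLeft wt
          have : max (-y.1) 0 ≤ |z| := max_le ((neg_le_neg hz').trans (neg_le_abs z)) (abs_nonneg z)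
          simp only; linarith
        rw [Real.norm_eq_abs, abs_mul, abs_of_nonneg hw]
        calc wtLeft y ^ k * |G (z, y.2)| ≤ wt (z, y.2) ^ k * |G (z, y.2)| := by
              gcongr; exact wtLeft_nonneg y
          _ ≤ C * maj (z, y.2) := hC _
          _ ≤ _ := by
              unfold maj
              gcongr
              exact mul_le_of_le_one_right (by positivity)
                (inv_le_one_of_one_le₀ (by nlinarith [sq_nonneg y.2]))
    _ ≤ _ := setIntegral_le_integral hint (ae_of_all _ fun z => by positivity)

lemma Rapid.prim (hG : Rapid G) : RapidFam wtLeft (fun _ : Unit => prim G) := by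
  refine ⟨fun _ => hG.contDiff_prim, fun n => ?_⟩
  induction n generalizing G with
  | zero => exact hG.dom_prim
  | succ n ih =>
    refine ⟨hG.dom_prim, ?_, ?_⟩
    · simp only [hG.d1_prim']; exact ih hG.d1
    · simp only [hG.d2_prim]; exact ih hG.d2

end Primitive

/-! ### Step functions of the first variable and their derivatives. -/

section Steps

variable {h : ℝ → ℝ}

/-- A smooth function on the line, constant on `(-∞, 1]` and zero on `[2, ∞)`. -/
structure IsStep (h : ℝ → ℝ) : Prop where
  smooth : ContDiff ℝ ∞ h
  left : ∃ c, ∀ r, r ≤ 1 → h r = c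
  right : ∀ r, 2 ≤ r → h r = 0

lemma IsCutoff.isStep (hh : IsCutoff h) : IsStep h := ⟨hh.contDiff, ⟨1, hh.eq_one⟩, hh.eq_zero⟩

lemma IsStep.hasDerivAt (hh : IsStep h) (r : ℝ) : HasDerivAt h (deriv h r) r :=
  (hh.smooth.differentiable (by simp) r).hasDerivAt

lemma IsStep.contDiff_deriv (hh : IsStep h) : ContDiff ℝ ∞ (deriv h) :=
  (contDiff_infty_iff_deriv.1 hh.smooth).2

lemma IsStep.deriv_left (hh : IsStep h) {r : ℝ} (hr : r ≤ 1) : deriv h r = 0 := by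
  obtain ⟨c, hc⟩ := hh.left
  have hlt : ∀ r ∈ Iio (1 : ℝ), deriv h r = 0 := fun r hr => by
    have : h =ᶠ[𝓝 r] fun _ => c := by
      filter_upwards [Iio_mem_nhds (mem_Iio.1 hr)] with z hz using hc z (le_of_lt hz)
    rw [this.deriv_eq, deriv_const]
  have hcl : IsClosed {r | deriv h r = 0} :=
    isClosed_eq hh.contDiff_deriv.continuous continuous_const
  have : closure (Iio (1 : ℝ)) ⊆ {r | deriv h r = 0} := hcl.closure_subset_iff.2 hlt
  rw [closure_Iio] at this
  exact this hr

lemma IsStep.deriv_right (hh : IsStep h) {r : ℝ} (hr : 2 ≤ r) : deriv h r = 0 := by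
  have hlt : ∀ r ∈ Ioi (2 : ℝ), deriv h r = 0 := fun r hr => by
    have : h =ᶠ[𝓝 r] fun _ => 0 := by
      filter_upwards [Ioi_mem_nhds (mem_Ioi.1 hr)] with z hz using hh.right z (le_of_lt hz)
    rw [this.deriv_eq, deriv_const]
  have hcl : IsClosed {r | deriv h r = 0} :=
    isClosed_eq hh.contDiff_deriv.continuous continuous_const
  have : closure (Ioi (2 : ℝ)) ⊆ {r | deriv h r = 0} := hcl.closure_subset_iff.2 hlt
  rw [closure_Ioi] at this
  exact this hr

/-- Allowing any constant on the left, instead of 1, keeps the class stable under differentiation.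
-/
lemma IsStep.deriv (hh : IsStep h) : IsStep (deriv h) :=
  ⟨hh.contDiff_deriv, ⟨0, fun _ hr => hh.deriv_left hr⟩, fun _ hr => hh.deriv_right hr⟩

lemma IsStep.bounded (hh : IsStep h) : ∃ M, 0 ≤ M ∧ ∀ r, |h r| ≤ M := by
  obtain ⟨C, hC⟩ := isCompact_Icc (a := (1 : ℝ)) (b := 2) |>.exists_bound_of_continuousOn
    hh.smooth.continuous.continuousOn
  obtain ⟨c, hc⟩ := hh.left
  have h0 : 0 ≤ C := (norm_nonneg _).trans (hC 1 ⟨le_rfl, one_le_two⟩)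
  refine ⟨C, h0, fun r => ?_⟩
  rcases le_total r 1 with h1 | h1
  · rw [hc r h1, ← hc 1 le_rfl]; exact hC 1 ⟨le_rfl, one_le_two⟩
  · rcases le_total r 2 with h2 | h2
    · exact hC r ⟨h1, h2⟩
    · rw [hh.right r h2]; simpa using h0

lemma IsStep.dom (hh : IsStep h) {a : ℝ} (ha : 0 < a) :
    Dom wtRight (fun _ : Unit => fun y : ℝ × ℝ => h (a * y.1)) := by
  intro k
  obtain ⟨M, hM0, hM⟩ := hh.bounded
  refine ⟨(1 + 2 * a⁻¹) ^ k * M, fun _ y => ?_⟩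
  by_cases hy : a * y.1 ≤ 2
  · have : wtRight y ≤ 1 + 2 * a⁻¹ := by
      unfold wtRight
      gcongr
      exact max_le (by rw [← div_eq_mul_inv, le_div_iff₀ ha]; linarith) (by positivity)
    have := wtRight_nonneg y
    gcongr
    exact hM _
  · simp only [hh.right _ (not_le.1 hy).le, abs_zero, mul_zero]
    positivity

lemma IsStep.rapidFam (hh : IsStep h) {a : ℝ} (ha : 0 < a) :
    RapidFam wtRight (fun _ : Unit => fun y : ℝ × ℝ => h (a * y.1)) := by
  have hs : ∀ {h : ℝ → ℝ}, IsStep h → ContDiff ℝ ∞ (fun y : ℝ × ℝ => h (a * y.1)) :=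
    fun hh => hh.smooth.comp (by fun_prop)
  refine ⟨fun _ => hs hh, fun n => ?_⟩
  induction n generalizing h with
  | zero => exact hh.dom ha
  | succ n ih =>
    refine ⟨hh.dom ha, ?_, ?_⟩
    · simp only [d1_fst_comp hh.hasDerivAt]
      exact DecayN.const_mul wtRight_nonneg (c := fun _ => a) (fun _ => le_rfl)
        (fun _ => hs hh.deriv) (ih hh.deriv)
    · simp only [d2_fst_comp hh.hasDerivAt]
      exact DecayN.zero

/-- The primitive decays to the left and in y₂, and the step cuts off the right. This makes F φ_A
Schwartz, for each fixed A; bounds uniform in A are obtained separately on the strip. -/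
lemma Rapid.prim_mul_step {G : ℝ × ℝ → ℝ} (hG : Rapid G) (hh : IsStep h) {a : ℝ} (ha : 0 < a) :
    Rapid (fun y => ZK.prim G y * h (a * y.1)) :=
  RapidFam.mul wt_nonneg wtLeft_nonneg wtRight_nonneg wt_le_wtLeft_mul_wtRight hG.prim
    (hh.rapidFam ha)

lemma Rapid.mul_step {G : ℝ × ℝ → ℝ} (hG : Rapid G) (hh : IsStep h) {a : ℝ} (ha : 0 < a) :
    Rapid (fun y => G y * h (a * y.1)) :=
  RapidFam.mul wt_nonneg wt_nonneg wtRight_nonneg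
    (fun y => le_mul_of_one_le_right (wt_nonneg y) (one_le_wtRight y)) hG (hh.rapidFam ha)

end Steps

open scoped ENNReal Convolution

/-! ### Ladyzhenskaya's inequality for test functions. -/

section LadyzhenskayaTest

/-- The squared `L²` norm as an extended nonnegative number. -/
def sqInt (f : ℝ × ℝ → ℝ) : ℝ≥0∞ := ∫⁻ y, ‖f y‖ₑ ^ 2

lemma sqInt_congr {f g : ℝ × ℝ → ℝ} (h : f =ᵐ[volume] g) : sqInt f = sqInt g :=
  lintegral_congr_ae (h.mono fun y hy => by simp only [hy])

lemma sqInt_mono {f g : ℝ × ℝ → ℝ} (h : ∀ y, |f y| ≤ |g y|) : sqInt f ≤ sqInt g := by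
  refine lintegral_mono fun y => ?_
  gcongr
  exact enorm_le_iff_norm_le.2 (h y)

lemma sqInt_const_mul (c : ℝ) (f : ℝ × ℝ → ℝ) :
    sqInt (fun y => c * f y) = ‖c‖ₑ ^ 2 * sqInt f := by
  unfold sqInt
  rw [← lintegral_const_mul' _ _ (by simp)]
  simp_rw [enorm_mul, mul_pow]

lemma ennreal_add_sq_le (a b : ℝ≥0∞) : (a + b) ^ 2 ≤ 2 * (a ^ 2 + b ^ 2) := by
  have := ENNReal.rpow_add_le_mul_rpow_add_rpow a b (p := 2) one_le_two
  norm_num at this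
  simpa [ENNReal.rpow_two] using this

lemma sqInt_add_le {f g : ℝ × ℝ → ℝ} (hf : AEStronglyMeasurable f volume) :
    sqInt (fun y => f y + g y) ≤ 2 * (sqInt f + sqInt g) := by
  unfold sqInt
  rw [← lintegral_add_left' (hf.enorm.pow_const 2), ← lintegral_const_mul' _ _ (by simp)]
  refine lintegral_mono fun y => le_trans ?_ (ennreal_add_sq_le _ _)
  gcongr
  exact enorm_add_le _ _

lemma lintegral_mul_sq_le {μ : Measure (ℝ × ℝ)} {f g : ℝ × ℝ → ℝ≥0∞} (hf : AEMeasurable f μ)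
    (hg : AEMeasurable g μ) :
    (∫⁻ y, f y * g y ∂μ) ^ 2 ≤ (∫⁻ y, f y ^ 2 ∂μ) * ∫⁻ y, g y ^ 2 ∂μ := by
  have h := ENNReal.lintegral_mul_le_Lp_mul_Lq μ Real.HolderConjugate.two_two hf hg
  simp only [Pi.mul_apply, ENNReal.rpow_two] at h
  have hs : ∀ a : ℝ≥0∞, (a ^ (1 / 2 : ℝ)) ^ 2 = a := fun a => by
    rw [← ENNReal.rpow_two, ← ENNReal.rpow_mul]; norm_num
  calc _ ≤ ((∫⁻ y, f y ^ 2 ∂μ) ^ (1 / 2 : ℝ) * (∫⁻ y, g y ^ 2 ∂μ) ^ (1 / 2 : ℝ)) ^ 2 := by gcongr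
    _ = _ := by rw [mul_pow, hs, hs]

/-- Ladyzhenskaya's inequality for test functions. -/
lemma exists_ladyzhenskaya_test : ∃ K : ℝ≥0∞, K ≠ ⊤ ∧ ∀ f : ℝ × ℝ → ℝ, IsTest f →
    ∫⁻ y, ‖f y‖ₑ ^ 4 ≤ K * (sqInt f * (sqInt (d1 f) + sqInt (d2 f))) := by
  set C := lintegralPowLePowLIntegralFDerivConst (volume : Measure (ℝ × ℝ)) 2 with hC
  refine ⟨C * 8, ENNReal.mul_ne_top (by simp) (by norm_num), fun f hf => ?_⟩
  have hdim : ((Module.finrank ℝ (ℝ × ℝ) : ℕ) : ℝ).HolderConjugate 2 := by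
    rw [Module.finrank_prod, Module.finrank_self]
    norm_num
    exact Real.HolderConjugate.two_two
  have hfd := smooth_differentiable hf.1
  -- In dimension two the Sobolev inequality bounds ‖f²‖₂ by ‖∇(f²)‖₁; Cauchy–Schwarz then splits
  -- f∇f.
  have h := lintegral_pow_le_pow_lintegral_fderiv (volume : Measure (ℝ × ℝ)) (u := fun y => f y * f y)
    ((hf.1.mul hf.1).of_le (by simp)) hf.2.mul_left hdim
  simp only [ENNReal.rpow_two] at h
  have e4 : ∀ y, ‖f y * f y‖ₑ ^ 2 = ‖f y‖ₑ ^ 4 := fun y => by rw [enorm_mul]; ring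
  simp_rw [e4] at h
  refine h.trans ?_
  rw [mul_assoc]
  gcongr
  have m0 : AEMeasurable (fun y => ‖f y‖ₑ) volume := hf.1.continuous.enorm.measurable.aemeasurable
  have m1 : AEMeasurable (fun y => ‖d1 f y‖ₑ) volume :=
    hf.d1.1.continuous.enorm.measurable.aemeasurable
  have m2 : AEMeasurable (fun y => ‖d2 f y‖ₑ) volume :=
    hf.d2.1.continuous.enorm.measurable.aemeasurable
  have hb : ∀ y, ‖fderiv ℝ (fun y => f y * f y) y‖ₑ ≤ 2 * (‖f y‖ₑ * (‖d1 f y‖ₑ + ‖d2 f y‖ₑ)) := by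
    intro y
    rw [fderiv_fun_mul (hfd y) (hfd y), ← two_smul ℝ, enorm_smul, enorm_smul]
    have : ‖fderiv ℝ f y‖ₑ ≤ ‖d1 f y‖ₑ + ‖d2 f y‖ₑ := by
      simp only [← ofReal_norm]
      rw [← ENNReal.ofReal_add (norm_nonneg _) (norm_nonneg _)]
      exact ENNReal.ofReal_le_ofReal (norm_fderiv_le f y)
    have h2 : ‖(2 : ℝ)‖ₑ = 2 := by rw [Real.enorm_eq_ofReal (by norm_num)]; norm_num
    rw [h2]
    gcongr
  calc (∫⁻ y, ‖fderiv ℝ (fun y => f y * f y) y‖ₑ) ^ 2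
      ≤ (2 * ∫⁻ y, ‖f y‖ₑ * (‖d1 f y‖ₑ + ‖d2 f y‖ₑ)) ^ 2 := by
        rw [← lintegral_const_mul' _ _ (by simp)]
        gcongr with y
        exact hb y
    _ = 4 * (∫⁻ y, ‖f y‖ₑ * (‖d1 f y‖ₑ + ‖d2 f y‖ₑ)) ^ 2 := by rw [mul_pow]; norm_num
    _ ≤ 4 * (sqInt f * ∫⁻ y, (‖d1 f y‖ₑ + ‖d2 f y‖ₑ) ^ 2) := by
        gcongr
        exact lintegral_mul_sq_le m0 (m1.add m2)
    _ ≤ 4 * (sqInt f * (2 * (sqInt (d1 f) + sqInt (d2 f)))) := by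
        gcongr
        unfold sqInt
        rw [← lintegral_add_left' (m1.pow_const 2), ← lintegral_const_mul' _ _ (by simp)]
        exact lintegral_mono fun y => ennreal_add_sq_le _ _
    _ = 8 * (sqInt f * (sqInt (d1 f) + sqInt (d2 f))) := by ring

end LadyzhenskayaTest

/-! ### Mollification of weakly differentiable functions. -/

section Mollification

variable {f g : ℝ × ℝ → ℝ}

/-- Convolution with a bump function. -/
def mollify (η : ContDiffBump (0 : ℝ × ℝ)) (f : ℝ × ℝ → ℝ) : ℝ × ℝ → ℝ :=
  (η.normed volume) ⋆[ContinuousLinearMap.lsmul ℝ ℝ, volume] f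

variable (η : ContDiffBump (0 : ℝ × ℝ))

lemma isTest_normed : IsTest (η.normed volume) := ⟨η.contDiff_normed, η.hasCompactSupport_normed⟩

lemma mollify_contDiff (hf : LocallyIntegrable f) : ContDiff ℝ ∞ (mollify η f) :=
  η.hasCompactSupport_normed.contDiff_convolution_left _ η.contDiff_normed hf

lemma mollify_apply (x : ℝ × ℝ) :
    mollify η f x = ∫ t, η.normed volume t * f (x - t) := rfl

/-- The derivative falls on the kernel, and the reflected kernel y ↦ η(x − y) is admissible in the
definition of the weak derivative. -/
lemma fderiv_mollify {v : ℝ × ℝ} (h : HasWeakDeriv v f g) (x : ℝ × ℝ) :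
    fderiv ℝ (mollify η f) x v = mollify η g x := by
  have hη := isTest_normed η
  have hd := η.hasCompactSupport_normed.hasFDerivAt_convolution_left (𝕜 := ℝ)
    (ContinuousLinearMap.lsmul ℝ ℝ) (μ := volume) (hη.1.of_le (by simp)) h.1 x
  change HasFDerivAt (mollify η f) _ x at hd
  have hci := (η.hasCompactSupport_normed.fderiv (𝕜 := ℝ)).convolutionExists_left
    ((ContinuousLinearMap.lsmul ℝ ℝ).precompL (ℝ × ℝ)) (μ := volume)
    (hη.1.continuous_fderiv (by simp)) h.1 x
  have e1 : fderiv ℝ (mollify η f) x v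
      = ∫ t, fderiv ℝ (η.normed volume) t v * f (x - t) := by
    rw [hd.fderiv, convolution_def, ContinuousLinearMap.integral_apply hci]
    rfl
  rw [e1, mollify_apply]
  have hψ : IsTest (fun y => η.normed volume (x - y)) := by
    refine ⟨hη.1.comp (by fun_prop), ?_⟩
    have := hη.2.comp_homeomorph (Homeomorph.subLeft x)
    exact this
  have hψd : ∀ y, fderiv ℝ (fun y => η.normed volume (x - y)) y v
      = - fderiv ℝ (η.normed volume) (x - y) v := by
    intro y
    have : HasFDerivAt (fun y => η.normed volume (x - y))
        ((fderiv ℝ (η.normed volume) (x - y)).comp (-ContinuousLinearMap.id ℝ (ℝ × ℝ))) y :=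
      ((smooth_differentiable hη.1) (x - y)).hasFDerivAt.comp y ((hasFDerivAt_id y).const_sub x)
    rw [this.fderiv]; simp
  have key := h.2.2 _ hψ
  simp_rw [hψd] at key
  rw [← integral_sub_left_eq_self (fun t => fderiv ℝ (η.normed volume) t v * f (x - t)) volume x,
    ← integral_sub_left_eq_self (fun t => η.normed volume t * g (x - t)) volume x]
  simp only [sub_sub_cancel]
  simp only [mul_neg, integral_neg, neg_inj] at key
  simp only [mul_comm _ (f _), mul_comm _ (g _)]
  exact key

/-- Cauchy–Schwarz for the probability measure with density η, then Tonelli and translation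
invariance. A measurable representative supplies the joint measurability of f(x − t). -/
lemma sqInt_mollify_le (hf : AEStronglyMeasurable f volume) : sqInt (mollify η f) ≤ sqInt f := by
  set f' := hf.mk f with hf'
  have hae : f =ᵐ[volume] f' := hf.ae_eq_mk
  have hm : Measurable f' := hf.stronglyMeasurable_mk.measurable
  have e : mollify η f = mollify η f' := convolution_congr _ (ae_eq_refl _) hae
  rw [e, sqInt_congr hae]
  have hηm : Measurable (fun t => ‖η.normed volume t‖ₑ) :=
    (isTest_normed η).1.continuous.enorm.measurable
  set ν := (volume : Measure (ℝ × ℝ)).withDensity (fun t => ‖η.normed volume t‖ₑ) with hν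
  have hν1 : ν univ = 1 := by
    rw [hν, withDensity_apply _ MeasurableSet.univ, Measure.restrict_univ]
    have := η.integral_normed (μ := (volume : Measure (ℝ × ℝ)))
    rw [← ofReal_integral_norm_eq_lintegral_enorm η.integrable_normed]
    simp only [Real.norm_of_nonneg (η.nonneg_normed _), this, ENNReal.ofReal_one]
  have : IsProbabilityMeasure ν := ⟨hν1⟩
  have hms : Measurable (Function.uncurry fun x t : ℝ × ℝ => ‖f' (x - t)‖ₑ ^ 2) :=
    ((hm.comp (measurable_fst.sub measurable_snd)).enorm.pow_const 2)
  have hpt : ∀ x, ‖mollify η f' x‖ₑ ^ 2 ≤ ∫⁻ t, ‖f' (x - t)‖ₑ ^ 2 ∂ν := by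
    intro x
    have hmx : Measurable fun t => ‖f' (x - t)‖ₑ := (hm.comp (measurable_const.sub measurable_id)).enorm
    have h1 : ‖mollify η f' x‖ₑ ≤ ∫⁻ t, ‖f' (x - t)‖ₑ * 1 ∂ν := by
      rw [mollify_apply, hν]
      refine (enorm_integral_le_lintegral_enorm _).trans ?_
      simp only [mul_one]
      rw [lintegral_withDensity_eq_lintegral_mul _ hηm hmx]
      simp [enorm_mul]
    refine (pow_le_pow_left' h1 2).trans ((lintegral_mul_sq_le hmx.aemeasurable
      aemeasurable_const).trans ?_)
    simp
  calc sqInt (mollify η f') ≤ ∫⁻ x, ∫⁻ t, ‖f' (x - t)‖ₑ ^ 2 ∂ν := lintegral_mono hpt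
    _ = ∫⁻ t, (∫⁻ x, ‖f' (x - t)‖ₑ ^ 2) ∂ν := lintegral_lintegral_swap hms.aemeasurable
    _ = ∫⁻ _, sqInt f' ∂ν := by
        refine lintegral_congr fun t => ?_
        exact lintegral_sub_right_eq_self (fun x => ‖f' x‖ₑ ^ 2) t
    _ = sqInt f' := by simp

end Mollification

/-! ### Ladyzhenskaya's inequality for weakly differentiable functions. -/

section Ladyzhenskaya

/-- Approximation of an `H¹` function by test functions. -/
lemma exists_test_approx : ∃ M : ℝ≥0∞, M ≠ ⊤ ∧ ∀ f g₁ g₂ : ℝ × ℝ → ℝ,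
    HasWeakDeriv (1, 0) f g₁ → HasWeakDeriv (0, 1) f g₂ →
    ∃ T : ℕ → ℝ × ℝ → ℝ, (∀ n, IsTest (T n)) ∧
      (∀ᵐ y, Tendsto (fun n => T n y) atTop (𝓝 (f y))) ∧
      ∀ n, sqInt (T n) ≤ M * sqInt f ∧ sqInt (d1 (T n)) ≤ M * (sqInt f + sqInt g₁) ∧
        sqInt (d2 (T n)) ≤ M * (sqInt f + sqInt g₂) := by
  obtain ⟨χ, hχ, h1⟩ := exists_test_eq_one
  have hc : ∀ n : ℕ, |((n : ℝ) + 1)⁻¹| ≤ 1 := fun n => by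
    rw [abs_of_nonneg (by positivity)]
    exact inv_le_one_of_one_le₀ (by linarith [(n.cast_nonneg : (0 : ℝ) ≤ n)])
  set X : ℕ → ℝ × ℝ → ℝ := fun n y => χ (((n : ℝ) + 1)⁻¹ • y) with hX
  have hXfam : RapidFam (fun _ => 1) X := hχ.dilate hc
  have hXtest : ∀ n, IsTest (X n) := fun n =>
    ⟨hχ.1.comp (by fun_prop), hχ.2.comp_smul (by positivity)⟩
  obtain ⟨C₀, hC₀⟩ := hXfam.dom 0
  obtain ⟨C₁, hC₁⟩ := hXfam.d1.dom 0
  obtain ⟨C₂, hC₂⟩ := hXfam.d2.dom 0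
  simp only [pow_zero, one_mul] at hC₀ hC₁ hC₂
  set C := max C₀ (max C₁ C₂) with hC
  have b0 : ∀ n y, |X n y| ≤ C := fun n y => (hC₀ n y).trans (le_max_left _ _)
  have b1 : ∀ n y, |d1 (X n) y| ≤ C := fun n y =>
    (hC₁ n y).trans ((le_max_left _ _).trans (le_max_right _ _))
  have b2 : ∀ n y, |d2 (X n) y| ≤ C := fun n y =>
    (hC₂ n y).trans ((le_max_right _ _).trans (le_max_right _ _))
  have hC0 : 0 ≤ C := (abs_nonneg _).trans (b0 0 0)
  refine ⟨‖C‖ₑ ^ 2 * 2, ENNReal.mul_ne_top (by simp) (by norm_num), fun f g₁ g₂ hg₁ hg₂ => ?_⟩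
  -- The ratio of outer to inner radius is kept at 2, as needed for almost everywhere convergence of
  -- the mollifications.
  set η : ℕ → ContDiffBump (0 : ℝ × ℝ) := fun n =>
    ⟨1 / ((n : ℝ) + 1), 2 * (1 / ((n : ℝ) + 1)), by positivity, by
      have : 0 < 1 / ((n : ℝ) + 1) := by positivity
      linarith⟩ with hη
  have hfm := hg₁.1.aestronglyMeasurable
  have hcm := fun n => mollify_contDiff (η n) hg₁.1
  have hle : ∀ {a : ℝ × ℝ → ℝ} {b : ℝ × ℝ → ℝ}, (∀ y, |a y| ≤ C) →
      sqInt (fun y => a y * b y) ≤ ‖C‖ₑ ^ 2 * sqInt b := by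
    intro a b ha
    rw [← sqInt_const_mul]
    refine sqInt_mono fun y => ?_
    rw [abs_mul, abs_mul, abs_of_nonneg hC0]
    gcongr
    exact ha y
  have hle2 : ∀ n {a a' : ℝ × ℝ → ℝ} {g : ℝ × ℝ → ℝ}, Continuous a → Continuous a' →
      (∀ y, |a y| ≤ C) → (∀ y, |a' y| ≤ C) → AEStronglyMeasurable g volume →
      AEStronglyMeasurable (mollify (η n) g) volume →
      sqInt (fun y => a y * mollify (η n) g y + a' y * mollify (η n) f y)
        ≤ ‖C‖ₑ ^ 2 * 2 * (sqInt f + sqInt g) := by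
    intro n a a' g ca ca' ha ha' hg hmg
    refine (sqInt_add_le (ca.aestronglyMeasurable.mul hmg)).trans ?_
    calc _ ≤ 2 * (‖C‖ₑ ^ 2 * sqInt g + ‖C‖ₑ ^ 2 * sqInt f) := by
          gcongr
          · exact (hle ha).trans (by gcongr; exact sqInt_mollify_le _ hg)
          · exact (hle ha').trans (by gcongr; exact sqInt_mollify_le _ hfm)
      _ = _ := by ring
  refine ⟨fun n y => X n y * mollify (η n) f y, fun n => ⟨?_, (hXtest n).2.mul_right⟩, ?_,
    fun n => ⟨?_, ?_, ?_⟩⟩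
  · exact (hXtest n).1.mul (hcm n)
  · have ht : Tendsto (fun n => (η n).rOut) atTop (𝓝 0) := by
      have := (tendsto_one_div_add_atTop_nhds_zero_nat (𝕜 := ℝ)).const_mul 2
      simpa [hη] using this
    have hae := ContDiffBump.ae_convolution_tendsto_right_of_locallyIntegrable (φ := η) (K := 2)
      ht (Eventually.of_forall fun n => le_rfl) hg₁.1
    filter_upwards [hae] with y hy
    refine hy.congr' ?_
    obtain ⟨N, hN⟩ := exists_nat_gt ‖y‖
    filter_upwards [eventually_ge_atTop N] with n hn
    have hn' : (N : ℝ) ≤ n := by exact_mod_cast hn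
    have : X n y = 1 := by
      apply h1
      rw [norm_smul, Real.norm_of_nonneg (by positivity), inv_mul_le_iff₀ (by positivity)]
      linarith
    simp only [this, one_mul]
    rfl
  · refine (hle (b0 n)).trans ?_
    calc _ ≤ ‖C‖ₑ ^ 2 * sqInt f := by gcongr; exact sqInt_mollify_le _ hfm
      _ ≤ _ := by gcongr; exact le_mul_of_one_le_right (by simp) (by norm_num)
  · have e : d1 (mollify (η n) f) = mollify (η n) g₁ := funext fun y => fderiv_mollify _ hg₁ y
    rw [d1_mul (smooth_differentiable (hXtest n).1) (smooth_differentiable (hcm n)), e]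
    exact hle2 n (hXtest n).1.continuous (hXtest n).d1.1.continuous (b0 n) (b1 n)
      hg₁.2.1.aestronglyMeasurable (mollify_contDiff _ hg₁.2.1).continuous.aestronglyMeasurable
  · have e : d2 (mollify (η n) f) = mollify (η n) g₂ := funext fun y => fderiv_mollify _ hg₂ y
    rw [d2_mul (smooth_differentiable (hXtest n).1) (smooth_differentiable (hcm n)), e]
    exact hle2 n (hXtest n).1.continuous (hXtest n).d2.1.continuous (b0 n) (b2 n)
      hg₂.2.1.aestronglyMeasurable (mollify_contDiff _ hg₂.2.1).continuous.aestronglyMeasurable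

/-- Fatou's lemma along the test approximations. The full H¹ norm appears, not only the gradient,
because derivatives of the cutoff fall on f. -/
lemma exists_ladyzhenskaya_weak : ∃ K : ℝ≥0∞, K ≠ ⊤ ∧ ∀ f g₁ g₂ : ℝ × ℝ → ℝ,
    HasWeakDeriv (1, 0) f g₁ → HasWeakDeriv (0, 1) f g₂ →
    ∫⁻ y, ‖f y‖ₑ ^ 4 ≤ K * (sqInt f * (sqInt f + sqInt g₁ + sqInt g₂)) := by
  obtain ⟨K, hK, hlad⟩ := exists_ladyzhenskaya_test
  obtain ⟨M, hM, happ⟩ := exists_test_approx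
  refine ⟨K * M * M * 2, by finiteness, fun f g₁ g₂ h₁ h₂ => ?_⟩
  obtain ⟨T, hT, hlim, hb⟩ := happ f g₁ g₂ h₁ h₂
  calc ∫⁻ y, ‖f y‖ₑ ^ 4 = ∫⁻ y, liminf (fun n => ‖T n y‖ₑ ^ 4) atTop := by
        refine lintegral_congr_ae (hlim.mono fun y hy => ?_)
        have : Tendsto (fun n => ‖T n y‖ₑ ^ 4) atTop (𝓝 (‖f y‖ₑ ^ 4)) :=
          ((ENNReal.continuous_pow 4).tendsto _).comp hy.enorm
        exact this.liminf_eq.symm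
    _ ≤ liminf (fun n => ∫⁻ y, ‖T n y‖ₑ ^ 4) atTop :=
        lintegral_liminf_le fun n => (hT n).1.continuous.enorm.measurable.pow_const 4
    _ ≤ liminf (fun _ : ℕ => K * M * M * 2 * (sqInt f * (sqInt f + sqInt g₁ + sqInt g₂))) atTop := by
        refine liminf_le_liminf (Eventually.of_forall fun n => ?_)
        obtain ⟨b0, b1, b2⟩ := hb n
        calc ∫⁻ y, ‖T n y‖ₑ ^ 4 ≤ K * (sqInt (T n) * (sqInt (d1 (T n)) + sqInt (d2 (T n)))) :=
              hlad _ (hT n)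
          _ ≤ K * (M * sqInt f * (M * (sqInt f + sqInt g₁) + M * (sqInt f + sqInt g₂))) := by gcongr
          _ ≤ K * (M * sqInt f * (M * (sqInt f + sqInt g₁ + sqInt g₂)
                + M * (sqInt f + sqInt g₁ + sqInt g₂))) := by
              have i1 : sqInt f + sqInt g₁ ≤ sqInt f + sqInt g₁ + sqInt g₂ := le_self_add
              have i2 : sqInt f + sqInt g₂ ≤ sqInt f + sqInt g₁ + sqInt g₂ := by
                rw [add_right_comm]; exact le_self_add
              exact mul_le_mul_right (mul_le_mul_right (add_le_add (mul_le_mul_right i1 _)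
                (mul_le_mul_right i2 _)) _) _
          _ = _ := by ring
    _ = _ := liminf_const _

end Ladyzhenskaya

/-! ### The norm of L² and the Cauchy–Schwarz inequality. -/

section L2

variable {f g : ℝ × ℝ → ℝ}

lemma l2Norm_nonneg (f : ℝ × ℝ → ℝ) : 0 ≤ l2Norm f := ENNReal.toReal_nonneg

lemma l2NormOn_nonneg (S : Set (ℝ × ℝ)) (f : ℝ × ℝ → ℝ) : 0 ≤ l2NormOn S f :=
  ENNReal.toReal_nonneg

lemma h1Norm_nonneg (f : ℝ × ℝ → ℝ) : 0 ≤ h1Norm f := Real.sqrt_nonneg _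

lemma l2Norm_le_h1Norm (f : ℝ × ℝ → ℝ) : l2Norm f ≤ h1Norm f :=
  Real.le_sqrt_of_sq_le (by
    nlinarith [sq_nonneg (l2Norm (weakDeriv (1, 0) f)), sq_nonneg (l2Norm (weakDeriv (0, 1) f))])

lemma eLpNorm_restrict_sq (S : Set (ℝ × ℝ)) (hf : MemLp f 2 (volume.restrict S)) :
    l2NormOn S f ^ 2 = ∫ y in S, f y ^ 2 := by
  have h := hf.eLpNorm_eq_integral_rpow_norm (by norm_num) (by norm_num)
  have h0 : 0 ≤ ∫ y in S, f y ^ 2 := integral_nonneg fun y => sq_nonneg _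
  simp only [ENNReal.toReal_ofNat, Real.rpow_two, Real.norm_eq_abs, sq_abs] at h
  rw [l2NormOn, h, ENNReal.toReal_ofReal (by positivity), ← Real.rpow_two, ← Real.rpow_mul h0]
  norm_num

lemma l2Norm_eq_l2NormOn (f : ℝ × ℝ → ℝ) : l2Norm f = l2NormOn univ f := by
  rw [l2Norm, l2NormOn, Measure.restrict_univ]

lemma l2Norm_sq (hf : MemLp f 2 volume) : l2Norm f ^ 2 = ∫ y, f y ^ 2 := by
  rw [l2Norm_eq_l2NormOn, eLpNorm_restrict_sq _ (by rwa [Measure.restrict_univ]),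
    Measure.restrict_univ]

lemma l2Norm_eq_sqrt (hf : MemLp f 2 volume) : l2Norm f = √(∫ y, f y ^ 2) := by
  rw [← l2Norm_sq hf, Real.sqrt_sq (l2Norm_nonneg f)]

lemma sqInt_eq (hf : MemLp f 2 volume) : sqInt f = ENNReal.ofReal (l2Norm f ^ 2) := by
  rw [l2Norm_sq hf, ofReal_integral_eq_lintegral_ofReal hf.integrable_sq
    (ae_of_all _ fun y => sq_nonneg _)]
  refine lintegral_congr fun y => ?_
  rw [← Real.enorm_eq_ofReal (sq_nonneg _), enorm_pow]

lemma abs_integral_mul_le_l2NormOn (S : Set (ℝ × ℝ)) (hf : MemLp f 2 (volume.restrict S))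
    (hg : MemLp g 2 (volume.restrict S)) :
    |∫ y in S, f y * g y| ≤ l2NormOn S f * l2NormOn S g := by
  have h := integral_mul_norm_le_Lp_mul_Lq (μ := volume.restrict S) Real.HolderConjugate.two_two
    (f := f) (g := g) (by simpa using hf) (by simpa using hg)
  simp only [Real.rpow_two, Real.norm_eq_abs, sq_abs] at h
  rw [← eLpNorm_restrict_sq S hf, ← eLpNorm_restrict_sq S hg, ← Real.sqrt_eq_rpow,
    ← Real.sqrt_eq_rpow, Real.sqrt_sq (l2NormOn_nonneg S f),
    Real.sqrt_sq (l2NormOn_nonneg S g)] at h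
  refine le_trans ?_ h
  simp only [← abs_mul]
  exact abs_integral_le_integral_abs

lemma abs_integral_mul_le (hf : MemLp f 2 volume) (hg : MemLp g 2 volume) :
    |∫ y, f y * g y| ≤ l2Norm f * l2Norm g := by
  have := abs_integral_mul_le_l2NormOn (f := f) (g := g) univ (by rwa [Measure.restrict_univ])
    (by rwa [Measure.restrict_univ])
  rwa [Measure.restrict_univ, ← l2Norm_eq_l2NormOn, ← l2Norm_eq_l2NormOn] at this

lemma l2Norm_le_of_abs_le (hg : MemLp g 2 volume) (h : ∀ y, |f y| ≤ |g y|) :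
    l2Norm f ≤ l2Norm g :=
  ENNReal.toReal_mono hg.eLpNorm_ne_top (eLpNorm_mono h)

lemma l2Norm_const_mul (c : ℝ) (f : ℝ × ℝ → ℝ) : l2Norm (fun y => c * f y) = |c| * l2Norm f := by
  have := eLpNorm_const_smul c f 2 volume
  unfold l2Norm
  rw [show (fun y => c * f y) = c • f from rfl, this, ENNReal.toReal_mul]
  simp

lemma l2Norm_congr (h : f =ᵐ[volume] g) : l2Norm f = l2Norm g := by
  unfold l2Norm; rw [eLpNorm_congr_ae h]

end L2

/-! ### Cubes of H¹ functions. -/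

section Cubes

variable {f g : ℝ × ℝ → ℝ}

lemma HasWeakDeriv.sub {v : ℝ × ℝ} {f' g' : ℝ × ℝ → ℝ} (hf : HasWeakDeriv v f f')
    (hg : HasWeakDeriv v g g') : HasWeakDeriv v (fun y => f y - g y) (fun y => f' y - g' y) := by
  refine ⟨hf.1.sub hg.1, hf.2.1.sub hg.2.1, fun ψ hψ => ?_⟩
  simp only [sub_mul]
  have hψ' := hψ.fderiv_apply v
  rw [integral_sub (locallyIntegrable_mul_test hf.1 hψ') (locallyIntegrable_mul_test hg.1 hψ'),
    integral_sub (locallyIntegrable_mul_test hf.2.1 hψ) (locallyIntegrable_mul_test hg.2.1 hψ),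
    hf.2.2 ψ hψ, hg.2.2 ψ hψ]
  ring

lemma MemH1.sub (hf : MemH1 f) (hg : MemH1 g) : MemH1 (fun y => f y - g y) := by
  obtain ⟨h0, ⟨f1, hf1, hw1⟩, ⟨f2, hf2, hw2⟩⟩ := hf
  obtain ⟨k0, ⟨g1, hg1, kw1⟩, ⟨g2, hg2, kw2⟩⟩ := hg
  exact ⟨h0.sub k0, ⟨_, hf1.sub hg1, hw1.sub kw1⟩, ⟨_, hf2.sub hg2, hw2.sub kw2⟩⟩

lemma exists_ladyzhenskaya : ∃ K : ℝ, 0 ≤ K ∧ ∀ f : ℝ × ℝ → ℝ, MemH1 f →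
    Integrable (fun y => f y ^ 4) ∧ ∫ y, f y ^ 4 ≤ K * (l2Norm f ^ 2 * h1Norm f ^ 2) := by
  obtain ⟨K, hK, h⟩ := exists_ladyzhenskaya_weak
  refine ⟨K.toReal, ENNReal.toReal_nonneg, fun f hf => ?_⟩
  obtain ⟨h0, ⟨f1, hf1, hw1⟩, ⟨f2, hf2, hw2⟩⟩ := hf
  have hb := h f f1 f2 hw1 hw2
  have e1 : h1Norm f ^ 2 = l2Norm f ^ 2 + l2Norm f1 ^ 2 + l2Norm f2 ^ 2 := by
    rw [h1Norm, Real.sq_sqrt (by positivity), l2Norm_congr hw1.weakDeriv_ae_eq,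
      l2Norm_congr hw2.weakDeriv_ae_eq]
  have e2 : K * (sqInt f * (sqInt f + sqInt f1 + sqInt f2))
      = ENNReal.ofReal (K.toReal * (l2Norm f ^ 2 * h1Norm f ^ 2)) := by
    rw [e1, sqInt_eq h0, sqInt_eq hf1, sqInt_eq hf2, ← ENNReal.ofReal_add (by positivity)
      (by positivity), ← ENNReal.ofReal_add (by positivity) (by positivity),
      ← ENNReal.ofReal_mul (by positivity), ENNReal.ofReal_mul ENNReal.toReal_nonneg,
      ENNReal.ofReal_toReal hK]
  rw [e2] at hb
  have e3 : ∀ y, ‖f y ^ 4‖ₑ = ‖f y‖ₑ ^ 4 := fun y => enorm_pow _ _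
  have hint : Integrable (fun y => f y ^ 4) := by
    refine ⟨h0.aestronglyMeasurable.pow 4, ?_⟩
    unfold HasFiniteIntegral
    simp_rw [e3]
    exact hb.trans_lt ENNReal.ofReal_lt_top
  refine ⟨hint, ?_⟩
  rw [← ENNReal.ofReal_le_ofReal_iff (by positivity), ofReal_integral_eq_lintegral_ofReal hint
    (ae_of_all _ fun y => by positivity)]
  refine le_trans (le_of_eq (lintegral_congr fun y => ?_)) hb
  rw [← Real.enorm_eq_ofReal (by positivity), e3]

lemma MemH1.integrable_pow_four (hf : MemH1 f) : Integrable (fun y => f y ^ 4) := by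
  obtain ⟨K, -, h⟩ := exists_ladyzhenskaya
  exact (h f hf).1

lemma MemH1.memLp_sq (hf : MemH1 f) : MemLp (fun y => f y ^ 2) 2 volume := by
  refine (memLp_two_iff_integrable_sq (hf.1.aestronglyMeasurable.pow 2)).2 ?_
  exact hf.integrable_pow_four.congr (ae_of_all _ fun y => by simp only [Pi.pow_apply]; ring)

lemma MemH1.l2Norm_sq_fun (hf : MemH1 f) : l2Norm (fun y => f y ^ 2) = √(∫ y, f y ^ 4) := by
  rw [l2Norm_eq_sqrt hf.memLp_sq]
  simp only [← pow_mul]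

lemma MemH1.integrable_cube (hf : MemH1 f) : Integrable (fun y => f y ^ 3) :=
  (hf.1.integrable_mul hf.memLp_sq).congr (ae_of_all _ fun y => by simp only [Pi.mul_apply]; ring)

lemma memLp_abs (hf : MemLp f 2 volume) : MemLp (fun y => |f y|) 2 volume := hf.norm

lemma l2Norm_abs (f : ℝ × ℝ → ℝ) : l2Norm (fun y => |f y|) = l2Norm f := by
  unfold l2Norm
  exact congrArg _ (eLpNorm_norm f)

/-- The cubic Gagliardo-Nirenberg inequality. -/
lemma exists_cube_le : ∃ K : ℝ, 0 ≤ K ∧ ∀ f : ℝ × ℝ → ℝ, MemH1 f →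
    ∫ y, |f y| ^ 3 ≤ K * (l2Norm f ^ 2 * h1Norm f) := by
  obtain ⟨K, hK, h⟩ := exists_ladyzhenskaya
  refine ⟨√K, Real.sqrt_nonneg _, fun f hf => ?_⟩
  have h1 := abs_integral_mul_le (memLp_abs hf.1) hf.memLp_sq
  rw [l2Norm_abs, hf.l2Norm_sq_fun] at h1
  have h2 : √(∫ y, f y ^ 4) ≤ √K * (l2Norm f * h1Norm f) := by
    rw [← Real.sqrt_sq (mul_nonneg (l2Norm_nonneg f) (h1Norm_nonneg f)), ← Real.sqrt_mul hK]
    exact Real.sqrt_le_sqrt ((h f hf).2.trans_eq (by ring))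
  have e : ∀ y, |f y| * f y ^ 2 = |f y| ^ 3 := fun y => by rw [← sq_abs]; ring
  simp_rw [e] at h1
  calc _ ≤ l2Norm f * √(∫ y, f y ^ 4) := (le_abs_self _).trans h1
    _ ≤ l2Norm f * (√K * (l2Norm f * h1Norm f)) := by gcongr; exact l2Norm_nonneg f
    _ = _ := by ring

lemma abs_cube_sub_le (a b : ℝ) : |a ^ 3 - b ^ 3| ≤ 2 * (|a - b| * a ^ 2 + |a - b| * b ^ 2) := by
  have h : a ^ 3 - b ^ 3 = (a - b) * (a ^ 2 + a * b + b ^ 2) := by ring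
  rw [h, abs_mul]
  have h2 : |a ^ 2 + a * b + b ^ 2| ≤ 2 * (a ^ 2 + b ^ 2) := by
    rw [abs_le]; constructor <;> nlinarith [sq_nonneg (a + b), sq_nonneg (a - b)]
  calc _ ≤ |a - b| * (2 * (a ^ 2 + b ^ 2)) := by gcongr
    _ = _ := by ring

lemma integral_abs_cube_sub_le (hf : MemH1 f) (hg : MemH1 g) :
    ∫ y, |f y ^ 3 - g y ^ 3|
      ≤ 2 * l2Norm (fun y => f y - g y) * (√(∫ y, f y ^ 4) + √(∫ y, g y ^ 4)) := by
  have hd := memLp_abs (hf.sub hg).1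
  have i1 : Integrable (fun y => |f y - g y| * f y ^ 2) := hd.integrable_mul hf.memLp_sq
  have i2 : Integrable (fun y => |f y - g y| * g y ^ 2) := hd.integrable_mul hg.memLp_sq
  have h1 := (le_abs_self _).trans (abs_integral_mul_le hd hf.memLp_sq)
  have h2 := (le_abs_self _).trans (abs_integral_mul_le hd hg.memLp_sq)
  rw [l2Norm_abs, hf.l2Norm_sq_fun] at h1
  rw [l2Norm_abs, hg.l2Norm_sq_fun] at h2
  calc ∫ y, |f y ^ 3 - g y ^ 3|
      ≤ ∫ y, 2 * (|f y - g y| * f y ^ 2 + |f y - g y| * g y ^ 2) :=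
        integral_mono (hf.integrable_cube.sub hg.integrable_cube).abs ((i1.add i2).const_mul 2)
          fun y => abs_cube_sub_le _ _
    _ = 2 * ((∫ y, |f y - g y| * f y ^ 2) + ∫ y, |f y - g y| * g y ^ 2) := by
        rw [integral_const_mul, integral_add i1 i2]
    _ ≤ _ := by linarith

end Cubes

/-! ### Continuity in time and the equation against Schwartz functions. -/

namespace IsH1Solution

variable {u : ℝ → ℝ × ℝ → ℝ}

lemma tendsto_l2Norm_sub (hu : IsH1Solution u) {t₀ : ℝ} (ht : 0 ≤ t₀) :
    Tendsto (fun t => l2Norm (fun x => u t x - u t₀ x)) (𝓝[Ici 0] t₀) (𝓝 0) :=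
  squeeze_zero (fun _ => l2Norm_nonneg _) (fun _ => l2Norm_le_h1Norm _) (hu.continuous t₀ ht)

/-- Continuity of u³ in L¹: the L² distance goes to 0, while (a + b)⁴ ≤ 8(a⁴ + b⁴) and
Ladyzhenskaya's inequality bound the L⁴ norms near t₀. -/
lemma tendsto_integral_cube_sub (hu : IsH1Solution u) {t₀ : ℝ} (ht : 0 ≤ t₀) :
    Tendsto (fun t => ∫ x, |u t x ^ 3 - u t₀ x ^ 3|) (𝓝[Ici 0] t₀) (𝓝 0) := by
  obtain ⟨K, hK, h⟩ := exists_ladyzhenskaya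
  set D : ℝ → ℝ := fun t => h1Norm (fun x => u t x - u t₀ x) with hD
  set B := ∫ x, u t₀ x ^ 4 with hB
  have hlim : Tendsto (fun t => 2 * D t * (√(8 * (K * (D t ^ 2 * D t ^ 2)) + 8 * B) + √B))
      (𝓝[Ici 0] t₀) (𝓝 0) := by
    have hc := hu.continuous t₀ ht
    have : Continuous fun d : ℝ => 2 * d * (√(8 * (K * (d ^ 2 * d ^ 2)) + 8 * B) + √B) := by
      fun_prop
    have h2 := (this.tendsto 0).comp hc
    simpa [Function.comp_def] using h2
  refine squeeze_zero' (Eventually.of_forall fun t => integral_nonneg fun x => abs_nonneg _) ?_ hlim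
  filter_upwards [self_mem_nhdsWithin] with t htm
  have m1 := hu.memH1 t htm
  have m0 := hu.memH1 t₀ ht
  have md := m1.sub m0
  refine (integral_abs_cube_sub_le m1 m0).trans ?_
  have hl : l2Norm (fun x => u t x - u t₀ x) ≤ D t := l2Norm_le_h1Norm _
  have hDn : 0 ≤ D t := h1Norm_nonneg _
  have h4 : ∫ x, u t x ^ 4 ≤ 8 * (K * (D t ^ 2 * D t ^ 2)) + 8 * B := by
    calc ∫ x, u t x ^ 4 ≤ ∫ x, 8 * (u t x - u t₀ x) ^ 4 + 8 * u t₀ x ^ 4 := by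
          refine integral_mono m1.integrable_pow_four
            ((md.integrable_pow_four.const_mul 8).add (m0.integrable_pow_four.const_mul 8))
            fun x => ?_
          simp only
          nlinarith [sq_nonneg ((u t x - u t₀ x) ^ 2 - u t₀ x ^ 2), sq_nonneg (u t x - 2 * u t₀ x),
            sq_nonneg ((u t x - u t₀ x) - u t₀ x), sq_nonneg ((u t x - u t₀ x) + u t₀ x),
            sq_nonneg (((u t x - u t₀ x) - u t₀ x) ^ 2),
            mul_nonneg (sq_nonneg ((u t x - u t₀ x) - u t₀ x)) (sq_nonneg ((u t x - u t₀ x) + u t₀ x)),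
            mul_nonneg (sq_nonneg ((u t x - u t₀ x) - u t₀ x)) (sq_nonneg (u t x - u t₀ x)),
            mul_nonneg (sq_nonneg ((u t x - u t₀ x) - u t₀ x)) (sq_nonneg (u t₀ x))]
      _ = 8 * (∫ x, (u t x - u t₀ x) ^ 4) + 8 * B := by
          rw [integral_add (md.integrable_pow_four.const_mul 8)
            (m0.integrable_pow_four.const_mul 8), integral_const_mul, integral_const_mul]
      _ ≤ _ := by
          have := (h _ md).2
          have h3 : K * (l2Norm (fun x => u t x - u t₀ x) ^ 2 * D t ^ 2)
              ≤ K * (D t ^ 2 * D t ^ 2) := by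
            gcongr; exact l2Norm_nonneg _
          linarith
  gcongr

end IsH1Solution

section Locality

variable {f g : ℝ × ℝ → ℝ} {y : ℝ × ℝ}

/-- Truncations agree with the function near each point, hence so do their derivatives. -/
lemma d1_eventuallyEq (h : f =ᶠ[𝓝 y] g) : d1 f =ᶠ[𝓝 y] d1 g :=
  h.fderiv.mono fun z hz => by simp only [d1]; rw [hz]

lemma d2_eventuallyEq (h : f =ᶠ[𝓝 y] g) : d2 f =ᶠ[𝓝 y] d2 g :=
  h.fderiv.mono fun z hz => by simp only [d2]; rw [hz]

lemma lap_eventuallyEq (h : f =ᶠ[𝓝 y] g) : lap f =ᶠ[𝓝 y] lap g :=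
  (d1_eventuallyEq (d1_eventuallyEq h)).add (d2_eventuallyEq (d2_eventuallyEq h))

end Locality

lemma integrable_mul_bounded {U h : ℝ × ℝ → ℝ} (hU : Integrable U) (hh : Continuous h) {C : ℝ}
    (hC : ∀ y, |h y| ≤ C) : Integrable (fun y => U y * h y) :=
  hU.mul_bdd hh.aestronglyMeasurable (ae_of_all _ hC)

lemma abs_integral_mul_le_of_bounded {U h : ℝ × ℝ → ℝ} (hU : Integrable U) {C : ℝ}
    (hC : ∀ y, |h y| ≤ C) : |∫ y, U y * h y| ≤ C * ∫ y, |U y| := by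
  rw [← integral_const_mul]
  refine norm_integral_le_of_norm_le (f := fun y => U y * h y) (hU.abs.const_mul C) (ae_of_all _ fun y => ?_)
  rw [Real.norm_eq_abs, abs_mul, mul_comm]
  gcongr
  exact hC y

namespace IsH1Solution

variable {u : ℝ → ℝ × ℝ → ℝ} {ψ : ℝ × ℝ → ℝ}

/-- The weak form of `-∂₁(Δu + u³)` tested against `ψ`. -/
def rhs (u : ℝ → ℝ × ℝ → ℝ) (ψ : ℝ × ℝ → ℝ) (t : ℝ) : ℝ :=
  (∫ x, u t x * d1 (lap ψ) x) + ∫ x, u t x ^ 3 * d1 ψ x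

/-- The test function enters only through C, so the modulus of continuity in time is common to all
truncations. -/
lemma abs_rhs_sub_le (hu : IsH1Solution u) (hψ : Rapid ψ) {C : ℝ} (hC : 0 ≤ C)
    (h1 : ∀ y, |d1 (lap ψ) y| ≤ C * maj y) (h2 : ∀ y, |d1 ψ y| ≤ C) {t t₀ : ℝ} (ht : 0 ≤ t)
    (ht₀ : 0 ≤ t₀) : |rhs u ψ t - rhs u ψ t₀| ≤
      C * (l2Norm (fun x => u t x - u t₀ x) * l2Norm maj + ∫ x, |u t x ^ 3 - u t₀ x ^ 3|) := by
  have m1 := hu.memH1 t ht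
  have m0 := hu.memH1 t₀ ht₀
  have hψ3 := hψ.lap.d1
  have i1 := m1.1.integrable_mul hψ3.memLp
  have i0 := m0.1.integrable_mul hψ3.memLp
  have j1 := integrable_mul_bounded m1.integrable_cube hψ.d1.continuous h2
  have j0 := integrable_mul_bounded m0.integrable_cube hψ.d1.continuous h2
  have e : rhs u ψ t - rhs u ψ t₀ = (∫ x, (u t x - u t₀ x) * d1 (lap ψ) x)
      + ∫ x, (u t x ^ 3 - u t₀ x ^ 3) * d1 ψ x := by
    have e1 : ∫ x, (u t x - u t₀ x) * d1 (lap ψ) x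
        = (∫ x, u t x * d1 (lap ψ) x) - ∫ x, u t₀ x * d1 (lap ψ) x := by
      simp only [sub_mul]; exact integral_sub i1 i0
    have e2 : ∫ x, (u t x ^ 3 - u t₀ x ^ 3) * d1 ψ x
        = (∫ x, u t x ^ 3 * d1 ψ x) - ∫ x, u t₀ x ^ 3 * d1 ψ x := by
      simp only [sub_mul]; exact integral_sub j1 j0
    rw [e1, e2]; unfold rhs; ring
  rw [e]
  have b1 := abs_integral_mul_le (m1.sub m0).1 hψ3.memLp
  have b2 := abs_integral_mul_le_of_bounded (m1.integrable_cube.sub m0.integrable_cube) h2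
  simp only [Pi.sub_apply] at b2
  have b3 : l2Norm (d1 (lap ψ)) ≤ C * l2Norm maj := by
    have := l2Norm_le_of_abs_le (f := d1 (lap ψ)) (memLp_maj.const_mul C)
      (fun y => (h1 y).trans (le_abs_self _))
    rwa [l2Norm_const_mul, abs_of_nonneg hC] at this
  have hn := l2Norm_nonneg (fun x => u t x - u t₀ x)
  calc _ ≤ |∫ x, (u t x - u t₀ x) * d1 (lap ψ) x| + |∫ x, (u t x ^ 3 - u t₀ x ^ 3) * d1 ψ x| :=
        abs_add_le _ _
    _ ≤ l2Norm (fun x => u t x - u t₀ x) * (C * l2Norm maj)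
        + C * ∫ x, |u t x ^ 3 - u t₀ x ^ 3| := by
        refine add_le_add (b1.trans ?_) b2
        gcongr
    _ = _ := by ring

/-- The equation tested against Schwartz functions. -/
lemma hasDerivWithinAt_rapid (hu : IsH1Solution u) (hψ : Rapid ψ) {t₀ : ℝ} (ht₀ : 0 ≤ t₀) :
    HasDerivWithinAt (fun τ => ∫ x, u τ x * ψ x) (rhs u ψ t₀) (Ici 0) t₀ := by
  obtain ⟨T, hT, hTr, hTe⟩ := hψ.exists_truncation
  obtain ⟨C₀, hC₀, b₀⟩ := hTr.dom.le_maj 0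
  obtain ⟨C₁, hC₁, b₁⟩ := hTr.d1.dom.le_maj 0
  obtain ⟨C₃, hC₃, b₃⟩ := (RapidFam.d1 (RapidFam.lap wt_nonneg hTr)).dom.le_maj 0
  simp only [pow_zero, one_mul] at b₀ b₁ b₃
  have b₁' : ∀ n y, |d1 (T n) y| ≤ C₁ := fun n y =>
    (b₁ n y).trans (mul_le_of_le_one_right hC₁ (maj_le_one y))
  set C := max C₁ C₃ with hC
  have hC0 : 0 ≤ C := hC₁.trans (le_max_left _ _)
  have lim0 : ∀ {t}, 0 ≤ t →
      Tendsto (fun n => ∫ x, u t x * T n x) atTop (𝓝 (∫ x, u t x * ψ x)) := by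
    intro t ht
    have hm := (hu.memH1 t ht).1
    refine tendsto_integral_of_dominated_convergence (fun x => |u t x| * (C₀ * maj x))
      (fun n => hm.aestronglyMeasurable.mul (hT n).1.continuous.aestronglyMeasurable)
      ((memLp_abs hm).integrable_mul (memLp_maj.const_mul C₀))
      (fun n => ae_of_all _ fun x => ?_) (ae_of_all _ fun x => ?_)
    · rw [Real.norm_eq_abs, abs_mul]; gcongr; exact b₀ n x
    · exact tendsto_const_nhds.congr' ((hTe x).mono fun n hn => by simp only [hn.eq_of_nhds])
  have lim1 : Tendsto (fun n => rhs u (T n) t₀) atTop (𝓝 (rhs u ψ t₀)) := by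
    have hm := hu.memH1 t₀ ht₀
    refine Tendsto.add ?_ ?_
    · refine tendsto_integral_of_dominated_convergence (fun x => |u t₀ x| * (C₃ * maj x))
        (fun n => hm.1.aestronglyMeasurable.mul
          (d1_contDiff (lap_contDiff (hT n).1)).continuous.aestronglyMeasurable)
        ((memLp_abs hm.1).integrable_mul (memLp_maj.const_mul C₃))
        (fun n => ae_of_all _ fun x => ?_) (ae_of_all _ fun x => ?_)
      · rw [Real.norm_eq_abs, abs_mul]; gcongr; exact b₃ n x
      · exact tendsto_const_nhds.congr' ((hTe x).mono fun n hn => by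
          simp only [(d1_eventuallyEq (lap_eventuallyEq hn)).eq_of_nhds])
    · refine tendsto_integral_of_dominated_convergence (fun x => |u t₀ x ^ 3| * C₁)
        (fun n => hm.integrable_cube.aestronglyMeasurable.mul
          (hT n).d1.1.continuous.aestronglyMeasurable)
        (hm.integrable_cube.abs.mul_const C₁)
        (fun n => ae_of_all _ fun x => ?_) (ae_of_all _ fun x => ?_)
      · rw [Real.norm_eq_abs, abs_mul]; gcongr; exact b₁' n x
      · exact tendsto_const_nhds.congr' ((hTe x).mono fun n hn => by
          simp only [(d1_eventuallyEq hn).eq_of_nhds])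
  have hω : Tendsto (fun t => C * (l2Norm (fun x => u t x - u t₀ x) * l2Norm maj
      + ∫ x, |u t x ^ 3 - u t₀ x ^ 3|)) (𝓝[Ici 0] t₀) (𝓝 0) := by
    have := (((hu.tendsto_l2Norm_sub ht₀).mul_const (l2Norm maj)).add
      (hu.tendsto_integral_cube_sub ht₀)).const_mul C
    simpa using this
  rw [hasDerivWithinAt_iff_isLittleO, Asymptotics.isLittleO_iff]
  intro ε hε
  obtain ⟨δ, hδ, hball⟩ := Metric.mem_nhdsWithin_iff.1 (hω.eventually (gt_mem_nhds hε))
  refine Metric.mem_nhdsWithin_iff.2 ⟨δ, hδ, fun t ht => ?_⟩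
  set S := Metric.ball t₀ δ ∩ Ici 0 with hS
  have hconv : Convex ℝ S := (convex_ball _ _).inter (convex_Ici 0)
  have hmem₀ : t₀ ∈ S := ⟨Metric.mem_ball_self hδ, ht₀⟩
  -- The mean value inequality gives the first-order expansion with an error uniform in n, so it
  -- survives n → ∞.
  have hn : ∀ n, ‖(∫ x, u t x * T n x) - (∫ x, u t₀ x * T n x) - (t - t₀) • rhs u (T n) t₀‖
      ≤ ε * ‖t - t₀‖ := by
    intro n
    have hd : ∀ τ ∈ S, HasDerivWithinAt (fun τ => (∫ x, u τ x * T n x) - τ * rhs u (T n) t₀)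
        (rhs u (T n) τ - rhs u (T n) t₀) S τ := by
      intro τ hτ
      have h1 := (hu.eq (T n) (hT n) τ hτ.2).mono (inter_subset_right : S ⊆ Ici 0)
      have h2 := (hasDerivWithinAt_id τ S).mul_const (rhs u (T n) t₀)
      exact (h1.fun_sub h2).congr_deriv (by rw [one_mul]; rfl)
    have hb : ∀ τ ∈ S, ‖rhs u (T n) τ - rhs u (T n) t₀‖ ≤ ε := by
      intro τ hτ
      refine (hu.abs_rhs_sub_le (hT n).rapid hC0 (fun y => (b₃ n y).trans ?_)
        (fun y => (b₁' n y).trans (le_max_left _ _)) hτ.2 ht₀).trans (le_of_lt (hball hτ))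
      exact mul_le_mul_of_nonneg_right (le_max_right _ _) (maj_pos y).le
    have := hconv.norm_image_sub_le_of_norm_hasDerivWithin_le hd hb hmem₀ ht
    refine le_trans (le_of_eq ?_) this
    congr 1
    simp only [smul_eq_mul]; ring
  exact le_of_tendsto (((lim0 ht.2).sub (lim0 ht₀)).sub (lim1.const_smul _)).norm (Eventually.of_forall hn)

end IsH1Solution

/-! ### Change of variables to the moving frame. -/

/-- The rescaled solution `lam u(t, lam y₁ + x, lam y₂)`. -/
def pull (u : ℝ → ℝ × ℝ → ℝ) (lam x : ℝ → ℝ) (s : ℝ) (y : ℝ × ℝ) : ℝ :=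
  lam s * u (origTime lam s) (lam s * y.1 + x s, lam s * y.2)

/-- The inverse of the change of variables `y ↦ lam y + x e₁`. -/
def frame (lam x : ℝ → ℝ) (s : ℝ) (y : ℝ × ℝ) : ℝ × ℝ := (lam s)⁻¹ • y + (-(x s / lam s), 0)

/-- The test function `g` transported to the original variables. -/
def push (lam x : ℝ → ℝ) (g : ℝ × ℝ → ℝ) (s : ℝ) (y : ℝ × ℝ) : ℝ := (lam s)⁻¹ * g (frame lam x s y)

lemma Rapid.scalingGen {g : ℝ × ℝ → ℝ} (hg : Rapid g) : Rapid (scalingGen g) :=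
  (hg.add hg.d1.fst_mul).add hg.d2.snd_mul

lemma integral_comp_affine (h : ℝ × ℝ → ℝ) (l a : ℝ) :
    ∫ y : ℝ × ℝ, h (l * y.1 + a, l * y.2) = (l ^ 2)⁻¹ * ∫ y, h y := by
  have h1 := Measure.integral_comp_smul (volume : Measure (ℝ × ℝ)) (fun y => h (y + (a, 0))) l
  rw [integral_add_right_eq_self (fun y => h y) (a, 0)] at h1
  simp only [Module.finrank_prod, Module.finrank_self, smul_eq_mul] at h1
  norm_num at h1
  simpa [Prod.smul_def] using h1

section Frame

variable {u : ℝ → ℝ × ℝ → ℝ} {lam x : ℝ → ℝ} {g h : ℝ × ℝ → ℝ} {s : ℝ}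

lemma frame_affine (hs : 0 < lam s) (y : ℝ × ℝ) :
    frame lam x s (lam s * y.1 + x s, lam s * y.2) = y := by
  unfold frame
  ext
  · simp; field_simp; ring
  · simp; field_simp

/-- The factor of `push` is the amplitude λ times the Jacobian λ⁻². -/
lemma integral_pull_mul (hs : 0 < lam s) :
    ∫ y, pull u lam x s y * g y = ∫ y, u (origTime lam s) y * push lam x g s y := by
  have h1 := integral_comp_affine
    (fun z => lam s * u (origTime lam s) z * g (frame lam x s z)) (lam s) (x s)
  simp only [frame_affine hs] at h1
  unfold pull
  rw [h1, ← integral_const_mul]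
  congr 1
  funext y
  unfold push
  field_simp

lemma integral_pull_cube_mul (hs : 0 < lam s) :
    ∫ y, pull u lam x s y ^ 3 * g y
      = ∫ y, u (origTime lam s) y ^ 3 * (lam s * g (frame lam x s y)) := by
  have h1 := integral_comp_affine
    (fun z => (lam s * u (origTime lam s) z) ^ 3 * g (frame lam x s z)) (lam s) (x s)
  simp only [frame_affine hs] at h1
  unfold pull
  rw [h1, ← integral_const_mul]
  congr 1
  funext y
  field_simp

lemma Rapid.push (hg : Rapid g) (hs : 0 < lam s) : Rapid (push lam x g s) :=
  (hg.comp_affine (inv_ne_zero hs.ne') _).const_mul _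

lemma d1_push (hg : Differentiable ℝ g) :
    d1 (push lam x g s) = fun y => (lam s)⁻¹ * push lam x (d1 g) s y := by
  have : Differentiable ℝ (fun y => g (frame lam x s y)) :=
    hg.comp (by unfold frame; fun_prop)
  unfold push
  rw [d1_const_mul _ this]
  unfold frame
  rw [d1_comp_smul_add hg]

lemma d2_push (hg : Differentiable ℝ g) :
    d2 (push lam x g s) = fun y => (lam s)⁻¹ * push lam x (d2 g) s y := by
  have : Differentiable ℝ (fun y => g (frame lam x s y)) :=
    hg.comp (by unfold frame; fun_prop)
  unfold push
  rw [d2_const_mul _ this]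
  unfold frame
  rw [d2_comp_smul_add hg]

lemma d1_lap_push (hg : Rapid g) (hs : 0 < lam s) (y : ℝ × ℝ) :
    d1 (lap (push lam x g s)) y = ((lam s) ^ 3)⁻¹ * push lam x (d1 (lap g)) s y := by
  have e1 : d1 (d1 (push lam x g s)) = fun y => (lam s)⁻¹ * ((lam s)⁻¹ * push lam x (d1 (d1 g)) s y) := by
    rw [d1_push hg.differentiable, d1_const_mul _ (hg.d1.push hs).differentiable,
      d1_push hg.d1.differentiable]
  have e2 : d2 (d2 (push lam x g s)) = fun y => (lam s)⁻¹ * ((lam s)⁻¹ * push lam x (d2 (d2 g)) s y) := by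
    rw [d2_push hg.differentiable, d2_const_mul _ (hg.d2.push hs).differentiable,
      d2_push hg.d2.differentiable]
  have e : lap (push lam x g s) = fun y => ((lam s) ^ 2)⁻¹ * push lam x (lap g) s y := by
    funext y
    rw [lap, e1, e2]
    simp only [push, lap]
    field_simp
  rw [e, d1_const_mul _ (hg.lap.push hs).differentiable, d1_push hg.lap.differentiable]
  field_simp

/-- Scale invariance: dt/ds = λ³ compensates the three derivatives, and the cubic term scales in the
same way. -/
lemma rhs_push (hg : Rapid g) (hs : 0 < lam s) :
    lam s ^ 3 * IsH1Solution.rhs u (push lam x g s) (origTime lam s)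
      = (∫ y, pull u lam x s y * d1 (lap g) y) + ∫ y, pull u lam x s y ^ 3 * d1 g y := by
  rw [integral_pull_mul hs, integral_pull_cube_mul hs, IsH1Solution.rhs, mul_add,
    ← integral_const_mul, ← integral_const_mul]
  congr 2
  · funext y
    rw [d1_lap_push hg hs]
    field_simp
  · funext y
    rw [d1_push hg.differentiable]
    simp only [push]
    field_simp

end Frame

/-! ### Differentiation in the rescaled time. -/

/-- The modulation parameters are `C¹` on `[0, ∞)` and the scale is positive. -/
structure IsFrame (lam x : ℝ → ℝ) : Prop where
  scale : ContDiffOn ℝ 1 lam (Ici 0)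
  shift : ContDiffOn ℝ 1 x (Ici 0)
  pos : ∀ s, 0 ≤ s → 0 < lam s

namespace IsFrame

variable {u : ℝ → ℝ × ℝ → ℝ} {lam x : ℝ → ℝ} {g h : ℝ × ℝ → ℝ} {s : ℝ}

lemma hasDerivWithinAt_scale (hf : IsFrame lam x) (hs : 0 ≤ s) :
    HasDerivWithinAt lam (derivWithin lam (Ici 0) s) (Ici 0) s :=
  (hf.scale.differentiableOn (by simp) s hs).hasDerivWithinAt

lemma hasDerivWithinAt_shift (hf : IsFrame lam x) (hs : 0 ≤ s) :
    HasDerivWithinAt x (derivWithin x (Ici 0) s) (Ici 0) s :=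
  (hf.shift.differentiableOn (by simp) s hs).hasDerivWithinAt

lemma continuousOn_scaleRate (hf : IsFrame lam x) : ContinuousOn (scaleRate lam) (Ici 0) :=
  (hf.scale.continuousOn_derivWithin (uniqueDiffOn_Ici 0) le_rfl).div hf.scale.continuousOn
    fun s hs => (hf.pos s hs).ne'

lemma continuousOn_shiftRate (hf : IsFrame lam x) : ContinuousOn (shiftRate lam x) (Ici 0) :=
  ((hf.shift.continuousOn_derivWithin (uniqueDiffOn_Ici 0) le_rfl).div hf.scale.continuousOn
    fun s hs => (hf.pos s hs).ne').sub continuousOn_const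

lemma origTime_nonneg (hf : IsFrame lam x) (hs : 0 ≤ s) : 0 ≤ origTime lam s :=
  intervalIntegral.integral_nonneg hs fun r hr => (pow_pos (hf.pos r hr.1) 3).le

lemma hasDerivWithinAt_origTime (hf : IsFrame lam x) (hs : 0 ≤ s) :
    HasDerivWithinAt (origTime lam) (lam s ^ 3) (Ici 0) s := by
  -- Extending λ by its value at 0 gives an integrand continuous on the whole line, to which the
  -- fundamental theorem applies.
  have hc : Continuous fun r => lam (max r 0) ^ 3 :=
    (hf.scale.continuousOn.comp_continuous (by fun_prop) fun r => le_max_right r 0).pow 3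
  have hd := (hc.integral_hasStrictDerivAt 0 s).hasDerivAt.hasDerivWithinAt (s := Ici 0)
  rw [max_eq_left hs] at hd
  have e : ∀ r ∈ Ici (0 : ℝ), origTime lam r = ∫ σ in (0 : ℝ)..r, lam (max σ 0) ^ 3 := by
    intro r hr
    refine intervalIntegral.integral_congr fun σ hσ => ?_
    rw [uIcc_of_le hr] at hσ
    simp only [max_eq_left hσ.1]
  exact hd.congr e (e s hs)

lemma tendsto_origTime (hf : IsFrame lam x) (hs : 0 ≤ s) :
    Tendsto (origTime lam) (𝓝[Ici 0] s) (𝓝[Ici 0] (origTime lam s)) :=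
  tendsto_nhdsWithin_of_tendsto_nhds_of_eventually_within _
    (hf.hasDerivWithinAt_origTime hs).continuousWithinAt
    (eventually_mem_nhdsWithin.mono fun _ hr => hf.origTime_nonneg hr)

lemma Icc_mem (s : ℝ) : Icc 0 (s + 1) ∈ 𝓝[Ici 0] s := by
  rw [← Ici_inter_Iic]
  exact inter_mem self_mem_nhdsWithin (mem_nhdsWithin_of_mem_nhds (Iic_mem_nhds (by linarith)))

/-- Λ generates the scaling λ⁻¹g(·/λ) and ∂₁ the translation; `shiftRate + 1` is x_s/λ. -/
lemma hasDerivWithinAt_push (hf : IsFrame lam x) (hg : Rapid g) (hs : 0 ≤ s) (y : ℝ × ℝ) :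
    HasDerivWithinAt (fun s => push lam x g s y)
      (-scaleRate lam s * push lam x (scalingGen g) s y
        - (shiftRate lam x s + 1) * push lam x (d1 g) s y) (Ici 0) s := by
  have hl := (hf.pos s hs).ne'
  have h1 := (hf.hasDerivWithinAt_scale hs).inv hl
  have h2 := (hf.hasDerivWithinAt_shift hs).div (hf.hasDerivWithinAt_scale hs) hl
  have h3 : HasDerivWithinAt (fun s => frame lam x s y)
      ((-derivWithin lam (Ici 0) s / lam s ^ 2) • y
        + (-((derivWithin x (Ici 0) s * lam s - x s * derivWithin lam (Ici 0) s) / lam s ^ 2), 0))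
      (Ici 0) s :=
    (h1.smul_const y).add (h2.neg.prodMk (hasDerivWithinAt_const s (Ici 0) (0 : ℝ)))
  have h4 := (hg.differentiable (frame lam x s y)).hasFDerivAt.comp_hasDerivWithinAt s h3
  refine (h1.mul h4).congr_deriv ?_
  rw [fderiv_eq_d1_d2]
  simp only [push, scalingGen, scaleRate, shiftRate, Function.comp_apply, Pi.inv_apply]
  set G := g (frame lam x s y)
  set G1 := d1 g (frame lam x s y)
  set G2 := d2 g (frame lam x s y)
  simp only [frame, Prod.fst_add, Prod.snd_add, Prod.smul_fst, Prod.smul_snd, smul_eq_mul]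
  field_simp
  ring

lemma exists_bound_Icc {c : ℝ → ℝ} (hc : ContinuousOn c (Ici 0)) (s : ℝ) :
    ∃ M, 0 ≤ M ∧ ∀ r ∈ Icc 0 (s + 1), |c r| ≤ M := by
  obtain ⟨M, hM⟩ := isCompact_Icc.exists_bound_of_continuousOn
    (hc.mono (fun r (hr : r ∈ Icc 0 (s + 1)) => hr.1))
  exact ⟨|M|, abs_nonneg M, fun r hr => (hM r hr).trans (le_abs_self M)⟩

/-- On a compact time interval the frame distorts the weight by a bounded factor, so one majorant
serves all times. -/
lemma exists_push_bound (hf : IsFrame lam x) (hg : Rapid g) (s : ℝ) :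
    ∃ B, 0 ≤ B ∧ ∀ r ∈ Icc 0 (s + 1), ∀ y, |push lam x g r y| ≤ B * maj y := by
  have cl := hf.scale.continuousOn
  have hne : ∀ r ∈ Ici (0 : ℝ), lam r ≠ 0 := fun r hr => (hf.pos r hr).ne'
  obtain ⟨M, hM0, hM⟩ := exists_bound_Icc (cl.inv₀ hne) s
  obtain ⟨K, hK0, hK⟩ := exists_bound_Icc (c := fun r => 1 + |(lam r)⁻¹|⁻¹ *
    (1 + |-(x r / lam r)| + |(0 : ℝ)|)) (by
      have h1 := (hf.shift.continuousOn.div cl hne).neg.abs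
      have h2 := (cl.inv₀ hne).abs.inv₀ (fun r hr => abs_ne_zero.2 (inv_ne_zero (hne r hr)))
      exact continuousOn_const.add (h2.mul ((continuousOn_const.add h1).add continuousOn_const))) s
  obtain ⟨C, hC⟩ := RapidFam.dom hg 4
  have hC0 : 0 ≤ C := le_trans (by have := wt_nonneg 0; positivity) (hC () 0)
  refine ⟨M * (C * K ^ 4), by positivity, fun r hr y => ?_⟩
  have hw := wt_le_affine (inv_ne_zero (hne r hr.1)) (-(x r / lam r), 0) y
  have hw1 : wt y ≤ K * wt (frame lam x r y) :=
    hw.trans (mul_le_mul_of_nonneg_right ((le_abs_self _).trans (hK r hr)) (wt_nonneg _))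
  have hwy := wt_pos y
  have hC' := hC () (frame lam x r y)
  have h4 : |g (frame lam x r y)| ≤ C * K ^ 4 * maj y := by
    calc |g (frame lam x r y)| = (wt y ^ 4 * |g (frame lam x r y)|) * (wt y ^ 4)⁻¹ := by field_simp
      _ ≤ ((K * wt (frame lam x r y)) ^ 4 * |g (frame lam x r y)|) * (wt y ^ 4)⁻¹ := by gcongr
      _ = K ^ 4 * (wt (frame lam x r y) ^ 4 * |g (frame lam x r y)|) * (wt y ^ 4)⁻¹ := by
          rw [mul_pow]; ring
      _ ≤ K ^ 4 * C * maj y := by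
          gcongr
          exact inv_wt_pow_four_le y
      _ = _ := by ring
  rw [push, abs_mul]
  calc |(lam r)⁻¹| * |g (frame lam x r y)| ≤ M * (C * K ^ 4 * maj y) := by
        gcongr; exact hM r hr
    _ = _ := by ring

lemma exists_push_lipschitz (hf : IsFrame lam x) (hg : Rapid g) (s : ℝ) :
    ∃ B, 0 ≤ B ∧ ∀ r ∈ Icc 0 (s + 1), ∀ r' ∈ Icc 0 (s + 1), ∀ y,
      |push lam x g r' y - push lam x g r y| ≤ B * maj y * |r' - r| := by
  obtain ⟨B₁, h₁0, h₁⟩ := hf.exists_push_bound hg.scalingGen s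
  obtain ⟨B₂, h₂0, h₂⟩ := hf.exists_push_bound hg.d1 s
  obtain ⟨M₁, m₁0, m₁⟩ := exists_bound_Icc hf.continuousOn_scaleRate s
  obtain ⟨M₂, m₂0, m₂⟩ := exists_bound_Icc (hf.continuousOn_shiftRate.add continuousOn_const
    (g := fun _ => 1)) s
  refine ⟨M₁ * B₁ + M₂ * B₂, by positivity, fun r hr r' hr' y => ?_⟩
  have hm := maj_pos y
  refine (convex_Icc 0 (s + 1)).norm_image_sub_le_of_norm_hasDerivWithin_le
    (fun σ hσ => (hf.hasDerivWithinAt_push hg hσ.1 y).mono fun τ hτ => hτ.1)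
    (fun σ hσ => ?_) hr hr'
  calc ‖-scaleRate lam σ * push lam x (scalingGen g) σ y
        - (shiftRate lam x σ + 1) * push lam x (d1 g) σ y‖
      ≤ |scaleRate lam σ| * |push lam x (scalingGen g) σ y|
        + |shiftRate lam x σ + 1| * |push lam x (d1 g) σ y| := by
        refine (norm_sub_le _ _).trans (le_of_eq ?_)
        simp only [Real.norm_eq_abs, abs_mul, abs_neg]
    _ ≤ M₁ * (B₁ * maj y) + M₂ * (B₂ * maj y) := by
        gcongr
        · exact m₁ σ hσ
        · exact h₁ σ hσ y
        · exact m₂ σ hσ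
        · exact h₂ σ hσ y
    _ = _ := by ring

/-- Difference quotients fall on the test function and are dominated by the Lipschitz bound, so U in
L² suffices. -/
lemma hasDerivWithinAt_integral_push (hf : IsFrame lam x) (hg : Rapid g) (hs : 0 ≤ s)
    {U : ℝ × ℝ → ℝ} (hU : MemLp U 2 volume) :
    HasDerivWithinAt (fun r => ∫ y, U y * push lam x g r y)
      (-scaleRate lam s * (∫ y, U y * push lam x (scalingGen g) s y)
        - (shiftRate lam x s + 1) * ∫ y, U y * push lam x (d1 g) s y) (Ici 0) s := by
  have hps := hf.pos s hs
  obtain ⟨B, hB0, hB⟩ := hf.exists_push_lipschitz hg s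
  have hsI : s ∈ Icc 0 (s + 1) := ⟨hs, by linarith⟩
  have hint : ∀ {r}, 0 ≤ r → ∀ {k : ℝ × ℝ → ℝ}, Rapid k →
      Integrable (fun y => U y * push lam x k r y) := fun {r} hr {k} hk =>
    hU.integrable_mul (hk.push (hf.pos _ hr)).memLp
  rw [hasDerivWithinAt_iff_tendsto_slope]
  have hlim : Tendsto (fun r => ∫ y, U y * ((r - s)⁻¹ * (push lam x g r y - push lam x g s y)))
      (𝓝[Ici 0 \ {s}] s) (𝓝 (∫ y, U y * (-scaleRate lam s * push lam x (scalingGen g) s y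
        - (shiftRate lam x s + 1) * push lam x (d1 g) s y))) := by
    refine tendsto_integral_filter_of_dominated_convergence (fun y => |U y| * (B * maj y)) ?_ ?_
      ((memLp_abs hU).integrable_mul (memLp_maj.const_mul B)) (ae_of_all _ fun y => ?_)
    · filter_upwards [self_mem_nhdsWithin] with r hr
      exact hU.aestronglyMeasurable.mul ((((hg.push (hf.pos r hr.1)).continuous).sub
        (hg.push hps).continuous).aestronglyMeasurable.const_mul _)
    · filter_upwards [self_mem_nhdsWithin, nhdsWithin_mono s sdiff_subset (Icc_mem s)] with r hr hrI
      refine ae_of_all _ fun y => ?_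
      have hne : 0 < |r - s| := abs_pos.2 (sub_ne_zero.2 fun h => hr.2 (by simp [h]))
      rw [Real.norm_eq_abs, abs_mul]
      gcongr
      rw [abs_mul, abs_inv, inv_mul_le_iff₀ hne]
      exact (hB s hsI r hrI y).trans_eq (by ring)
    · have := (hasDerivWithinAt_iff_tendsto_slope.1 (hf.hasDerivWithinAt_push hg hs y)).const_mul
        (U y)
      refine this.congr fun r => ?_
      rw [slope_def_field]; ring
  have e : ∫ y, U y * (-scaleRate lam s * push lam x (scalingGen g) s y
        - (shiftRate lam x s + 1) * push lam x (d1 g) s y)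
      = -scaleRate lam s * (∫ y, U y * push lam x (scalingGen g) s y)
        - (shiftRate lam x s + 1) * ∫ y, U y * push lam x (d1 g) s y := by
    rw [← integral_const_mul, ← integral_const_mul,
      ← integral_sub ((hint hs hg.scalingGen).const_mul _) ((hint hs hg.d1).const_mul _)]
    congr 1; funext y; ring
  rw [e] at hlim
  refine hlim.congr' ?_
  filter_upwards [self_mem_nhdsWithin] with r hr
  rw [slope_def_field, ← integral_sub (hint hr.1 hg) (hint hs hg), div_eq_inv_mul,
    ← integral_const_mul]
  congr 1; funext y; ring

/-- The evolution of a rescaled solution tested against a fixed Schwartz function. -/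
lemma hasDerivWithinAt_pairing (hf : IsFrame lam x) (hu : IsH1Solution u) (hg : Rapid g)
    (hs : 0 ≤ s) :
    HasDerivWithinAt (fun r => ∫ y, pull u lam x r y * g y)
      ((∫ y, pull u lam x s y * d1 (lap g) y) + (∫ y, pull u lam x s y ^ 3 * d1 g y)
        - scaleRate lam s * (∫ y, pull u lam x s y * scalingGen g y)
        - (shiftRate lam x s + 1) * ∫ y, pull u lam x s y * d1 g y) (Ici 0) s := by
  have hps := hf.pos s hs
  set t := origTime lam with ht
  have hU : ∀ {r}, 0 ≤ r → MemLp (u (t r)) 2 volume := fun hr =>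
    (hu.memH1 _ (hf.origTime_nonneg hr)).1
  have hA : HasDerivWithinAt (fun r => ∫ y, u (t r) y * push lam x g s y)
      (IsH1Solution.rhs u (push lam x g s) (t s) * lam s ^ 3) (Ici 0) s :=
    (hu.hasDerivWithinAt_rapid (hg.push hps) (hf.origTime_nonneg hs)).comp s
      (hf.hasDerivWithinAt_origTime hs) fun r hr => hf.origTime_nonneg hr
  have hB := hf.hasDerivWithinAt_integral_push hg hs (hU hs)
  -- Cross term of the product rule: o(1) in L² from u times O(|r − s|) from the test function.
  have hC : HasDerivWithinAt
      (fun r => ∫ y, (u (t r) y - u (t s) y) * (push lam x g r y - push lam x g s y)) 0 (Ici 0) s := by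
    obtain ⟨B, hB0, hB⟩ := hf.exists_push_lipschitz hg s
    have hz : Tendsto (fun r => l2Norm (fun y => u (t r) y - u (t s) y) * (B * l2Norm maj))
        (𝓝[Ici 0] s) (𝓝 0) := by
      simpa using ((hu.tendsto_l2Norm_sub (hf.origTime_nonneg hs)).comp
        (hf.tendsto_origTime hs)).mul_const (B * l2Norm maj)
    rw [hasDerivWithinAt_iff_isLittleO, Asymptotics.isLittleO_iff]
    intro ε hε
    filter_upwards [hz.eventually (gt_mem_nhds hε), Icc_mem s] with r hr hrI
    simp only [sub_self, zero_mul, integral_zero, smul_zero, sub_zero]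
    have hd := (hg.push (x := x) (hf.pos r hrI.1)).sub (hg.push (x := x) hps)
    refine (abs_integral_mul_le ((hu.memH1 _ (hf.origTime_nonneg hrI.1)).sub
      (hu.memH1 _ (hf.origTime_nonneg hs))).1 hd.memLp).trans ?_
    have hle : l2Norm (fun y => push lam x g r y - push lam x g s y)
        ≤ B * |r - s| * l2Norm maj := by
      have := l2Norm_le_of_abs_le (f := fun y => push lam x g r y - push lam x g s y)
        (memLp_maj.const_mul (B * |r - s|)) fun y =>
          (hB s ⟨hs, by linarith⟩ r hrI y).trans ((le_of_eq (by ring)).trans (le_abs_self _))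
      rwa [l2Norm_const_mul, abs_of_nonneg (by positivity)] at this
    calc _ ≤ l2Norm (fun y => u (t r) y - u (t s) y) * (B * |r - s| * l2Norm maj) := by
          gcongr; exact l2Norm_nonneg _
      _ = l2Norm (fun y => u (t r) y - u (t s) y) * (B * l2Norm maj) * |r - s| := by ring
      _ ≤ ε * ‖r - s‖ := by rw [Real.norm_eq_abs]; gcongr
  have hsum := ((hA.add hB).add hC).sub_const (∫ y, u (t s) y * push lam x g s y)
  have e : ∀ r ∈ Ici (0 : ℝ), ∫ y, pull u lam x r y * g y
      = (∫ y, u (t r) y * push lam x g s y) + (∫ y, u (t s) y * push lam x g r y)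
        + (∫ y, (u (t r) y - u (t s) y) * (push lam x g r y - push lam x g s y))
        - ∫ y, u (t s) y * push lam x g s y := by
    intro r hr
    have pr := (hg.push (x := x) (hf.pos r hr)).memLp
    have ps := (hg.push (x := x) hps).memLp
    have i1 : Integrable (fun y => u (t r) y * push lam x g s y) := (hU hr).integrable_mul ps
    have i2 : Integrable (fun y => u (t s) y * push lam x g r y) := (hU hs).integrable_mul pr
    have i3 : Integrable (fun y => (u (t r) y - u (t s) y)
      * (push lam x g r y - push lam x g s y)) := ((hU hr).sub (hU hs)).integrable_mul (pr.sub ps)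
    have i4 : Integrable (fun y => u (t s) y * push lam x g s y) := (hU hs).integrable_mul ps
    have i12 : Integrable (fun y => u (t r) y * push lam x g s y + u (t s) y * push lam x g r y) :=
      i1.add i2
    have i123 : Integrable (fun y => u (t r) y * push lam x g s y + u (t s) y * push lam x g r y
        + (u (t r) y - u (t s) y) * (push lam x g r y - push lam x g s y)) := i12.add i3
    rw [integral_pull_mul (hf.pos r hr), ← integral_add i1 i2, ← integral_add i12 i3,
      ← integral_sub i123 i4]
    congr 1; funext y
    ring
  refine (hsum.congr e (e s hs)).congr_deriv ?_
  rw [mul_comm, rhs_push hg hps, integral_pull_mul (g := scalingGen g) hps,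
    integral_pull_mul (g := d1 g) hps]
  ring

lemma continuousOn_pairing (hf : IsFrame lam x) (hu : IsH1Solution u) (hg : Rapid g) :
    ContinuousOn (fun r => ∫ y, pull u lam x r y * g y) (Ici 0) := fun _ hs =>
  (hf.hasDerivWithinAt_pairing hu hg hs).continuousWithinAt

/-- Needed for the C¹ claim. The variation of u³ is handled in L¹ and that of the frame by dominated
convergence. -/
lemma continuousOn_cube_pairing (hf : IsFrame lam x) (hu : IsH1Solution u) (hg : Rapid g) :
    ContinuousOn (fun r => ∫ y, pull u lam x r y ^ 3 * g y) (Ici 0) := by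
  intro s hs
  obtain ⟨B, hB0, hB⟩ := hg.bounded
  obtain ⟨M, hM0, hM⟩ := exists_bound_Icc hf.scale.continuousOn s
  set t := origTime lam with ht
  have hU : ∀ {r}, 0 ≤ r → MemH1 (u (t r)) := fun hr => hu.memH1 _ (hf.origTime_nonneg hr)
  have hcf : ∀ r, Continuous (frame lam x r) := fun r => by unfold frame; fun_prop
  have hcont : ∀ r, Continuous fun y => lam r * g (frame lam x r y) := fun r =>
    continuous_const.mul (hg.continuous.comp (hcf r))
  have hbd : ∀ r ∈ Icc 0 (s + 1), ∀ y, |lam r * g (frame lam x r y)| ≤ M * B := fun r hr y => by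
    rw [abs_mul]; exact mul_le_mul (hM r hr) (hB _) (abs_nonneg _) hM0
  have hsI : s ∈ Icc 0 (s + 1) := ⟨hs, by linarith⟩
  have l1 : Tendsto (fun r => ∫ y, (u (t r) y ^ 3 - u (t s) y ^ 3) * (lam r * g (frame lam x r y)))
      (𝓝[Ici 0] s) (𝓝 0) := by
    have hz : Tendsto (fun r => M * B * ∫ y, |u (t r) y ^ 3 - u (t s) y ^ 3|)
        (𝓝[Ici 0] s) (𝓝 0) := by
      simpa using ((hu.tendsto_integral_cube_sub (hf.origTime_nonneg hs)).comp
        (hf.tendsto_origTime hs)).const_mul (M * B)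
    refine squeeze_zero_norm' ?_ hz
    filter_upwards [Icc_mem s] with r hr
    exact abs_integral_mul_le_of_bounded ((hU hr.1).integrable_cube.sub (hU hs).integrable_cube)
      (hbd r hr)
  have l2 : Tendsto (fun r => ∫ y, u (t s) y ^ 3 * (lam r * g (frame lam x r y)))
      (𝓝[Ici 0] s) (𝓝 (∫ y, u (t s) y ^ 3 * (lam s * g (frame lam x s y)))) := by
    refine tendsto_integral_filter_of_dominated_convergence (fun y => |u (t s) y ^ 3| * (M * B))
      (Eventually.of_forall fun r => (hU hs).integrable_cube.aestronglyMeasurable.mul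
        (hcont r).aestronglyMeasurable) ?_ ((hU hs).integrable_cube.abs.mul_const _)
      (ae_of_all _ fun y => ?_)
    · filter_upwards [Icc_mem s] with r hr
      refine ae_of_all _ fun y => ?_
      rw [Real.norm_eq_abs, abs_mul]
      gcongr
      exact hbd r hr y
    · have cl := hf.scale.continuousOn s hs
      have hl := (hf.pos s hs).ne'
      have cf : ContinuousWithinAt (fun r => frame lam x r y) (Ici 0) s :=
        ((cl.inv₀ hl).smul continuousWithinAt_const).add
          (((hf.shift.continuousOn s hs).div cl hl).neg.prodMk continuousWithinAt_const)
      exact (cl.mul (hg.continuous.continuousAt.comp_continuousWithinAt cf)).const_mul _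
  have hsum := l1.add l2
  rw [zero_add, ← integral_pull_cube_mul (hf.pos s hs)] at hsum
  refine hsum.congr' ?_
  filter_upwards [Icc_mem s] with r hr
  rw [integral_pull_cube_mul (hf.pos r hr.1), ← integral_add]
  · congr 1; funext y; ring
  · exact integrable_mul_bounded ((hU hr.1).integrable_cube.sub (hU hs).integrable_cube) (hcont r)
      (hbd r hr)
  · exact integrable_mul_bounded (hU hs).integrable_cube (hcont r) (hbd r hr)

end IsFrame

/-! ### Estimates on the strip where the cutoff varies. -/

section Strip

/-- The weight `(1 + y₂²)⁻¹` on the strip `A ≤ y₁ ≤ 2 A`. -/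
def strip (A : ℝ) (y : ℝ × ℝ) : ℝ := (Icc A (2 * A)).indicator (fun _ => 1) y.1 * (1 + y.2 ^ 2)⁻¹

lemma strip_nonneg (A : ℝ) (y : ℝ × ℝ) : 0 ≤ strip A y :=
  mul_nonneg (indicator_nonneg (fun _ _ => zero_le_one) _) (by positivity)

lemma measurable_strip (A : ℝ) : Measurable (strip A) := by
  unfold strip
  exact ((measurable_const.indicator measurableSet_Icc).comp measurable_fst).mul (by fun_prop)

lemma integrable_strip_sq (A : ℝ) : Integrable (fun y => strip A y ^ 2) ∧
    ∫ y, strip A y ^ 2 = (∫ z, (Icc A (2 * A)).indicator (fun _ => (1 : ℝ)) z)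
      * ∫ z : ℝ, ((1 + z ^ 2)⁻¹) ^ 2 := by
  have e : ∀ y, strip A y ^ 2
      = (Icc A (2 * A)).indicator (fun _ => (1 : ℝ)) y.1 * ((1 + y.2 ^ 2)⁻¹) ^ 2 := fun y => by
    unfold strip
    by_cases h : y.1 ∈ Icc A (2 * A) <;> simp [h]
  have i1 : Integrable ((Icc A (2 * A)).indicator (fun _ => (1 : ℝ))) :=
    (integrable_indicator_iff measurableSet_Icc).2 (by simp)
  have i2 : Integrable (fun z : ℝ => ((1 + z ^ 2)⁻¹) ^ 2) := by
    refine integrable_inv_one_add_sq.mono' (by fun_prop : Measurable _).aestronglyMeasurable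
      (ae_of_all _ fun z => ?_)
    have h1 : (1 + z ^ 2)⁻¹ ≤ 1 := inv_le_one_of_one_le₀ (by nlinarith [sq_nonneg z])
    have h0 : 0 ≤ (1 + z ^ 2)⁻¹ := by positivity
    rw [Real.norm_eq_abs, abs_of_nonneg (by positivity), sq]
    exact mul_le_of_le_one_left h0 h1
  simp_rw [e]
  exact ⟨i1.mul_prod i2, integral_prod_mul (μ := volume) (ν := volume)
    ((Icc A (2 * A)).indicator (fun _ => (1 : ℝ))) (fun z : ℝ => ((1 + z ^ 2)⁻¹) ^ 2)⟩

lemma memLp_strip (A : ℝ) : MemLp (strip A) 2 volume :=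
  (memLp_two_iff_integrable_sq (measurable_strip A).aestronglyMeasurable).2 (integrable_strip_sq A).1

/-- The square root of `∫ (1 + z²)⁻²`. -/
def stripConst : ℝ := √(∫ z : ℝ, ((1 + z ^ 2)⁻¹) ^ 2)

lemma stripConst_nonneg : 0 ≤ stripConst := Real.sqrt_nonneg _

/-- The strip has width A; this is the source of every power A^{±1/2} in the remainder. -/
lemma l2Norm_strip {A : ℝ} (hA : 0 ≤ A) : l2Norm (strip A) = √A * stripConst := by
  rw [l2Norm_eq_sqrt (memLp_strip A), (integrable_strip_sq A).2, integral_indicator measurableSet_Icc]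
  have : ∫ z in Icc A (2 * A), (1 : ℝ) = A := by simp [two_mul, hA]
  rw [this, Real.sqrt_mul hA, stripConst]

lemma l2Norm_le_maj_strip {k : ℝ × ℝ → ℝ} {A a b : ℝ} (hA : 0 ≤ A) (ha : 0 ≤ a) (hb : 0 ≤ b)
    (h : ∀ y, |k y| ≤ a * maj y + b * strip A y) :
    l2Norm k ≤ a * l2Norm maj + b * (√A * stripConst) := by
  have m1 : MemLp (fun y => a * maj y) 2 volume := memLp_maj.const_mul a
  have m2 : MemLp (fun y => b * strip A y) 2 volume := (memLp_strip A).const_mul b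
  have h1 : l2Norm k ≤ l2Norm (fun y => a * maj y + b * strip A y) :=
    l2Norm_le_of_abs_le (m1.add m2) fun y => (h y).trans (le_abs_self _)
  refine h1.trans ?_
  have h2 : l2Norm (fun y => a * maj y + b * strip A y)
      ≤ l2Norm (fun y => a * maj y) + l2Norm (fun y => b * strip A y) := by
    unfold l2Norm
    rw [← ENNReal.toReal_add m1.eLpNorm_ne_top m2.eLpNorm_ne_top]
    exact ENNReal.toReal_mono (ENNReal.add_ne_top.2 ⟨m1.eLpNorm_ne_top, m2.eLpNorm_ne_top⟩)
      (eLpNorm_add_le m1.1 m2.1 (by norm_num))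
  refine h2.trans (le_of_eq ?_)
  rw [l2Norm_const_mul, l2Norm_const_mul, abs_of_nonneg ha, abs_of_nonneg hb, l2Norm_strip hA]

lemma abs_integral_mul_le_maj_strip {e k : ℝ × ℝ → ℝ} {A a b : ℝ} (he : MemLp e 2 volume)
    (hk : MemLp k 2 volume) (hA : 0 ≤ A) (ha : 0 ≤ a) (hb : 0 ≤ b)
    (h : ∀ y, |k y| ≤ a * maj y + b * strip A y) :
    |∫ y, e y * k y| ≤ l2Norm e * (a * l2Norm maj + b * (√A * stripConst)) :=
  (abs_integral_mul_le he hk).trans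
    (mul_le_mul_of_nonneg_left (l2Norm_le_maj_strip hA ha hb h) (l2Norm_nonneg e))

/-- Decay of order two in the second variable, uniformly in the first. -/
def SndDecay (k : ℝ × ℝ → ℝ) : Prop := ∃ C, 0 ≤ C ∧ ∀ y, |k y| ≤ C * (1 + y.2 ^ 2)⁻¹

lemma maj_le_snd (y : ℝ × ℝ) : maj y ≤ (1 + y.2 ^ 2)⁻¹ :=
  mul_le_of_le_one_left (by positivity) (inv_le_one_of_one_le₀ (by nlinarith [sq_nonneg y.1]))

lemma Rapid.sndDecay {k : ℝ × ℝ → ℝ} (hk : Rapid k) : SndDecay k := by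
  obtain ⟨C, h0, hC⟩ := hk.abs_le_maj
  exact ⟨C, h0, fun y => (hC y).trans (mul_le_mul_of_nonneg_left (maj_le_snd y) h0)⟩

lemma Rapid.sndDecay_prim {G : ℝ × ℝ → ℝ} (hG : Rapid G) : SndDecay (ZK.prim G) := by
  obtain ⟨C, hC⟩ := hG.dom_prim 2
  refine ⟨|C|, abs_nonneg C, fun y => ?_⟩
  rw [← div_eq_mul_inv, le_div_iff₀ (by positivity), mul_comm]
  have hw : 1 + y.2 ^ 2 ≤ wtLeft y ^ 2 := by
    unfold wtLeft
    nlinarith [abs_nonneg y.2, sq_abs y.2, le_max_right (-y.1) 0,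
      mul_nonneg (abs_nonneg y.2) (le_max_right (-y.1) 0)]
  calc (1 + y.2 ^ 2) * |ZK.prim G y| ≤ wtLeft y ^ 2 * |ZK.prim G y| := by gcongr
    _ ≤ |C| := (hC () y).trans (le_abs_self C)

lemma SndDecay.mul_bounded {k b : ℝ × ℝ → ℝ} (hk : SndDecay k) (hb : ∃ M, 0 ≤ M ∧ ∀ y, |b y| ≤ M) :
    SndDecay (fun y => b y * k y) := by
  obtain ⟨C, h0, hC⟩ := hk
  obtain ⟨M, m0, hM⟩ := hb
  refine ⟨M * C, by positivity, fun y => ?_⟩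
  rw [abs_mul, mul_assoc]
  exact mul_le_mul (hM y) (hC y) (abs_nonneg _) m0

/-- h'(y₁/A) vanishes off A ≤ y₁ ≤ 2A, and decay in y₂ alone is enough there. The constant is chosen
before A. -/
lemma SndDecay.mul_deriv_step {k : ℝ × ℝ → ℝ} (hk : SndDecay k) {h : ℝ → ℝ} (hh : IsStep h) :
    ∃ C, 0 ≤ C ∧ ∀ A : ℝ, 1 ≤ A → ∀ y, |k y * deriv h (A⁻¹ * y.1)| ≤ C * strip A y := by
  obtain ⟨C, h0, hC⟩ := hk
  obtain ⟨M, m0, hM⟩ := hh.deriv.bounded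
  refine ⟨C * M, by positivity, fun A hA y => ?_⟩
  have hA0 : 0 < A := by linarith
  by_cases hy : y.1 ∈ Icc A (2 * A)
  · rw [abs_mul, strip, indicator_of_mem hy, one_mul]
    calc |k y| * |deriv h (A⁻¹ * y.1)| ≤ C * (1 + y.2 ^ 2)⁻¹ * M := by
          gcongr
          · exact hC y
          · exact hM _
      _ = _ := by ring
  · have : deriv h (A⁻¹ * y.1) = 0 := by
      rw [inv_mul_eq_div]
      rw [mem_Icc, not_and_or, not_le, not_le] at hy
      rcases hy with hy | hy
      · exact hh.deriv_left ((div_le_one hA0).2 hy.le)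
      · exact hh.deriv_right ((le_div_iff₀ hA0).2 hy.le)
    rw [this, mul_zero, abs_zero]
    exact mul_nonneg (by positivity) (strip_nonneg A y)

end Strip

/-! ### Leibniz rules for products with a rescaled step. -/

section StepCalculus

variable {k : ℝ × ℝ → ℝ} {h : ℝ → ℝ}

lemma step_contDiff (hh : IsStep h) (a : ℝ) : ContDiff ℝ ∞ (fun y : ℝ × ℝ => h (a * y.1)) :=
  hh.smooth.comp (by fun_prop)

lemma d1_mul_step (hk : Differentiable ℝ k) (hh : IsStep h) (a : ℝ) :
    d1 (fun y => k y * h (a * y.1))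
      = fun y => a * (k y * deriv h (a * y.1)) + d1 k y * h (a * y.1) := by
  rw [d1_mul hk (smooth_differentiable (step_contDiff hh a)), d1_fst_comp hh.hasDerivAt]
  funext y; ring

lemma d2_mul_step (hk : Differentiable ℝ k) (hh : IsStep h) (a : ℝ) :
    d2 (fun y => k y * h (a * y.1)) = fun y => d2 k y * h (a * y.1) := by
  rw [d2_mul hk (smooth_differentiable (step_contDiff hh a)), d2_fst_comp hh.hasDerivAt]
  funext y; ring

lemma lap_add {f g : ℝ × ℝ → ℝ} (hf : ContDiff ℝ ∞ f) (hg : ContDiff ℝ ∞ g) (y : ℝ × ℝ) :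
    lap (fun y => f y + g y) y = lap f y + lap g y := by
  rw [lap, d1_add (smooth_differentiable hf) (smooth_differentiable hg),
    d2_add (smooth_differentiable hf) (smooth_differentiable hg),
    d1_add (smooth_differentiable (d1_contDiff hf)) (smooth_differentiable (d1_contDiff hg)),
    d2_add (smooth_differentiable (d2_contDiff hf)) (smooth_differentiable (d2_contDiff hg))]
  simp only [lap]; ring

lemma lap_const_mul {f : ℝ × ℝ → ℝ} (hf : ContDiff ℝ ∞ f) (c : ℝ) (y : ℝ × ℝ) :
    lap (fun y => c * f y) y = c * lap f y := by
  rw [lap, d1_const_mul c (smooth_differentiable hf), d2_const_mul c (smooth_differentiable hf),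
    d1_const_mul c (smooth_differentiable (d1_contDiff hf)),
    d2_const_mul c (smooth_differentiable (d2_contDiff hf))]
  simp only [lap]; ring

lemma lap_mul_step (hk : ContDiff ℝ ∞ k) (hh : IsStep h) (a : ℝ) (y : ℝ × ℝ) :
    lap (fun y => k y * h (a * y.1)) y = lap k y * h (a * y.1)
      + 2 * a * (d1 k y * deriv h (a * y.1)) + a ^ 2 * (k y * deriv (deriv h) (a * y.1)) := by
  have c1 : ContDiff ℝ ∞ fun y => k y * deriv h (a * y.1) := hk.mul (step_contDiff hh.deriv a)
  have c2 : ContDiff ℝ ∞ fun y => d1 k y * h (a * y.1) := (d1_contDiff hk).mul (step_contDiff hh a)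
  rw [lap, d1_mul_step (smooth_differentiable hk) hh, d2_mul_step (smooth_differentiable hk) hh,
    d1_add ((smooth_differentiable c1).const_mul a) (smooth_differentiable c2),
    d1_const_mul a (smooth_differentiable c1),
    d1_mul_step (smooth_differentiable hk) hh.deriv,
    d1_mul_step (smooth_differentiable (d1_contDiff hk)) hh,
    d2_mul_step (smooth_differentiable (d2_contDiff hk)) hh]
  simp only [lap]; ring

/-- φ − 1 vanishes for r ≤ 1, and |r| ≥ 1 elsewhere. At r = y₁/A this trades removal of the cutoff
for a factor |y₁|/A. -/
lemma abs_one_sub_cutoff_le {φ : ℝ → ℝ} (hφ : IsCutoff φ) :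
    ∃ M, 0 ≤ M ∧ (∀ r, |φ r| ≤ M) ∧ ∀ r, |φ r - 1| ≤ M * |r| := by
  obtain ⟨M, m0, hM⟩ := hφ.isStep.bounded
  refine ⟨M + 1, by linarith, fun r => (hM r).trans (by linarith), fun r => ?_⟩
  rcases le_total r 1 with h | h
  · rw [hφ.eq_one r h, sub_self, abs_zero]; positivity
  · have h1 : |φ r - 1| ≤ M + 1 := (abs_sub _ _).trans (by rw [abs_one]; linarith [hM r])
    have h2 : 1 ≤ |r| := h.trans (le_abs_self r)
    exact h1.trans (le_mul_of_one_le_right (by linarith) h2)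

end StepCalculus

/-! ### Antisymmetry of Λ and the value of κ. -/

section Integrals

/-- In dimension two Λ = 1 + y·∇ generates the dilations that preserve the L² norm, so it is
antisymmetric. -/
lemma Rapid.integral_mul_scalingGen {f g : ℝ × ℝ → ℝ} (hf : Rapid f) (hg : Rapid g) :
    ∫ y, f y * ZK.scalingGen g y = - ∫ y, ZK.scalingGen f y * g y := by
  have h1 := hf.fst_mul.integral_mul_d1 hg
  have h2 := hf.snd_mul.integral_mul_d2 hg
  rw [d1_mul differentiable_fst' hf.differentiable, d1_fst] at h1
  rw [d2_mul differentiable_snd' hf.differentiable, d2_snd] at h2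
  have i0 := (hf.mul hg).integrable
  have i1 := (hf.fst_mul.mul hg.d1).integrable
  have i2 := (hf.snd_mul.mul hg.d2).integrable
  have j1 := (hf.d1.fst_mul.mul hg).integrable
  have j2 := (hf.d2.snd_mul.mul hg).integrable
  have e1 : ∫ y, f y * ZK.scalingGen g y
      = (∫ y, f y * g y) + (∫ y, y.1 * f y * d1 g y) + ∫ y, y.2 * f y * d2 g y := by
    have i01 : Integrable (fun y => f y * g y + y.1 * f y * d1 g y) := i0.add i1
    rw [← integral_add i0 i1, ← integral_add i01 i2]
    congr 1; funext y
    simp only [ZK.scalingGen]; ring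
  have e2 : ∫ y, ZK.scalingGen f y * g y
      = (∫ y, f y * g y) + (∫ y, y.1 * d1 f y * g y) + ∫ y, y.2 * d2 f y * g y := by
    have j01 : Integrable (fun y => f y * g y + y.1 * d1 f y * g y) := i0.add j1
    rw [← integral_add i0 j1, ← integral_add j01 j2]
    congr 1; funext y
    simp only [ZK.scalingGen]; ring
  have e3 : ∫ y : ℝ × ℝ, (y.1 * d1 f y + 1 * f y) * g y
      = (∫ y, y.1 * d1 f y * g y) + ∫ y, f y * g y := by
    rw [← integral_add j1 i0]; congr 1; funext y; ring
  have e4 : ∫ y : ℝ × ℝ, (y.2 * d2 f y + 1 * f y) * g y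
      = (∫ y, y.2 * d2 f y * g y) + ∫ y, f y * g y := by
    rw [← integral_add j2 i0]; congr 1; funext y; ring
  rw [e1, e2, h1, h2, e3, e4]; ring

lemma Rapid.integral_mul_scalingGen_self {f : ℝ × ℝ → ℝ} (hf : Rapid f) :
    ∫ y, f y * ZK.scalingGen f y = 0 := by
  have h := hf.integral_mul_scalingGen hf
  simp only [mul_comm (ZK.scalingGen f _)] at h
  linarith

lemma Rapid.integral_line_d1 {f : ℝ × ℝ → ℝ} (hf : Rapid f) (b : ℝ) :
    ∫ z, d1 f (z, b) = 0 :=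
  integral_eq_zero_of_hasDerivAt_of_integrable (fun z => hasDerivAt_d1 hf.differentiable z b)
    (hf.d1.integrable_line b) (hf.integrable_line b)

/-- Λf = ∂₁(y₁f) + y₂∂₂f, and the first term integrates to 0 along the line. Its square gives the
weight y₂² in κ. -/
lemma Rapid.integral_line_scalingGen {f : ℝ × ℝ → ℝ} (hf : Rapid f) (b : ℝ) :
    ∫ z, ZK.scalingGen f (z, b) = b * ∫ z, d2 f (z, b) := by
  have e : ∀ z, ZK.scalingGen f (z, b) = d1 (fun y => y.1 * f y) (z, b) + b * d2 f (z, b) := by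
    intro z
    rw [d1_mul differentiable_fst' hf.differentiable, d1_fst]
    simp only [ZK.scalingGen]; ring
  simp_rw [e]
  rw [integral_add (hf.fst_mul.d1.integrable_line b) ((hf.d2.integrable_line b).const_mul b),
    hf.fst_mul.integral_line_d1, integral_const_mul, zero_add]

lemma Rapid.tendsto_prim {G : ℝ × ℝ → ℝ} (hG : Rapid G) (b : ℝ) :
    Tendsto (fun z => ZK.prim G (z, b)) atTop (𝓝 (∫ z, G (z, b))) := by
  have hc : AECover (volume : Measure ℝ) atTop (fun z : ℝ => Iic z) := aecover_Iic tendsto_id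
  exact hc.integral_tendsto_of_countably_generated (hG.integrable_line b)

lemma Rapid.integrable_mul_prim {G H : ℝ × ℝ → ℝ} (hH : Rapid H) (hG : Rapid G) :
    Integrable (fun y => H y * ZK.prim G y) := by
  obtain ⟨C, h0, hC⟩ := hG.sndDecay_prim
  refine integrable_mul_bounded (C := C) hH.integrable hG.contDiff_prim.continuous fun y => ?_
  exact (hC y).trans (mul_le_of_le_one_right h0
    (inv_le_one_of_one_le₀ (by nlinarith [sq_nonneg y.2])))

/-- On each line the integrand is the derivative of half the squared primitive, which runs from 0 to
the full line integral. -/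
lemma Rapid.integral_mul_prim {G : ℝ × ℝ → ℝ} (hG : Rapid G) :
    ∫ y, G y * ZK.prim G y = 1 / 2 * ∫ b, (∫ z, G (z, b)) ^ 2 := by
  have hint := hG.integrable_mul_prim hG
  rw [Measure.volume_eq_prod, integral_prod_symm _ (by rwa [Measure.volume_eq_prod] at hint),
    ← integral_const_mul]
  congr 1; funext b
  have hd : ∀ z, HasDerivAt (fun z => 1 / 2 * ZK.prim G (z, b) ^ 2) (G (z, b) * ZK.prim G (z, b)) z := by
    intro z
    have h1 := hasDerivAt_d1 (smooth_differentiable hG.contDiff_prim) z b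
    rw [hG.d1_prim] at h1
    refine ((h1.fun_pow 2).const_mul (1 / 2)).congr_deriv ?_
    simp; ring
  have hbot : Tendsto (fun z => ZK.prim G (z, b)) atBot (𝓝 0) := by
    obtain ⟨C, hC⟩ := hG.dom_prim 1
    have hlim : Tendsto (fun z : ℝ => |C| * (-z)⁻¹) atBot (𝓝 0) := by
      simpa using (tendsto_inv_atTop_zero.comp tendsto_neg_atBot_atTop).const_mul |C|
    refine squeeze_zero_norm' ?_ hlim
    filter_upwards [eventually_lt_atBot (0 : ℝ)] with z hz
    have h := hC () (z, b)
    rw [pow_one] at h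
    rw [← div_eq_mul_inv, le_div_iff₀ (by linarith), mul_comm, Real.norm_eq_abs]
    refine le_trans ?_ (h.trans (le_abs_self C))
    gcongr
    unfold wtLeft
    simp only
    linarith [abs_nonneg b, le_max_left (-z) 0]
  have hi : Integrable (fun z => G (z, b) * ZK.prim G (z, b)) := by
    obtain ⟨C, h0, hC⟩ := hG.sndDecay_prim
    refine (hG.integrable_line b).mul_bdd (c := C)
      (hG.contDiff_prim.continuous.comp (by fun_prop : Continuous fun z : ℝ => (z, b))).aestronglyMeasurable
      (ae_of_all _ fun z => (hC _).trans (mul_le_of_le_one_right h0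
        (inv_le_one_of_one_le₀ (by nlinarith [sq_nonneg b]))))
  rw [integral_of_hasDerivAt_of_tendsto hd hi ((hbot.pow 2).const_mul (1 / 2))
    (((hG.tendsto_prim b).pow 2).const_mul (1 / 2))]
  ring

lemma IsGroundState.integral_scalingGen_mul_bigF {Q : ℝ × ℝ → ℝ} (hQ : IsGroundState Q) :
    ∫ y, scalingGen Q y * bigF Q y = kappa Q := by
  have h := hQ.rapid_scalingGen.integral_mul_prim
  simp only [hQ.rapid.integral_line_scalingGen, mul_pow] at h
  exact h

end Integrals

/-! ### The test function F φ_A and the error estimates. -/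

section Probe

variable {Q : ℝ × ℝ → ℝ} {φ : ℝ → ℝ}

/-- The function `F φ_A` against which `ε` is integrated. -/
def probe (Q : ℝ × ℝ → ℝ) (φ : ℝ → ℝ) (A : ℝ) (y : ℝ × ℝ) : ℝ := bigF Q y * φ (A⁻¹ * y.1)

lemma cutoff_eq (φ : ℝ → ℝ) (A : ℝ) (y : ℝ × ℝ) : cutoff φ A y = φ (A⁻¹ * y.1) := by
  rw [cutoff, inv_mul_eq_div]

lemma IsGroundState.rapid_probe (hQ : IsGroundState Q) (hφ : IsCutoff φ) {A : ℝ} (hA : 0 < A) :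
    Rapid (probe Q φ A) :=
  hQ.rapid_scalingGen.prim_mul_step hφ.isStep (inv_pos.2 hA)

lemma IsGroundState.contDiff_bigF (hQ : IsGroundState Q) : ContDiff ℝ ∞ (bigF Q) :=
  hQ.rapid_scalingGen.contDiff_prim

lemma IsGroundState.d1_bigF (hQ : IsGroundState Q) : d1 (bigF Q) = scalingGen Q :=
  hQ.rapid_scalingGen.d1_prim

lemma IsGroundState.d2_bigF (hQ : IsGroundState Q) : d2 (bigF Q) = prim (d2 (scalingGen Q)) :=
  hQ.rapid_scalingGen.d2_prim

lemma IsGroundState.lap_bigF (hQ : IsGroundState Q) (y : ℝ × ℝ) :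
    lap (bigF Q) y = d1 (scalingGen Q) y + prim (d2 (d2 (scalingGen Q))) y := by
  rw [lap, hQ.d1_bigF, hQ.d2_bigF, hQ.rapid_scalingGen.d2.d2_prim]

lemma IsGroundState.sndDecay_bigF (hQ : IsGroundState Q) : SndDecay (bigF Q) :=
  hQ.rapid_scalingGen.sndDecay_prim

lemma SndDecay.bounded {k : ℝ × ℝ → ℝ} (hk : SndDecay k) : ∃ M, 0 ≤ M ∧ ∀ y, |k y| ≤ M := by
  obtain ⟨C, h0, hC⟩ := hk
  exact ⟨C, h0, fun y => (hC y).trans (mul_le_of_le_one_right h0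
    (inv_le_one_of_one_le₀ (by nlinarith [sq_nonneg y.2])))⟩

lemma SndDecay.add {k l : ℝ × ℝ → ℝ} (hk : SndDecay k) (hl : SndDecay l) :
    SndDecay (fun y => k y + l y) := by
  obtain ⟨C, h0, hC⟩ := hk
  obtain ⟨D, d0, hD⟩ := hl
  exact ⟨C + D, by positivity, fun y => (abs_add_le _ _).trans
    ((add_le_add (hC y) (hD y)).trans_eq (add_mul _ _ _).symm)⟩

lemma IsGroundState.d1_probe (hQ : IsGroundState Q) (hφ : IsCutoff φ) (A : ℝ) :
    d1 (probe Q φ A) = fun y => A⁻¹ * (bigF Q y * deriv φ (A⁻¹ * y.1))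
      + scalingGen Q y * φ (A⁻¹ * y.1) := by
  rw [← hQ.d1_bigF]
  exact d1_mul_step (smooth_differentiable hQ.contDiff_bigF) hφ.isStep A⁻¹

lemma IsGroundState.d2_probe (hQ : IsGroundState Q) (hφ : IsCutoff φ) (A : ℝ) :
    d2 (probe Q φ A) = fun y => d2 (bigF Q) y * φ (A⁻¹ * y.1) :=
  d2_mul_step (smooth_differentiable hQ.contDiff_bigF) hφ.isStep A⁻¹

/-- An exact identity: when no derivative hits φ, LΛQ = −2Q gives 2Qφ; each remaining term carries a
derivative of φ and at least one A⁻¹. -/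
lemma IsGroundState.lap_d1_probe (hQ : IsGroundState Q) (hφ : IsCutoff φ) (A : ℝ) (y : ℝ × ℝ) :
    lap (d1 (probe Q φ A)) y + 3 * Q y ^ 2 * d1 (probe Q φ A) y - d1 (probe Q φ A) y
      = 2 * Q y * φ (A⁻¹ * y.1)
        + A⁻¹ * ((3 * d1 (scalingGen Q) y + prim (d2 (d2 (scalingGen Q))) y
              + (3 * Q y ^ 2 - 1) * bigF Q y) * deriv φ (A⁻¹ * y.1)
            + 3 * A⁻¹ * (scalingGen Q y * deriv (deriv φ) (A⁻¹ * y.1))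
            + A⁻¹ ^ 2 * (bigF Q y * deriv (deriv (deriv φ)) (A⁻¹ * y.1))) := by
  have hF := hQ.contDiff_bigF
  have hS := hQ.rapid_scalingGen.contDiff
  have hs := hφ.isStep
  have c1 : ContDiff ℝ ∞ fun y => bigF Q y * deriv φ (A⁻¹ * y.1) :=
    hF.mul (step_contDiff hs.deriv _)
  have c2 : ContDiff ℝ ∞ fun y => scalingGen Q y * φ (A⁻¹ * y.1) := hS.mul (step_contDiff hs _)
  rw [hQ.d1_probe hφ, lap_add (contDiff_const.mul c1) c2, lap_const_mul c1,
    lap_mul_step hF hs.deriv, lap_mul_step hS hs, hQ.lap_bigF, hQ.lap_scalingGen, hQ.d1_bigF]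
  ring

lemma abs_integral_mul_cutoff_sub_one_le {M : ℝ} (hM : ∀ r, |φ r - 1| ≤ M * |r|) {A : ℝ}
    (hA : 0 < A) {U : ℝ × ℝ → ℝ} (hU : Integrable fun y => y.1 * U y) :
    |∫ y, U y * (φ (A⁻¹ * y.1) - 1)| ≤ A⁻¹ * (M * ∫ y, |y.1 * U y|) := by
  rw [← integral_const_mul, ← integral_const_mul]
  refine norm_integral_le_of_norm_le (f := fun y => U y * (φ (A⁻¹ * y.1) - 1))
    ((hU.abs.const_mul M).const_mul _) (ae_of_all _ fun y => ?_)
  rw [Real.norm_eq_abs, abs_mul]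
  refine (mul_le_mul_of_nonneg_left (hM _) (abs_nonneg _)).trans (le_of_eq ?_)
  rw [abs_mul, abs_mul, abs_of_pos (inv_pos.2 hA)]
  ring

lemma l2NormOn_le_l2Norm (S : Set (ℝ × ℝ)) {f : ℝ × ℝ → ℝ} (hf : MemLp f 2 volume) :
    l2NormOn S f ≤ l2Norm f :=
  ENNReal.toReal_mono hf.eLpNorm_ne_top (eLpNorm_mono_measure _ Measure.restrict_le_self)

lemma inv_eq_inv_sqrt_sq {A : ℝ} (hA : 0 ≤ A) : A⁻¹ = (√A)⁻¹ ^ 2 := by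
  rw [inv_pow, Real.sq_sqrt hA]

lemma inv_sqrt_le_one {A : ℝ} (hA : 1 ≤ A) : (√A)⁻¹ ≤ 1 :=
  inv_le_one_of_one_le₀ (Real.one_le_sqrt.2 hA)

lemma inv_le_inv_sqrt {A : ℝ} (hA : 1 ≤ A) : A⁻¹ ≤ (√A)⁻¹ := by
  rw [inv_eq_inv_sqrt_sq (by linarith), sq]
  exact mul_le_of_le_one_left (by positivity) (inv_sqrt_le_one hA)

lemma inv_mul_sqrt {A : ℝ} (hA : 1 ≤ A) : A⁻¹ * √A = (√A)⁻¹ := by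
  have : 0 < √A := Real.sqrt_pos.2 (by linarith)
  rw [inv_eq_inv_sqrt_sq (by linarith)]
  field_simp

/-- The linearised operator applied to the derivative of the probe is `2 Q`, up to `A^{-1/2}`. -/
lemma IsGroundState.exists_linear_le (hQ : IsGroundState Q) (hφ : IsCutoff φ) :
    ∃ C, 0 ≤ C ∧ ∀ A : ℝ, 1 ≤ A → ∀ e : ℝ × ℝ → ℝ, MemLp e 2 volume →
      |(∫ y, e y * (lap (d1 (probe Q φ A)) y + 3 * Q y ^ 2 * d1 (probe Q φ A) y
          - d1 (probe Q φ A) y)) - 2 * ∫ y, e y * Q y| ≤ C * ((√A)⁻¹ * l2Norm e) := by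
  have hS := hQ.rapid_scalingGen
  have hs := hφ.isStep
  obtain ⟨M, m0, -, hM⟩ := abs_one_sub_cutoff_le hφ
  obtain ⟨B, b0, hB⟩ := hQ.rapid.fst_mul.abs_le_maj
  obtain ⟨B', b'0, hB'⟩ := hQ.rapid.bounded
  have hcoef : SndDecay fun y => 3 * d1 (scalingGen Q) y + prim (d2 (d2 (scalingGen Q))) y
      + (3 * Q y ^ 2 - 1) * bigF Q y := by
    refine ((hS.d1.const_mul 3).sndDecay.add hS.d2.d2.sndDecay_prim).add
      (hQ.sndDecay_bigF.mul_bounded ⟨3 * B' ^ 2 + 1, by positivity, fun y => ?_⟩)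
    have : Q y ^ 2 ≤ B' ^ 2 := sq_le_sq' (abs_le.1 (hB' y)).1 (abs_le.1 (hB' y)).2
    rw [abs_le]; constructor <;> nlinarith [sq_nonneg (Q y)]
  obtain ⟨D₁, d₁0, h₁⟩ := hcoef.mul_deriv_step hs
  obtain ⟨D₂, d₂0, h₂⟩ := hS.sndDecay.mul_deriv_step hs.deriv
  obtain ⟨D₃, d₃0, h₃⟩ := hQ.sndDecay_bigF.mul_deriv_step hs.deriv.deriv
  refine ⟨2 * M * B * l2Norm maj + (D₁ + 3 * D₂ + D₃) * stripConst, ?_, fun A hA e he => ?_⟩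
  · have := l2Norm_nonneg maj
    have := stripConst_nonneg
    positivity
  have hA0 : 0 < A := by linarith
  have ha0 : 0 < A⁻¹ := inv_pos.2 hA0
  have ha1 : A⁻¹ ≤ 1 := inv_le_one_of_one_le₀ hA
  have hk : Rapid (d1 (probe Q φ A)) := (hQ.rapid_probe hφ hA0).d1
  have hK : Rapid fun y => lap (d1 (probe Q φ A)) y + 3 * Q y ^ 2 * d1 (probe Q φ A) y
      - d1 (probe Q φ A) y := by
    have h := (hk.lap.add (((hQ.rapid.mul hQ.rapid).const_mul 3).mul hk)).sub hk
    simpa only [sq] using h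
  have hR := hK.sub (hQ.rapid.const_mul 2)
  have hsplit : (∫ y, e y * (lap (d1 (probe Q φ A)) y + 3 * Q y ^ 2 * d1 (probe Q φ A) y
          - d1 (probe Q φ A) y)) - 2 * ∫ y, e y * Q y
      = ∫ y, e y * (lap (d1 (probe Q φ A)) y + 3 * Q y ^ 2 * d1 (probe Q φ A) y
          - d1 (probe Q φ A) y - 2 * Q y) := by
    have i1 : Integrable fun y => e y * (lap (d1 (probe Q φ A)) y
      + 3 * Q y ^ 2 * d1 (probe Q φ A) y - d1 (probe Q φ A) y) := he.integrable_mul hK.memLp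
    have i2 : Integrable fun y => e y * Q y := he.integrable_mul hQ.rapid.memLp
    rw [← integral_const_mul, ← integral_sub i1 (i2.const_mul 2)]
    congr 1; funext y; ring
  rw [hsplit]
  -- The `maj` part comes from replacing 2Qφ by 2Q, the strip part from derivatives of φ. The latter
  -- has L² norm A⁻¹√A = A^{-1/2}.
  refine (abs_integral_mul_le_maj_strip (A := A) (a := A⁻¹ * (2 * M * B))
    (b := A⁻¹ * (D₁ + 3 * D₂ + D₃)) he hR.memLp hA0.le (by positivity) (by positivity)
    fun y => ?_).trans ?_
  · rw [hQ.lap_d1_probe hφ]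
    have e1 : |2 * Q y * (φ (A⁻¹ * y.1) - 1)| ≤ A⁻¹ * (2 * M * B) * maj y := by
      calc |2 * Q y * (φ (A⁻¹ * y.1) - 1)| = 2 * |Q y| * |φ (A⁻¹ * y.1) - 1| := by
            rw [abs_mul, abs_mul, abs_two]
        _ ≤ 2 * |Q y| * (M * |A⁻¹ * y.1|) := by gcongr; exact hM _
        _ = A⁻¹ * (2 * M) * |y.1 * Q y| := by
            rw [abs_mul, abs_mul, abs_of_pos ha0]; ring
        _ ≤ A⁻¹ * (2 * M) * (B * maj y) := by gcongr; exact hB y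
        _ = _ := by ring
    have k1 := h₁ A hA y
    have k2 := h₂ A hA y
    have k3 := h₃ A hA y
    have hst := strip_nonneg A y
    have ha2 : A⁻¹ ^ 2 ≤ 1 := pow_le_one₀ ha0.le ha1
    set X₁ := (3 * d1 (scalingGen Q) y + prim (d2 (d2 (scalingGen Q))) y
              + (3 * Q y ^ 2 - 1) * bigF Q y) * deriv φ (A⁻¹ * y.1)
    set X₂ := scalingGen Q y * deriv (deriv φ) (A⁻¹ * y.1)
    set X₃ := bigF Q y * deriv (deriv (deriv φ)) (A⁻¹ * y.1)
    have e2 : |A⁻¹ * (X₁ + 3 * A⁻¹ * X₂ + A⁻¹ ^ 2 * X₃)|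
        ≤ A⁻¹ * (D₁ + 3 * D₂ + D₃) * strip A y := by
      rw [abs_mul, abs_of_pos ha0, mul_assoc A⁻¹ (D₁ + 3 * D₂ + D₃)]
      refine mul_le_mul_of_nonneg_left ?_ ha0.le
      refine (abs_add_three _ _ _).trans ?_
      rw [abs_mul (3 * A⁻¹), abs_mul (A⁻¹ ^ 2), abs_of_pos (mul_pos three_pos ha0),
        abs_of_pos (pow_pos ha0 2), add_mul, add_mul]
      have t2 : 3 * A⁻¹ * |X₂| ≤ 3 * 1 * (D₂ * strip A y) := by gcongr
      have t3 : A⁻¹ ^ 2 * |X₃| ≤ 1 * (D₃ * strip A y) := by gcongr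
      linarith
    calc _ = |2 * Q y * (φ (A⁻¹ * y.1) - 1) + A⁻¹ * (X₁ + 3 * A⁻¹ * X₂ + A⁻¹ ^ 2 * X₃)| := by
          congr 1; ring
      _ ≤ _ := (abs_add_le _ _).trans (add_le_add e1 e2)
  · have n1 := l2Norm_nonneg maj
    have n2 := stripConst_nonneg
    have n3 := l2Norm_nonneg e
    have q1 := inv_le_inv_sqrt hA
    have q2 := inv_mul_sqrt hA
    calc _ = l2Norm e * (A⁻¹ * (2 * M * B * l2Norm maj)
          + A⁻¹ * √A * ((D₁ + 3 * D₂ + D₃) * stripConst)) := by ring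
      _ ≤ l2Norm e * ((√A)⁻¹ * (2 * M * B * l2Norm maj)
          + (√A)⁻¹ * ((D₁ + 3 * D₂ + D₃) * stripConst)) := by rw [q2]; gcongr
      _ = _ := by ring

/-- ∂₁(Fφ_A) = ΛQ φ_A + A⁻¹Fφ'. The first term decays, and the A⁻¹ of the second beats the √A of the
strip, so both norms are bounded uniformly in A. -/
lemma IsGroundState.exists_d1_probe_le (hQ : IsGroundState Q) (hφ : IsCutoff φ) :
    ∃ C, 0 ≤ C ∧ ∀ A : ℝ, 1 ≤ A → (∀ y, |d1 (probe Q φ A) y| ≤ C) ∧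
      l2Norm (d1 (probe Q φ A)) ≤ C := by
  have hS := hQ.rapid_scalingGen
  obtain ⟨M, m0, hM, -⟩ := abs_one_sub_cutoff_le hφ
  obtain ⟨M', m'0, hM'⟩ := hφ.isStep.deriv.bounded
  obtain ⟨B, b0, hB⟩ := hS.abs_le_maj
  obtain ⟨B', b'0, hB'⟩ := hQ.sndDecay_bigF.bounded
  obtain ⟨D, d0, hD⟩ := hQ.sndDecay_bigF.mul_deriv_step hφ.isStep
  have n1 := l2Norm_nonneg maj
  have n2 := stripConst_nonneg
  refine ⟨(B' * M' + B * M) + (M * B * l2Norm maj + D * stripConst), by positivity,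
    fun A hA => ?_⟩
  have hA0 : 0 < A := by linarith
  have ha0 : 0 < A⁻¹ := inv_pos.2 hA0
  have ha1 : A⁻¹ ≤ 1 := inv_le_one_of_one_le₀ hA
  constructor
  · intro y
    have h1 : |d1 (probe Q φ A) y| ≤ B' * M' + B * M := by
      rw [hQ.d1_probe hφ]
      refine (abs_add_le _ _).trans ?_
      rw [abs_mul, abs_mul, abs_mul, abs_of_pos ha0]
      have t1 : A⁻¹ * (|bigF Q y| * |deriv φ (A⁻¹ * y.1)|) ≤ 1 * (B' * M') := by
        gcongr
        · exact hB' y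
        · exact hM' _
      have t2 : |scalingGen Q y| * |φ (A⁻¹ * y.1)| ≤ B * M := by
        gcongr
        · exact (hB y).trans (mul_le_of_le_one_right b0 (maj_le_one y))
        · exact hM _
      linarith
    have : 0 ≤ M * B * l2Norm maj + D * stripConst := by positivity
    linarith
  · have h2 : l2Norm (d1 (probe Q φ A)) ≤ M * B * l2Norm maj + A⁻¹ * D * (√A * stripConst) := by
      refine l2Norm_le_maj_strip hA0.le (by positivity) (by positivity) fun y => ?_
      rw [hQ.d1_probe hφ]
      refine (abs_add_le _ _).trans ?_
      rw [abs_mul A⁻¹, abs_mul (scalingGen Q y), abs_of_pos ha0]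
      have t2 : |scalingGen Q y| * |φ (A⁻¹ * y.1)| ≤ (B * maj y) * M := by
        gcongr
        · exact mul_nonneg b0 (maj_pos y).le
        · exact hB y
        · exact hM _
      have t1 : A⁻¹ * |bigF Q y * deriv φ (A⁻¹ * y.1)| ≤ A⁻¹ * (D * strip A y) := by
        gcongr; exact hD A hA y
      linarith
    have h3 : A⁻¹ * D * (√A * stripConst) ≤ D * stripConst := by
      calc _ = (A⁻¹ * √A) * (D * stripConst) := by ring
        _ ≤ 1 * (D * stripConst) := by
            rw [inv_mul_sqrt hA]; gcongr; exact inv_sqrt_le_one hA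
        _ = _ := one_mul _
    have : 0 ≤ B' * M' + B * M := by positivity
    linarith

lemma IsGroundState.exists_nonlinear_le (hQ : IsGroundState Q) (hφ : IsCutoff φ) :
    ∃ C, 0 ≤ C ∧ ∀ A : ℝ, 1 ≤ A → ∀ e : ℝ × ℝ → ℝ, MemH1 e →
      |(∫ y, e y ^ 3 * d1 (probe Q φ A) y) + 3 * ∫ y, e y ^ 2 * (Q y * d1 (probe Q φ A) y)|
        ≤ C * (l2Norm e ^ 2 + l2Norm e ^ 2 * h1Norm e) := by
  obtain ⟨K, k0, hK⟩ := exists_cube_le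
  obtain ⟨C, c0, hC⟩ := hQ.exists_d1_probe_le hφ
  obtain ⟨B, b0, hB⟩ := hQ.rapid.bounded
  refine ⟨C * K + 3 * (B * C), by positivity, fun A hA e he => ?_⟩
  have h1 := abs_integral_mul_le_of_bounded he.integrable_cube (hC A hA).1
  have h2 := abs_integral_mul_le_of_bounded he.1.integrable_sq (C := B * C)
    (h := fun y => Q y * d1 (probe Q φ A) y) (fun y => by
      rw [abs_mul]
      exact mul_le_mul (hB y) ((hC A hA).1 y) (abs_nonneg _) b0)
  simp only [abs_pow] at h1
  simp only [abs_pow, sq_abs] at h2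
  rw [← l2Norm_sq he.1] at h2
  have h3 := mul_le_mul_of_nonneg_left (hK e he) c0
  refine (abs_add_le _ _).trans ?_
  rw [abs_mul, abs_of_pos (by norm_num : (0 : ℝ) < 3)]
  have n1 : 0 ≤ C * K * l2Norm e ^ 2 := by positivity
  have n2 : 0 ≤ B * C * (l2Norm e ^ 2 * h1Norm e) := by
    have := h1Norm_nonneg e
    positivity
  nlinarith

/-- Since ∫ QΛQ = 0, the part without ε is O(A⁻¹). Subtracting ∫ εQ, itself O(‖ε‖₂), only matches
the form of the main term. -/
lemma IsGroundState.exists_shift_le (hQ : IsGroundState Q) (hφ : IsCutoff φ) :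
    ∃ C, 0 ≤ C ∧ ∀ A : ℝ, 1 ≤ A → ∀ e : ℝ × ℝ → ℝ, MemLp e 2 volume →
      |(∫ y, (e y + Q y) * d1 (probe Q φ A) y) - ∫ y, e y * Q y| ≤ C * (A⁻¹ + l2Norm e) := by
  have hS := hQ.rapid_scalingGen
  obtain ⟨M, m0, -, hM⟩ := abs_one_sub_cutoff_le hφ
  obtain ⟨M', m'0, hM'⟩ := hφ.isStep.deriv.bounded
  obtain ⟨B', b'0, hB'⟩ := hQ.sndDecay_bigF.bounded
  obtain ⟨C, c0, hC⟩ := hQ.exists_d1_probe_le hφ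
  have n1 := l2Norm_nonneg Q
  have n2 : 0 ≤ ∫ y, |Q y| := integral_nonneg fun y => abs_nonneg _
  have n3 : 0 ≤ ∫ y : ℝ × ℝ, |y.1 * (Q y * scalingGen Q y)| := integral_nonneg fun y => abs_nonneg _
  refine ⟨(C + l2Norm Q) + (B' * M' * (∫ y, |Q y|)
    + M * ∫ y : ℝ × ℝ, |y.1 * (Q y * scalingGen Q y)|), by positivity, fun A hA e he => ?_⟩
  have hA0 : 0 < A := by linarith
  have ha0 : 0 < A⁻¹ := inv_pos.2 hA0
  have hk : Rapid (d1 (probe Q φ A)) := (hQ.rapid_probe hφ hA0).d1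
  have h1 : |∫ y, e y * d1 (probe Q φ A) y| ≤ l2Norm e * C :=
    (abs_integral_mul_le he hk.memLp).trans
      (mul_le_mul_of_nonneg_left (hC A hA).2 (l2Norm_nonneg e))
  have h2 := abs_integral_mul_le he hQ.rapid.memLp
  have h3 := abs_integral_mul_cutoff_sub_one_le hM hA0 (hQ.rapid.mul hS).fst_mul.integrable
  have h4 : |∫ y, Q y * (bigF Q y * deriv φ (A⁻¹ * y.1))| ≤ B' * M' * ∫ y, |Q y| :=
    abs_integral_mul_le_of_bounded hQ.rapid.integrable fun y => by
      rw [abs_mul]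
      exact mul_le_mul (hB' y) (hM' _) (abs_nonneg _) b'0
  have i1 : Integrable fun y => Q y * (bigF Q y * deriv φ (A⁻¹ * y.1)) :=
    (hQ.rapid.mul (hS.prim_mul_step hφ.isStep.deriv ha0)).integrable
  have i2 : Integrable fun y => Q y * (scalingGen Q y * φ (A⁻¹ * y.1)) :=
    (hQ.rapid.mul (hS.mul_step hφ.isStep ha0)).integrable
  have i3 : Integrable fun y => Q y * scalingGen Q y := (hQ.rapid.mul hS).integrable
  have e1 : ∫ y, (e y + Q y) * d1 (probe Q φ A) y
      = (∫ y, e y * d1 (probe Q φ A) y) + ∫ y, Q y * d1 (probe Q φ A) y := by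
    have i0 : Integrable fun y => e y * d1 (probe Q φ A) y := he.integrable_mul hk.memLp
    rw [← integral_add i0 (hQ.rapid.mul hk).integrable]
    congr 1; funext y; ring
  have e2 : ∫ y, Q y * d1 (probe Q φ A) y = A⁻¹ * (∫ y, Q y * (bigF Q y * deriv φ (A⁻¹ * y.1)))
      + ∫ y, Q y * (scalingGen Q y * φ (A⁻¹ * y.1)) := by
    rw [← integral_const_mul, ← integral_add (i1.const_mul _) i2, hQ.d1_probe hφ]
    congr 1; funext y; ring
  have e3 : ∫ y, Q y * (scalingGen Q y * φ (A⁻¹ * y.1))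
      = ∫ y, Q y * scalingGen Q y * (φ (A⁻¹ * y.1) - 1) := by
    have h0 := hQ.rapid.integral_mul_scalingGen_self
    have hsub : ∫ y, Q y * scalingGen Q y * (φ (A⁻¹ * y.1) - 1)
        = (∫ y, Q y * (scalingGen Q y * φ (A⁻¹ * y.1))) - ∫ y, Q y * scalingGen Q y := by
      rw [← integral_sub i2 i3]; congr 1; funext y; ring
    rw [hsub, h0, sub_zero]
  rw [e1, e2, e3]
  have h5 : |A⁻¹ * ∫ y, Q y * (bigF Q y * deriv φ (A⁻¹ * y.1))|
      ≤ A⁻¹ * (B' * M' * ∫ y, |Q y|) := by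
    rw [abs_mul, abs_of_pos ha0]
    exact mul_le_mul_of_nonneg_left h4 ha0.le
  have n4 := l2Norm_nonneg e
  have p1 : 0 ≤ A⁻¹ * (C + l2Norm Q) := by positivity
  have p2 : 0 ≤ l2Norm e * (B' * M' * (∫ y, |Q y|)
    + M * ∫ y : ℝ × ℝ, |y.1 * (Q y * scalingGen Q y)|) := by positivity
  rw [abs_le] at *
  constructor <;> nlinarith

/-- In Λψ = ψ + y₁∂₁ψ + y₂∂₂ψ, the first term yields J_A and the last the integral with y₂F_{y₂}. Of
y₁∂₁ψ, the ΛQ part is harmless and the φ' part lives where y₁ ≥ A. -/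
lemma IsGroundState.exists_scale_le (hQ : IsGroundState Q) (hφ : IsCutoff φ) :
    ∃ C, 0 ≤ C ∧ ∀ A : ℝ, 1 ≤ A → ∀ e : ℝ × ℝ → ℝ, MemLp e 2 volume →
      |(∫ y, (e y + Q y) * scalingGen (probe Q φ A) y) - (∫ y, e y * probe Q φ A y) + kappa Q
        - ∫ y : ℝ × ℝ, y.2 * d2 (bigF Q) y * e y * cutoff φ A y|
        ≤ C * (A⁻¹ + l2Norm e + √A * l2NormOn {y | A ≤ y.1} e) := by
  have hS := hQ.rapid_scalingGen
  obtain ⟨M, m0, hMb, hM⟩ := abs_one_sub_cutoff_le hφ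
  obtain ⟨D, d0, hD⟩ := hQ.sndDecay_bigF.mul_deriv_step hφ.isStep
  have n1 := l2Norm_nonneg (fun y => y.1 * scalingGen Q y)
  have n2 := stripConst_nonneg
  have n3 : 0 ≤ ∫ y : ℝ × ℝ, |y.1 * (scalingGen Q y * bigF Q y)| :=
    integral_nonneg fun y => abs_nonneg _
  refine ⟨M * l2Norm (fun y => y.1 * scalingGen Q y) + 2 * D * stripConst
    + M * ∫ y : ℝ × ℝ, |y.1 * (scalingGen Q y * bigF Q y)|, by positivity, fun A hA e he => ?_⟩
  have hA0 : 0 < A := by linarith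
  have ha0 : 0 < A⁻¹ := inv_pos.2 hA0
  have hψ := hQ.rapid_probe hφ hA0
  have r1 : Rapid fun y => y.1 * (bigF Q y * deriv φ (A⁻¹ * y.1)) :=
    (hS.prim_mul_step hφ.isStep.deriv ha0).fst_mul
  have r2 : Rapid fun y => y.1 * (scalingGen Q y * φ (A⁻¹ * y.1)) :=
    (hS.mul_step hφ.isStep ha0).fst_mul
  have r3 : Rapid fun y => y.2 * (d2 (bigF Q) y * φ (A⁻¹ * y.1)) := by
    rw [hQ.d2_bigF]
    exact (hS.d2.prim_mul_step hφ.isStep ha0).snd_mul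
  have j0 : Integrable fun y => e y * probe Q φ A y := he.integrable_mul hψ.memLp
  have j1 : Integrable fun y => e y * (A⁻¹ * (y.1 * (bigF Q y * deriv φ (A⁻¹ * y.1)))) :=
    he.integrable_mul (r1.const_mul A⁻¹).memLp
  have j2 : Integrable fun y => e y * (y.1 * (scalingGen Q y * φ (A⁻¹ * y.1))) :=
    he.integrable_mul r2.memLp
  have j3 : Integrable fun y : ℝ × ℝ => y.2 * d2 (bigF Q) y * e y * cutoff φ A y := by
    refine (he.integrable_mul r3.memLp).congr (ae_of_all _ fun y => ?_)
    simp only [Pi.mul_apply, cutoff_eq]; ring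
  have j4 : Integrable fun y => Q y * scalingGen (probe Q φ A) y :=
    (hQ.rapid.mul hψ.scalingGen).integrable
  have e1 : ∫ y, (e y + Q y) * scalingGen (probe Q φ A) y
      = (∫ y, e y * probe Q φ A y)
        + (∫ y, e y * (A⁻¹ * (y.1 * (bigF Q y * deriv φ (A⁻¹ * y.1)))))
        + (∫ y, e y * (y.1 * (scalingGen Q y * φ (A⁻¹ * y.1))))
        + (∫ y : ℝ × ℝ, y.2 * d2 (bigF Q) y * e y * cutoff φ A y)
        + ∫ y, Q y * scalingGen (probe Q φ A) y := by
    have j01 : Integrable fun y => e y * probe Q φ A y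
      + e y * (A⁻¹ * (y.1 * (bigF Q y * deriv φ (A⁻¹ * y.1)))) := j0.add j1
    have j02 : Integrable fun y => e y * probe Q φ A y
      + e y * (A⁻¹ * (y.1 * (bigF Q y * deriv φ (A⁻¹ * y.1))))
      + e y * (y.1 * (scalingGen Q y * φ (A⁻¹ * y.1))) := j01.add j2
    have j03 : Integrable fun y => e y * probe Q φ A y
      + e y * (A⁻¹ * (y.1 * (bigF Q y * deriv φ (A⁻¹ * y.1))))
      + e y * (y.1 * (scalingGen Q y * φ (A⁻¹ * y.1)))
      + y.2 * d2 (bigF Q) y * e y * cutoff φ A y := j02.add j3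
    rw [← integral_add j0 j1, ← integral_add j01 j2, ← integral_add j02 j3,
      ← integral_add j03 j4]
    congr 1; funext y
    have hpt : scalingGen (probe Q φ A) y = probe Q φ A y
        + A⁻¹ * (y.1 * (bigF Q y * deriv φ (A⁻¹ * y.1)))
        + y.1 * (scalingGen Q y * φ (A⁻¹ * y.1)) + y.2 * (d2 (bigF Q) y * φ (A⁻¹ * y.1)) := by
      rw [scalingGen, hQ.d1_probe hφ, hQ.d2_probe hφ]; ring
    rw [add_mul, cutoff_eq]
    nth_rw 1 [hpt]
    ring
  -- Antisymmetry of Λ turns the first integral into −∫ ΛQ F φ_A, which would be −κ without the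
  -- cutoff.
  have e2 : (∫ y, Q y * scalingGen (probe Q φ A) y) + kappa Q
      = - ∫ y, scalingGen Q y * bigF Q y * (φ (A⁻¹ * y.1) - 1) := by
    rw [hQ.rapid.integral_mul_scalingGen hψ, ← hQ.integral_scalingGen_mul_bigF]
    have i1 : Integrable fun y => scalingGen Q y * probe Q φ A y := (hS.mul hψ).integrable
    have hsub : ∫ y, scalingGen Q y * bigF Q y * (φ (A⁻¹ * y.1) - 1)
        = (∫ y, scalingGen Q y * probe Q φ A y) - ∫ y, scalingGen Q y * bigF Q y := by
      have i2 : Integrable fun y => scalingGen Q y * bigF Q y := hS.integrable_mul_prim hS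
      rw [← integral_sub i1 i2]
      congr 1; funext y; rw [probe]; ring
    rw [hsub]; ring
  have h1 : |∫ y, e y * (y.1 * (scalingGen Q y * φ (A⁻¹ * y.1)))|
      ≤ l2Norm e * (M * l2Norm fun y => y.1 * scalingGen Q y) := by
    refine (abs_integral_mul_le he r2.memLp).trans
      (mul_le_mul_of_nonneg_left ?_ (l2Norm_nonneg e))
    have hc := l2Norm_const_mul M fun y => y.1 * scalingGen Q y
    rw [abs_of_nonneg m0] at hc
    rw [← hc]
    refine l2Norm_le_of_abs_le (hS.fst_mul.const_mul M).memLp fun y => ?_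
    rw [← mul_assoc, abs_mul, abs_mul M, abs_of_nonneg m0, mul_comm]
    exact mul_le_mul_of_nonneg_right (hMb _) (abs_nonneg _)
  -- φ' vanishes for y₁ ≤ A, so only ε on {y₁ ≥ A} enters; y₁/A ≤ 2 on the strip absorbs the
  -- coordinate, at the price of √A.
  have h2 : |∫ y, e y * (A⁻¹ * (y.1 * (bigF Q y * deriv φ (A⁻¹ * y.1))))|
      ≤ l2NormOn {y | A ≤ y.1} e * (2 * D * (√A * stripConst)) := by
    set k : ℝ × ℝ → ℝ := fun y => A⁻¹ * (y.1 * (bigF Q y * deriv φ (A⁻¹ * y.1))) with hkdef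
    have hk : MemLp k 2 volume := (r1.const_mul A⁻¹).memLp
    have hzero : ∀ y, y ∉ {y : ℝ × ℝ | A ≤ y.1} → e y * k y = 0 := fun y hy => by
      have : deriv φ (A⁻¹ * y.1) = 0 := by
        rw [inv_mul_eq_div]
        exact hφ.isStep.deriv_left ((div_le_one hA0).2 (not_le.1 hy).le)
      simp [hkdef, this]
    change |∫ y, e y * k y| ≤ _
    rw [← setIntegral_eq_integral_of_forall_compl_eq_zero hzero]
    refine (abs_integral_mul_le_l2NormOn _ (he.mono_measure Measure.restrict_le_self)
      (hk.mono_measure Measure.restrict_le_self)).trans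
      (mul_le_mul_of_nonneg_left ?_ (l2NormOn_nonneg _ _))
    refine (l2NormOn_le_l2Norm _ hk).trans ?_
    have hb := l2Norm_le_maj_strip (k := k) hA0.le le_rfl (by positivity : 0 ≤ 2 * D) fun y => by
      rw [zero_mul, zero_add]
      have hD' := hD A hA y
      by_cases hy : y.1 ∈ Icc A (2 * A)
      · have hy1 : |A⁻¹ * y.1| ≤ 2 := by
          rw [abs_of_nonneg (mul_nonneg ha0.le (hA0.le.trans hy.1)), inv_mul_le_iff₀ hA0]
          linarith [hy.2]
        calc |k y| = |A⁻¹ * y.1| * |bigF Q y * deriv φ (A⁻¹ * y.1)| := by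
              rw [← abs_mul, hkdef]; congr 1; ring
          _ ≤ 2 * (D * strip A y) := by gcongr
          _ = _ := by ring
      · have hst : strip A y = 0 := by simp [strip, hy]
        rw [hst, mul_zero] at hD'
        have h0 : bigF Q y * deriv φ (A⁻¹ * y.1) = 0 := abs_nonpos_iff.1 hD'
        rw [hst, mul_zero, hkdef]
        simp only [h0, mul_zero, abs_zero, le_refl]
    rwa [zero_mul, zero_add] at hb
  have i5 : Integrable fun y : ℝ × ℝ => y.1 * (scalingGen Q y * bigF Q y) :=
    (hS.fst_mul.integrable_mul_prim hS).congr (ae_of_all _ fun y => mul_assoc _ _ _)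
  have h3 := abs_integral_mul_cutoff_sub_one_le hM hA0 i5
  have n4 := l2Norm_nonneg e
  have n5 := l2NormOn_nonneg {y : ℝ × ℝ | A ≤ y.1} e
  have n6 := Real.sqrt_nonneg A
  set I₁ := ∫ y, e y * (A⁻¹ * (y.1 * (bigF Q y * deriv φ (A⁻¹ * y.1))))
  set I₂ := ∫ y, e y * (y.1 * (scalingGen Q y * φ (A⁻¹ * y.1)))
  set I₃ := ∫ y, scalingGen Q y * bigF Q y * (φ (A⁻¹ * y.1) - 1)
  set P := M * l2Norm fun y => y.1 * scalingGen Q y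
  set T := M * ∫ y : ℝ × ℝ, |y.1 * (scalingGen Q y * bigF Q y)|
  have hP : 0 ≤ P := by positivity
  have hT : 0 ≤ T := by positivity
  have hkey : (∫ y, (e y + Q y) * scalingGen (probe Q φ A) y) - (∫ y, e y * probe Q φ A y)
      + kappa Q - ∫ y : ℝ × ℝ, y.2 * d2 (bigF Q) y * e y * cutoff φ A y = I₁ + I₂ + -I₃ := by
    rw [e1, ← e2]; ring
  rw [hkey]
  refine (abs_add_three _ _ _).trans ?_
  rw [abs_neg]
  have z1 : 0 ≤ P * (A⁻¹ + √A * l2NormOn {y : ℝ × ℝ | A ≤ y.1} e) := by positivity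
  have z2 : 0 ≤ 2 * D * stripConst * (A⁻¹ + l2Norm e) := by positivity
  have z3 : 0 ≤ T * (l2Norm e + √A * l2NormOn {y : ℝ × ℝ | A ≤ y.1} e) := by positivity
  linarith

/-- The linear and nonlinear terms of the flow at `e + Q`, expanded around the ground state. -/
lemma IsGroundState.integral_expand (hQ : IsGroundState Q) {e k : ℝ × ℝ → ℝ} (he : MemH1 e)
    (hk : Rapid k) :
    (∫ y, (e y + Q y) * lap k y) + (∫ y, (e y + Q y) ^ 3 * k y) - ∫ y, (e y + Q y) * k y
      = (∫ y, e y * (lap k y + 3 * Q y ^ 2 * k y - k y))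
        + ((∫ y, e y ^ 3 * k y) + 3 * ∫ y, e y ^ 2 * (Q y * k y)) := by
  obtain ⟨B, b0, hB⟩ := hk.bounded
  obtain ⟨B', b'0, hB'⟩ := (hQ.rapid.mul hk).bounded
  have hK : Rapid fun y => 3 * Q y ^ 2 * k y := by
    simpa only [sq] using ((hQ.rapid.mul hQ.rapid).const_mul 3).mul hk
  have hQ3 : Rapid fun y => Q y ^ 3 * k y := by
    have h := ((hQ.rapid.mul hQ.rapid).mul hQ.rapid).mul hk
    have hc : ∀ y, Q y ^ 3 * k y = Q y * Q y * Q y * k y := fun y => by ring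
    simpa only [hc] using h
  have a1 : Integrable fun y => e y * lap k y := he.1.integrable_mul hk.lap.memLp
  have a2 : Integrable fun y => e y * (3 * Q y ^ 2 * k y) := he.1.integrable_mul hK.memLp
  have a3 : Integrable fun y => e y * k y := he.1.integrable_mul hk.memLp
  have a4 : Integrable fun y => e y ^ 3 * k y :=
    integrable_mul_bounded he.integrable_cube hk.continuous hB
  have a5 : Integrable fun y => e y ^ 2 * (Q y * k y) :=
    integrable_mul_bounded he.1.integrable_sq (hQ.rapid.mul hk).continuous hB'
  have b1 := (hQ.rapid.mul hk.lap).integrable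
  have b3 := (hQ.rapid.mul hk).integrable
  -- The ground state equation tested against k.
  have hzero : (∫ y, Q y * lap k y) + (∫ y, Q y ^ 3 * k y) - ∫ y, Q y * k y = 0 := by
    have c1 := (hQ.rapid.lap.mul hk).integrable
    have c2 : Integrable fun y => lap Q y * k y + Q y ^ 3 * k y := c1.add hQ3.integrable
    rw [hQ.rapid.integral_mul_lap hk, ← integral_add c1 hQ3.integrable, ← integral_sub c2 b3]
    refine integral_eq_zero_of_ae (ae_of_all _ fun y => ?_)
    have h := hQ.eq y
    simp only [Pi.zero_apply]
    linear_combination -k y * h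
  have t1 : ∫ y, (e y + Q y) * lap k y = (∫ y, e y * lap k y) + ∫ y, Q y * lap k y := by
    rw [← integral_add a1 b1]; congr 1; funext y; ring
  have t3 : ∫ y, (e y + Q y) * k y = (∫ y, e y * k y) + ∫ y, Q y * k y := by
    rw [← integral_add a3 b3]; congr 1; funext y; ring
  have t2 : ∫ y, (e y + Q y) ^ 3 * k y = (∫ y, e y ^ 3 * k y)
      + (∫ y, 3 * (e y ^ 2 * (Q y * k y))) + (∫ y, e y * (3 * Q y ^ 2 * k y))
      + ∫ y, Q y ^ 3 * k y := by
    have a45 : Integrable fun y => e y ^ 3 * k y + 3 * (e y ^ 2 * (Q y * k y)) :=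
      a4.add (a5.const_mul 3)
    have a452 : Integrable fun y => e y ^ 3 * k y + 3 * (e y ^ 2 * (Q y * k y))
      + e y * (3 * Q y ^ 2 * k y) := a45.add a2
    rw [← integral_add a4 (a5.const_mul 3), ← integral_add a45 a2,
      ← integral_add a452 hQ3.integrable]
    congr 1; funext y; ring
  have t4 : ∫ y, e y * (lap k y + 3 * Q y ^ 2 * k y - k y)
      = (∫ y, e y * lap k y) + (∫ y, e y * (3 * Q y ^ 2 * k y)) - ∫ y, e y * k y := by
    have a12 : Integrable fun y => e y * lap k y + e y * (3 * Q y ^ 2 * k y) := a1.add a2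
    rw [← integral_add a1 a2, ← integral_sub a12 a3]
    congr 1; funext y; ring
  rw [t1, t2, t3, t4, integral_const_mul]
  linear_combination hzero

end Probe

/-! ### The virial functional as a pairing with a Schwartz function. -/

section Virial

variable {Q : ℝ × ℝ → ℝ} {φ : ℝ → ℝ} {u : ℝ → ℝ × ℝ → ℝ} {lam x : ℝ → ℝ} {A : ℝ}

lemma eps_add (Q : ℝ × ℝ → ℝ) (u : ℝ → ℝ × ℝ → ℝ) (lam x : ℝ → ℝ) (s : ℝ) (y : ℝ × ℝ) :
    eps Q u lam x s y + Q y = pull u lam x s y := by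
  rw [eps, pull]; ring

lemma virial_eq_integral_mul_probe (s : ℝ) :
    virial Q φ u lam x A s = ∫ y, eps Q u lam x s y * probe Q φ A y := by
  simp only [virial, cutoff_eq, probe, mul_assoc]

/-- The contribution of Q does not depend on s, so differentiating J_A means differentiating a
pairing of the rescaled solution. -/
lemma virial_eq (hQ : IsGroundState Q) (hφ : IsCutoff φ) (hA : 0 < A) {s : ℝ}
    (he : MemH1 (eps Q u lam x s)) :
    virial Q φ u lam x A s = (∫ y, pull u lam x s y * probe Q φ A y) - ∫ y, Q y * probe Q φ A y := by
  have hψ := hQ.rapid_probe hφ hA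
  have i1 : Integrable fun y => eps Q u lam x s y * probe Q φ A y :=
    he.1.integrable_mul hψ.memLp
  have h : ∫ y, pull u lam x s y * probe Q φ A y
      = (∫ y, eps Q u lam x s y * probe Q φ A y) + ∫ y, Q y * probe Q φ A y := by
    rw [← integral_add i1 (hQ.rapid.mul hψ).integrable]
    congr 1; funext y; rw [← eps_add Q]; ring
  rw [h, virial_eq_integral_mul_probe, add_sub_cancel_right]

/-- The derivative of the virial functional, in terms of the rescaled solution. -/
def virialDeriv (Q : ℝ × ℝ → ℝ) (φ : ℝ → ℝ) (u : ℝ → ℝ × ℝ → ℝ) (lam x : ℝ → ℝ) (A s : ℝ) : ℝ :=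
  (∫ y, pull u lam x s y * d1 (lap (probe Q φ A)) y)
    + (∫ y, pull u lam x s y ^ 3 * d1 (probe Q φ A) y)
    - scaleRate lam s * (∫ y, pull u lam x s y * scalingGen (probe Q φ A) y)
    - (shiftRate lam x s + 1) * ∫ y, pull u lam x s y * d1 (probe Q φ A) y

lemma hasDerivWithinAt_virial (hQ : IsGroundState Q) (hφ : IsCutoff φ) (hf : IsFrame lam x)
    (hu : IsH1Solution u) (he : ∀ s, 0 ≤ s → MemH1 (eps Q u lam x s)) (hA : 0 < A) {s : ℝ}
    (hs : 0 ≤ s) :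
    HasDerivWithinAt (virial Q φ u lam x A) (virialDeriv Q φ u lam x A s) (Ici 0) s :=
  ((hf.hasDerivWithinAt_pairing hu (hQ.rapid_probe hφ hA) hs).sub_const _).congr
    (fun r hr => virial_eq hQ hφ hA (he r hr)) (virial_eq hQ hφ hA (he s hs))

lemma continuousOn_virialDeriv (hQ : IsGroundState Q) (hφ : IsCutoff φ) (hf : IsFrame lam x)
    (hu : IsH1Solution u) (hA : 0 < A) : ContinuousOn (virialDeriv Q φ u lam x A) (Ici 0) := by
  have hψ := hQ.rapid_probe hφ hA
  exact (((hf.continuousOn_pairing hu hψ.lap.d1).add (hf.continuousOn_cube_pairing hu hψ.d1)).sub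
    (hf.continuousOn_scaleRate.mul (hf.continuousOn_pairing hu hψ.scalingGen))).sub
    ((hf.continuousOn_shiftRate.add continuousOn_const).mul (hf.continuousOn_pairing hu hψ.d1))

lemma contDiffOn_virial (hQ : IsGroundState Q) (hφ : IsCutoff φ) (hf : IsFrame lam x)
    (hu : IsH1Solution u) (he : ∀ s, 0 ≤ s → MemH1 (eps Q u lam x s)) (hA : 0 < A) :
    ContDiffOn ℝ 1 (virial Q φ u lam x A) (Ici 0) := by
  have hd := fun s (hs : s ∈ Ici (0 : ℝ)) =>
    hasDerivWithinAt_virial hQ hφ hf hu he hA (mem_Ici.1 hs)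
  refine (contDiffOn_one_iff_derivWithin (uniqueDiffOn_Ici 0)).2
    ⟨fun s hs => (hd s hs).differentiableWithinAt, ?_⟩
  exact (continuousOn_virialDeriv hQ hφ hf hu hA).congr fun s hs =>
    (hd s hs).derivWithin (uniqueDiffOn_Ici 0 s hs)

end Virial

end ZK

/-! ### Assembly of the identity and the remainder bound. -/

theorem lemma6p1 (Q : ℝ × ℝ → ℝ) (hQ : ZK.IsGroundState Q) (φ : ℝ → ℝ) (hφ : ZK.IsCutoff φ) :
    ∃ C₃ : ℝ, 0 < C₃ ∧
      ∀ (u : ℝ → ℝ × ℝ → ℝ) (lam x : ℝ → ℝ),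
        ZK.IsH1Solution u →
        ContDiffOn ℝ 1 lam (Ici 0) → ContDiffOn ℝ 1 x (Ici 0) →
        (∀ s, 0 ≤ s → 0 < lam s) →
        (∀ s, 0 ≤ s → ZK.MemH1 (ZK.eps Q u lam x s)) →
        ∀ A : ℝ, 1 ≤ A →
          ContDiffOn ℝ 1 (ZK.virial Q φ u lam x A) (Ici 0) ∧
          ∃ R : ℝ → ℝ, ∀ s : ℝ, 0 ≤ s →
            HasDerivWithinAt (ZK.virial Q φ u lam x A)
              (- ZK.scaleRate lam s * (ZK.virial Q φ u lam x A s - ZK.kappa Q)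
                + 2 * (1 - 1 / 2 * ZK.shiftRate lam x s) * (∫ y, ZK.eps Q u lam x s y * Q y)
                + R s) (Ici 0) s ∧
            |R s| ≤ C₃ *
              (ZK.l2Norm (ZK.eps Q u lam x s) ^ 2
                + ZK.l2Norm (ZK.eps Q u lam x s) ^ 2 * ZK.h1Norm (ZK.eps Q u lam x s)
                + A ^ (-(1 / 2) : ℝ) * ZK.l2Norm (ZK.eps Q u lam x s)
                + |ZK.shiftRate lam x s| * (A⁻¹ + ZK.l2Norm (ZK.eps Q u lam x s))
                + |ZK.scaleRate lam s| *
                  (A⁻¹ + ZK.l2Norm (ZK.eps Q u lam x s)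
                    + A ^ (1 / 2 : ℝ) *
                      ZK.l2NormOn {y : ℝ × ℝ | A ≤ y.1} (ZK.eps Q u lam x s)
                    + |∫ y : ℝ × ℝ, y.2 * ZK.d2 (ZK.bigF Q) y * ZK.eps Q u lam x s y
                        * ZK.cutoff φ A y|)) := by
  obtain ⟨c₁, c₁0, h₁⟩ := hQ.exists_linear_le hφ
  obtain ⟨c₂, c₂0, h₂⟩ := hQ.exists_nonlinear_le hφ
  obtain ⟨c₃, c₃0, h₃⟩ := hQ.exists_shift_le hφ
  obtain ⟨c₄, c₄0, h₄⟩ := hQ.exists_scale_le hφ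
  -- The summand 1 ensures positivity and covers the term |σ||∫ y₂F_{y₂}εφ_A|, which enters with
  -- coefficient 1.
  refine ⟨c₁ + c₂ + c₃ + c₄ + 1, by positivity, fun u lam x hu hlam hx hpos he A hA => ?_⟩
  have hf : ZK.IsFrame lam x := ⟨hlam, hx, hpos⟩
  have hA0 : 0 < A := by linarith
  -- R is defined as the defect in the identity, so all the content lies in its bound.
  refine ⟨ZK.contDiffOn_virial hQ hφ hf hu he hA0, fun s => ZK.virialDeriv Q φ u lam x A s
    - (- ZK.scaleRate lam s * (ZK.virial Q φ u lam x A s - ZK.kappa Q)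
      + 2 * (1 - 1 / 2 * ZK.shiftRate lam x s) * ∫ y, ZK.eps Q u lam x s y * Q y),
    fun s hs => ⟨(ZK.hasDerivWithinAt_virial hQ hφ hf hu he hA0 hs).congr_deriv (by ring), ?_⟩⟩
  have hes := he s hs
  have hψ := hQ.rapid_probe hφ hA0
  have b₁ := h₁ A hA _ hes.1
  have b₂ := h₂ A hA _ hes
  have b₃ := h₃ A hA _ hes.1
  have b₄ := h₄ A hA _ hes.1
  have hexp := hQ.integral_expand hes hψ.d1
  have hA1 : A ^ (1 / 2 : ℝ) = √A := (Real.sqrt_eq_rpow A).symm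
  have hA2 : A ^ (-(1 / 2) : ℝ) = (√A)⁻¹ := by rw [Real.rpow_neg hA0.le, hA1]
  beta_reduce
  rw [hA1, hA2, ZK.virialDeriv, ZK.virial_eq_integral_mul_probe, ZK.d1_lap hψ.contDiff]
  simp only [ZK.eps_add] at b₃ b₄ hexp
  have n₁ := ZK.l2Norm_nonneg (ZK.eps Q u lam x s)
  have n₂ := ZK.h1Norm_nonneg (ZK.eps Q u lam x s)
  have n₃ := ZK.l2NormOn_nonneg {y : ℝ × ℝ | A ≤ y.1} (ZK.eps Q u lam x s)
  have n₄ := Real.sqrt_nonneg A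
  have n₅ : 0 < A⁻¹ := inv_pos.2 hA0
  set N := ZK.l2Norm (ZK.eps Q u lam x s)
  set H := ZK.h1Norm (ZK.eps Q u lam x s)
  set Z := ZK.l2NormOn {y : ℝ × ℝ | A ≤ y.1} (ZK.eps Q u lam x s)
  set I := ∫ y : ℝ × ℝ, y.2 * ZK.d2 (ZK.bigF Q) y * ZK.eps Q u lam x s y * ZK.cutoff φ A y
  set P := ∫ y, ZK.eps Q u lam x s y * Q y
  set J := ∫ y, ZK.eps Q u lam x s y * ZK.probe Q φ A y
  set X₁ := (∫ y, ZK.eps Q u lam x s y * (ZK.lap (ZK.d1 (ZK.probe Q φ A)) y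
    + 3 * Q y ^ 2 * ZK.d1 (ZK.probe Q φ A) y - ZK.d1 (ZK.probe Q φ A) y)) - 2 * P with hX₁
  set X₂ := (∫ y, ZK.eps Q u lam x s y ^ 3 * ZK.d1 (ZK.probe Q φ A) y)
    + 3 * ∫ y, ZK.eps Q u lam x s y ^ 2 * (Q y * ZK.d1 (ZK.probe Q φ A) y)
  set X₃ := (∫ y, ZK.pull u lam x s y * ZK.d1 (ZK.probe Q φ A) y) - P with hX₃
  set X₄ := (∫ y, ZK.pull u lam x s y * ZK.scalingGen (ZK.probe Q φ A) y) - J + ZK.kappa Q - I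
    with hX₄
  set σ := ZK.scaleRate lam s
  set τ := ZK.shiftRate lam x s
  -- The unit part of τ + 1 supplies the −∫ vk used in `hexp`; what remains is one error term for
  -- each of the four estimates, plus σI.
  have hkey : (∫ y, ZK.pull u lam x s y * ZK.lap (ZK.d1 (ZK.probe Q φ A)) y)
      + (∫ y, ZK.pull u lam x s y ^ 3 * ZK.d1 (ZK.probe Q φ A) y)
      - σ * (∫ y, ZK.pull u lam x s y * ZK.scalingGen (ZK.probe Q φ A) y)
      - (τ + 1) * (∫ y, ZK.pull u lam x s y * ZK.d1 (ZK.probe Q φ A) y)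
      - (-σ * (J - ZK.kappa Q) + 2 * (1 - 1 / 2 * τ) * P)
      = X₁ + X₂ + (-(τ * X₃) + -(σ * (X₄ + I))) := by
    linear_combination hexp - hX₁ + τ * hX₃ + σ * hX₄
  have t₃ : |τ * X₃| ≤ c₃ * (|τ| * (A⁻¹ + N)) := by
    rw [abs_mul, mul_left_comm]
    exact mul_le_mul_of_nonneg_left b₃ (abs_nonneg τ)
  have t₄ : |σ * (X₄ + I)| ≤ |σ| * (c₄ * (A⁻¹ + N + √A * Z) + |I|) := by
    rw [abs_mul]
    exact mul_le_mul_of_nonneg_left ((abs_add_le _ _).trans (add_le_add_left b₄ _))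
      (abs_nonneg σ)
  have hsum : |X₁ + X₂ + (-(τ * X₃) + -(σ * (X₄ + I)))|
      ≤ c₁ * ((√A)⁻¹ * N) + c₂ * (N ^ 2 + N ^ 2 * H) + c₃ * (|τ| * (A⁻¹ + N))
        + |σ| * (c₄ * (A⁻¹ + N + √A * Z) + |I|) := by
    have q₁ := abs_add_le (X₁ + X₂) (-(τ * X₃) + -(σ * (X₄ + I)))
    have q₂ := abs_add_le X₁ X₂
    have q₃ := abs_add_le (-(τ * X₃)) (-(σ * (X₄ + I)))
    rw [abs_neg, abs_neg] at q₃
    linarith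
  rw [hkey]
  refine hsum.trans ?_
  have m₁ : 0 ≤ N ^ 2 + N ^ 2 * H := by positivity
  have m₂ : 0 ≤ (√A)⁻¹ * N := by positivity
  have m₃ : 0 ≤ |τ| * (A⁻¹ + N) := by positivity
  have m₄ : 0 ≤ |σ| * (A⁻¹ + N + √A * Z) := by positivity
  have m₅ : 0 ≤ |σ| * |I| := by positivity
  have w₁ : 0 ≤ (c₁ + c₃ + c₄ + 1) * (N ^ 2 + N ^ 2 * H) := by positivity
  have w₂ : 0 ≤ (c₂ + c₃ + c₄ + 1) * ((√A)⁻¹ * N) := by positivity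
  have w₃ : 0 ≤ (c₁ + c₂ + c₄ + 1) * (|τ| * (A⁻¹ + N)) := by positivity
  have w₄ : 0 ≤ (c₁ + c₂ + c₃ + 1) * (|σ| * (A⁻¹ + N + √A * Z)) := by positivity
  have w₅ : 0 ≤ (c₁ + c₂ + c₃ + c₄) * (|σ| * |I|) := by positivity
  linarith

end
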